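/- Consider $\mathbb R^9$ with coordinates $(t,x,y,z,u,v,w,\rho,P)$ and the vector fields $$X_1=\partial_x,\quad X_2=\partial_y,\quad X_3=\partial_z,\quad X_4=t\partial_x+\partial_u,\quad X_5=t\partial_y+\partial_v,\quad X_6=t\partial_z+\partial_w,$$ $$X_7=y\partial_z-z\partial_y+v\partial_w-w\partial_v,\quad X_8=z\partial_x-x\partial_z+w\partial_u-u\partial_w,\quad X_9=x\partial_y-y\partial_x+u\partial_v-v\partial_u,$$ $$X_{10}=\partial_t,\quad X_{11}=t\partial_t+x\partial_x+y\partial_y+z\partial_z,\quad Y=\partial_P .$$ Their real span $L_{12}$ is a 12-dimensional Lie algebra under the Lie bracket of vector fields. **Coordinates.** (C), cylindrical: $r,q>0$ and $y=r\cos\theta$, $z=r\sin\theta$, $v=V\cos\theta-W\sin\theta$, $w=V\sin\theta+W\cos\theta$, where $V=q\cos\vartheta$, $W=q\sin\vartheta$. (S), spherical: $r,q>0$, $0<\theta<\pi$, $0<\vartheta<\pi$ and $x=r\sin\theta\cos\phi$, $y=r\sin\theta\sin\phi$, $z=r\cos\theta$, $u=(U\sin\theta+V\cos\theta)\cos\phi-W\sin\phi$,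 $v=(U\sin\theta+V\cos\theta)\sin\phi+W\cos\phi$, $w=U\cos\theta-V\sin\theta$, where $U=q\cos\vartheta$, $V=q\sin\vartheta\cos\varphi$, $W=q\sin\vartheta\sin\varphi$. (D$_b$), Cartesian with auxiliary velocity variables $q,\vartheta$ and parameter $b$: $t^2+b^2\neq0$, $q\ne0$ and $$v=\frac{ty+bz}{t^2+b^2}+q\cos\vartheta,\qquad w=\frac{tz-by}{t^2+b^2}+q\sin\vartheta .$$ (D) means Cartesian coordinates only. In (C), (S), (D$_b$) the coordinate functions on an open set $\Omega\subseteq\mathbb R^9$ are any $C^\infty$ functions on $\Omega$ satisfying these relations (any smooth determination of the angles). Every tuple of real numbers satisfying the relations at a given point consists of the values at that point of such coordinate functions on some neighbourhood of it. **Complete set of invariants.** Five functions $I_1,\dots,I_5$ on an open set $\Omega$ form a complete functionally independent set of invariants of $Z_1,\dots,Z_4$ on $\Omega$ if: they are $C^\infty$ on $\Omega$; $Z_i I_j=0$ on $\Omega$ for all $i,j$; the differentials $dI_1,\dots,dI_5$ are linearly independent at every point of $\Omega$; and, for every $p\in\Omega$, every $C^\infty$ function $F$ on a neighbourhood of $p$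 with $Z_iF=0$ there for all $i$ coincides near $p$ with $G(I_1,\dots,I_5)$ for some $C^\infty$ function $G$ defined on a neighbourhood of $(I_1(p),\dots,I_5(p))$ in $\mathbb R^5$. **Theorem.** In each of the following cases, for all real values of the parameters subject to the stated conditions, the listed four fields are a basis of a four-dimensional Lie subalgebra of $L_{12}$. Moreover, $\rho$ together with the four listed functions forms a complete functionally independent set of invariants of these fields on every open set $\Omega$ on which coordinate functions of the indicated type are given and the denominators and the arguments of the logarithms (written $\ln|\cdot|$) in the listed functions do not vanish. 1. $X_7,X_8,X_9,Y+X_{11}$. (S): $\frac rt,\ q,\ \vartheta,\ P-\ln|t|$. 2. $X_7,X_8,X_9,Y+X_{10}$. (S): $r,\ q,\ \vartheta,\ P-t$. 3. $X_1,aX_4+X_7,bX_4+X_{11},Y+X_4$. (C): $\frac rt,\ q,\ \vartheta,\ u-P-a\theta-b\ln|t|$. 4. $X_1,X_4,X_7+X_{10},Y+X_{10}$. (C): $r,\ q,\ \vartheta,\ P-t+\theta$. 5. $X_2,X_3,X_7+X_{10},Y+aX_1+bX_{10}$. (i) $a\ne0$, $a^2+b^2=1$, (C): $\frac ba x-t+\theta+\vartheta,\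 u,\ q,\ P-\frac xa$. (ii) $a=0$, $b=1$, (C): $x,\ u,\ q,\ P-t+\theta+\vartheta$. 6. $X_1,X_4,X_{11},Y+X_7$. (C): $\frac rt,\ q,\ \vartheta,\ P-\theta$. 7. $X_1,X_4,X_{10},Y+aX_7+X_{11}$. (i) $a\ne0$, (C): $\theta-a\ln|r|,\ q,\ \vartheta,\ P-\ln|r|$. (ii) $a=0$, (D): $\frac yz,\ v,\ w,\ P-\ln|y|$. 8. $X_1,X_4,X_{10},Y+X_7$. (C): $r,\ \vartheta,\ q,\ P-\theta$. 9. $X_2,X_3,\varepsilon X_4+X_{10},Y+aX_1+X_7$, $\varepsilon\in\{0,1\}$. (C): $x-\varepsilon\frac{t^2}2-a(\theta+\vartheta),\ u-\varepsilon t,\ q,\ P-(\theta+\vartheta)$. 10. $aX_1+X_4,bX_3+X_5,bX_2-X_6,Y+\varepsilon X_1+X_7$, $a^2+b^2=1$, $\varepsilon\in\{0,1\}$. (D$_b$): $t,\ u-\frac x{t+a}+\frac\varepsilon{t+a}\vartheta,\ q,\ P-\vartheta$. 11. $X_4,X_5,X_6,Y+aX_7+X_{11}$. (i) $a\ne0$,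 (D$_0$): $u-\frac xt,\ \ln|t|-\frac\vartheta a,\ q,\ P-\ln|t|$. (ii) $a=0$, (D): $u-\frac xt,\ v-\frac yt,\ w-\frac zt,\ P-\ln|t|$. 12. $X_4,X_5,X_6,Y+\varepsilon X_1+X_7$, $\varepsilon\in\{0,1\}$. (D$_0$): $t,\ u-\frac xt+\frac\varepsilon t\vartheta,\ q,\ P-\vartheta$. 13. $X_1,X_3+X_5,X_2-X_6,Y+aX_4+X_7$. (D$_1$): $t,\ u-a\vartheta,\ q,\ P-\vartheta$. 14. $X_1,X_5,X_6,Y+aX_4+bX_7+X_{11}$. (i) $b\ne0$, (D$_0$): $u-a\ln|t|,\ \vartheta-b\ln|t|,\ q,\ P-\ln|t|$. (ii) $b=0$, (D): $u-a\ln|t|,\ v-\frac yt,\ w-\frac zt,\ P-\ln|t|$. 15. $X_1,X_5,X_6,Y+bX_4+X_7$. (D$_0$): $t,\ u-b\vartheta,\ q,\ P-\vartheta$. 16. $X_2,X_3,X_4,Y+aX_7+X_{11}$. (i) $a\ne0$, (C): $u-\frac xt,\ \theta+\vartheta-a\ln|t|,\ q,\ P-\ln|t|$. (ii) $a=0$,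 (D): $u-\frac xt,\ v,\ w,\ P-\ln|t|$. 17. $X_2,X_3,X_4,Y+\varepsilon X_1+X_7$, $\varepsilon\in\{0,1\}$. (C): $t,\ q,\ u-\frac xt+\frac\varepsilon t(\theta+\vartheta),\ P-(\theta+\vartheta)$. 18. $X_1,X_2,X_4,Y+aX_5+bX_6+cX_{10}+dX_{11}$. (i) $d\neq0$, $c^2+d^2=1$, (D): $\frac z{dt+c}-\frac{bc}{d^2(dt+c)}-\frac{b\ln|dt+c|}{d^2},\ v-\frac ad\ln|dt+c|,\ w-\frac bd\ln|dt+c|,\ P-\frac{\ln|dt+c|}d$. (ii) $d=0$, $c=1$, (D): $z-b\frac{t^2}2,\ v-at,\ w-bt,\ P-t$. 19. $X_1,X_2,X_3,Y+aX_4+X_7+\varepsilon X_{10}+cX_{11}$. (i) $c\ne0$, $\varepsilon=0$, (C): $\theta+\vartheta-\frac{\ln|t|}c,\ u-\frac ac\ln|t|,\ q,\ P-\frac{\ln|t|}c$. (ii) $c=0$, $\varepsilon=0$, (C): $t,\ u-a(\vartheta+\theta),\ q,\ P-(\theta+\vartheta)$. (iii) $c=0$, $\varepsilon=1$, (C): $\theta+\vartheta-t,\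 u-at,\ q,\ P-t$. 20. $X_1,X_2,X_3,Y+X_4$. (D): $t,\ v,\ w,\ P-u$. -/

import Mathlib

open Set Topology
open scoped ContDiff

noncomputable section

namespace GasDyn

/-- The nine-dimensional space with coordinates `(t, x, y, z, u, v, w, ρ, P)`: time, position,
velocity, density, pressure. -/
abbrev State : Type := Fin 9 → ℝ

/-- Time. -/
def t (p : State) : ℝ := p 0
/-- First Cartesian coordinate of the position. -/
def x (p : State) : ℝ := p 1
/-- Second Cartesian coordinate of the position. -/
def y (p : State) : ℝ := p 2
/-- Third Cartesian coordinate of the position. -/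
def z (p : State) : ℝ := p 3
/-- First Cartesian coordinate of the velocity. -/
def u (p : State) : ℝ := p 4
/-- Second Cartesian coordinate of the velocity. -/
def v (p : State) : ℝ := p 5
/-- Third Cartesian coordinate of the velocity. -/
def w (p : State) : ℝ := p 6
/-- Density. -/
def ρ (p : State) : ℝ := p 7
/-- Pressure. -/
def P (p : State) : ℝ := p 8

/-- Vector fields on the space of states, given by their components with respect to
`∂_t, ∂_x, ∂_y, ∂_z, ∂_u, ∂_v, ∂_w, ∂_ρ, ∂_P`. -/
abbrev VF : Type := State → State

/-! The twelve generators: space translations, Galilean translations, rotations, time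
translation, uniform dilation, pressure translation. -/

/-- `∂_x` -/
def X1 : VF := fun _ => ![0, 1, 0, 0, 0, 0, 0, 0, 0]
/-- `∂_y` -/
def X2 : VF := fun _ => ![0, 0, 1, 0, 0, 0, 0, 0, 0]
/-- `∂_z` -/
def X3 : VF := fun _ => ![0, 0, 0, 1, 0, 0, 0, 0, 0]
/-- `t ∂_x + ∂_u` -/
def X4 : VF := fun p => ![0, t p, 0, 0, 1, 0, 0, 0, 0]
/-- `t ∂_y + ∂_v` -/
def X5 : VF := fun p => ![0, 0, t p, 0, 0, 1, 0, 0, 0]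
/-- `t ∂_z + ∂_w` -/
def X6 : VF := fun p => ![0, 0, 0, t p, 0, 0, 1, 0, 0]
/-- `y ∂_z - z ∂_y + v ∂_w - w ∂_v` -/
def X7 : VF := fun p => ![0, 0, -z p, y p, 0, -w p, v p, 0, 0]
/-- `z ∂_x - x ∂_z + w ∂_u - u ∂_w` -/
def X8 : VF := fun p => ![0, z p, 0, -x p, w p, 0, -u p, 0, 0]
/-- `x ∂_y - y ∂_x + u ∂_v - v ∂_u` -/
def X9 : VF := fun p => ![0, -y p, x p, 0, -v p, u p, 0, 0, 0]
/-- `∂_t` -/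
def X10 : VF := fun _ => ![1, 0, 0, 0, 0, 0, 0, 0, 0]
/-- `t ∂_t + x ∂_x + y ∂_y + z ∂_z` -/
def X11 : VF := fun p => ![t p, x p, y p, z p, 0, 0, 0, 0, 0]
/-- `∂_P` -/
def Y : VF := fun _ => ![0, 0, 0, 0, 0, 0, 0, 0, 1]

/-- The real vector space of vector fields spanned by the twelve generators. -/
def L12 : Submodule ℝ VF :=
  Submodule.span ℝ {X1, X2, X3, X4, X5, X6, X7, X8, X9, X10, X11, Y}

/-- A space of vector fields is closed under the Lie bracket of vector fields. -/
def ClosedUnderBracket (S : Submodule ℝ VF) : Prop :=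
  ∀ A ∈ S, ∀ B ∈ S, VectorField.lieBracket ℝ A B ∈ S

/-- `Z` is a basis of a four-dimensional Lie subalgebra of `L12`. -/
def IsSubalgebraBasis (Z : Fin 4 → VF) : Prop :=
  LinearIndependent ℝ Z ∧ Submodule.span ℝ (range Z) ≤ L12 ∧
    ClosedUnderBracket (Submodule.span ℝ (range Z))

/-- The function `F` is annihilated on the open set `N` by the four vector fields `Z`. -/
def IsInvariantOn (Z : Fin 4 → VF) (F : State → ℝ) (N : Set State) : Prop :=
  ∀ i, ∀ p ∈ N, fderiv ℝ F p (Z i p) = 0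

/-- The five functions `I` form, on the open set `U`, a complete (generating) set of functionally
independent invariants of the four vector fields `Z`: they are smooth, are annihilated by the
fields, have linearly independent differentials at each point of `U`, and near each point of `U`
every smooth function annihilated by the fields is a smooth function of them. -/
structure IsCompleteInvariantSet (U : Set State) (Z : Fin 4 → VF) (I : Fin 5 → State → ℝ) :
    Prop where
  smooth : ∀ j, ContDiffOn ℝ ∞ (I j) U
  invariant : ∀ j, IsInvariantOn Z (I j) U
  independent : ∀ p ∈ U, LinearIndependent ℝ (fun j => fderiv ℝ (I j) p)
  complete : ∀ p ∈ U, ∀ (N : Set State) (F : State → ℝ), IsOpen N → p ∈ N →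
    ContDiffOn ℝ ∞ F N → IsInvariantOn Z F N →
    ∃ (G : (Fin 5 → ℝ) → ℝ) (W : Set (Fin 5 → ℝ)), IsOpen W ∧ (fun j => I j p) ∈ W ∧
      ContDiffOn ℝ ∞ G W ∧ ∀ᶠ q in 𝓝 p, F q = G (fun j => I j q)

/-- `r, θ` are cylindrical coordinates of the position (with axis the first coordinate axis), and
`q, ϑ` are the polar coordinates of the pair `(V, W)` of the cylindrical velocity components
`V = q cos ϑ`, `W = q sin ϑ`. Angles are real numbers, not restricted to one period. -/
def CylRel (p : State) (r θ q ϑ : ℝ) : Prop :=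
  0 < r ∧ 0 < q ∧
  y p = r * Real.cos θ ∧ z p = r * Real.sin θ ∧
  v p = (q * Real.cos ϑ) * Real.cos θ - (q * Real.sin ϑ) * Real.sin θ ∧
  w p = (q * Real.cos ϑ) * Real.sin θ + (q * Real.sin ϑ) * Real.cos θ

/-- `r, θ, φ` are spherical coordinates of the position, and `q, ϑ, ψ` are spherical coordinates
of the triple `(U, V, W)` of the spherical velocity components
`U = q cos ϑ`, `V = q sin ϑ cos ψ`, `W = q sin ϑ sin ψ`. -/
def SphRel (p : State) (r θ φ q ϑ ψ : ℝ) : Prop :=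
  0 < r ∧ 0 < q ∧ θ ∈ Ioo 0 Real.pi ∧ ϑ ∈ Ioo 0 Real.pi ∧
  x p = r * Real.sin θ * Real.cos φ ∧ y p = r * Real.sin θ * Real.sin φ ∧ z p = r * Real.cos θ ∧
  u p = ((q * Real.cos ϑ) * Real.sin θ + (q * Real.sin ϑ * Real.cos ψ) * Real.cos θ) * Real.cos φ
    - (q * Real.sin ϑ * Real.sin ψ) * Real.sin φ ∧
  v p = ((q * Real.cos ϑ) * Real.sin θ + (q * Real.sin ϑ * Real.cos ψ) * Real.cos θ) * Real.sin φ
    + (q * Real.sin ϑ * Real.sin ψ) * Real.cos φ ∧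
  w p = (q * Real.cos ϑ) * Real.cos θ - (q * Real.sin ϑ * Real.cos ψ) * Real.sin θ

/-- The auxiliary velocity variables `q, ϑ` with parameter `b`. -/
def VelRel (b : ℝ) (p : State) (q ϑ : ℝ) : Prop :=
  t p ^ 2 + b ^ 2 ≠ 0 ∧ q ≠ 0 ∧
  v p = (t p * y p + b * z p) / (t p ^ 2 + b ^ 2) + q * Real.cos ϑ ∧
  w p = (t p * z p - b * y p) / (t p ^ 2 + b ^ 2) + q * Real.sin ϑ

/-- A smooth determination on `U` of the cylindrical coordinate functions. -/
structure CylChart (U : Set State) where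
  r : State → ℝ
  θ : State → ℝ
  q : State → ℝ
  ϑ : State → ℝ
  smooth_r : ContDiffOn ℝ ∞ r U
  smooth_θ : ContDiffOn ℝ ∞ θ U
  smooth_q : ContDiffOn ℝ ∞ q U
  smooth_ϑ : ContDiffOn ℝ ∞ ϑ U
  rel : ∀ p ∈ U, CylRel p (r p) (θ p) (q p) (ϑ p)

/-- A smooth determination on `U` of the spherical coordinate functions. -/
structure SphChart (U : Set State) where
  r : State → ℝ
  θ : State → ℝ
  φ : State → ℝ
  q : State → ℝ
  ϑ : State → ℝ
  ψ : State → ℝ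
  smooth_r : ContDiffOn ℝ ∞ r U
  smooth_θ : ContDiffOn ℝ ∞ θ U
  smooth_φ : ContDiffOn ℝ ∞ φ U
  smooth_q : ContDiffOn ℝ ∞ q U
  smooth_ϑ : ContDiffOn ℝ ∞ ϑ U
  smooth_ψ : ContDiffOn ℝ ∞ ψ U
  rel : ∀ p ∈ U, SphRel p (r p) (θ p) (φ p) (q p) (ϑ p) (ψ p)

/-- A smooth determination on `U` of the auxiliary velocity variables with parameter `b`. -/
structure VelChart (b : ℝ) (U : Set State) where
  q : State → ℝ
  ϑ : State → ℝ
  smooth_q : ContDiffOn ℝ ∞ q U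
  smooth_ϑ : ContDiffOn ℝ ∞ ϑ U
  rel : ∀ p ∈ U, VelRel b p (q p) (ϑ p)

end GasDyn

end

open GasDyn

/-! The Lie-algebra half is linear algebra over structure constants. All twelve generators are
affine fields, so a combination is determined by its twelve coefficients and the bracket becomes an
explicit bilinear map `brk` on coefficient vectors (`lieBracket_gen`). This bracket is
antisymmetric, hence on a four-dimensional span it depends only on the minors of the two coefficient
vectors. Closure of each span then amounts to exhibiting its structure constants and checking a
polynomial identity (`isSubalgebraBasis_of_coeffs`).

The completeness half rests on a dimension count, `9 = 5 + 4`. If five invariants have independent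
differentials and the four fields are independent at every point, the common kernel of the
differentials is exactly the span of the fields. Complete the invariants to local coordinates by
four linear functions. A vector tangent to a common level set of the invariants is then a
combination of the fields, so it annihilates every further invariant `F`; on a product neighbourhood
with convex fibres `F` depends on the five invariants alone. This is
`isCompleteInvariantSet_of_linearIndependent`. Frobenius' theorem is not needed, because the
invariants are given explicitly.

What remains for each case is pointwise: a `5 × 9` matrix of differentials and a `4 × 9` matrix of
field components, both of full rank and orthogonal to each other.
`IsCoordSystem.isCompleteInvariantSet` allows these matrices to be written in any local coordinates,
chosen so that the fields become simple. In cylindrical coordinates `X7` is `∂_θ`. If the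
translations `X2` and `X3` are present, `y` and `z` are kept and only the angle `θ + ϑ` of the
vector `(v, w)` is introduced. The auxiliary velocity variables are polar coordinates of a pair of
functions which the combined translations and boosts annihilate and which `X7` rotates.

For the full rotation group the matrices stay Cartesian: `r`, `q` and `ϑ` are functions of the
squared lengths of position and velocity and of their scalar product, and `sin ϑ ≠ 0` says that
these two vectors are not parallel. That gives both the differential of `ϑ` and the independence of
the three rotations. -/

namespace GasDyn

/-! ### Completeness of independent invariants, by linear algebra and the inverse function theorem.
-/

/-- A linear map given by five independent linear forms has as its kernel the span of any four
independent vectors killed by these forms. -/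
theorem mem_span_of_forall_eq_zero {l : Fin 5 → State →L[ℝ] ℝ} (hl : LinearIndependent ℝ l)
    {ζ : Fin 4 → State} (hζ : LinearIndependent ℝ ζ) (h : ∀ j i, l j (ζ i) = 0) {ξ : State}
    (hξ : ∀ j, l j ξ = 0) : ξ ∈ Submodule.span ℝ (range ζ) := by
  have hl' : LinearIndependent ℝ (fun j => (l j : State →ₗ[ℝ] ℝ)) :=
    hl.map' (ContinuousLinearMap.coeLM ℝ) (LinearMap.ker_eq_bot.2
      ContinuousLinearMap.coe_injective)
  let W : Submodule ℝ (Module.Dual ℝ State) :=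
    Submodule.span ℝ (range fun j => (l j : State →ₗ[ℝ] ℝ))
  have hW : Module.finrank ℝ W = 5 := by
    simpa using finrank_span_eq_card hl'
  have hS : Module.finrank ℝ (Submodule.span ℝ (range ζ)) = 4 := by
    simpa using finrank_span_eq_card hζ
  have hle : Submodule.span ℝ (range ζ) ≤ W.dualCoannihilator := by
    rw [Submodule.span_le]
    rintro _ ⟨i, rfl⟩
    rw [SetLike.mem_coe, Submodule.mem_dualCoannihilator]
    intro φ hφ
    induction hφ using Submodule.span_induction with
    | mem φ hφ => obtain ⟨j, rfl⟩ := hφ; exact h j i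
    | zero => rfl
    | add a b _ _ ha hb => simp [ha, hb]
    | smul c a _ ha => simp [ha]
  have hfin := Subspace.finrank_add_finrank_dualCoannihilator_eq W
  -- The common kernel of five independent forms on a nine-dimensional space has dimension `9 - 5 =
  -- 4`, which is also the dimension of the span.
  have heq := Submodule.eq_of_le_of_finrank_eq hle (by
    rw [hW] at hfin
    simp only [Module.finrank_fintype_fun_eq_card, Fintype.card_fin] at hfin
    omega)
  rw [heq, Submodule.mem_dualCoannihilator]
  intro φ hφ
  induction hφ using Submodule.span_induction with
  | mem φ hφ => obtain ⟨j, rfl⟩ := hφ; exact hξ j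
  | zero => rfl
  | add a b _ _ ha hb => simp [ha, hb]
  | smul c a _ ha => simp [ha]

/-- The linear map whose components are the dot products with the vectors `ζ`. -/
noncomputable def dotMap (ζ : Fin 4 → State) : State →L[ℝ] (Fin 4 → ℝ) :=
  LinearMap.toContinuousLinearMap (Matrix.mulVecLin (Matrix.of ζ))

/-- Independent linear forms, completed by the dot products with independent vectors that they
kill, form an invertible map. -/
theorem bijective_pi_prod_dotMap {l : Fin 5 → State →L[ℝ] ℝ} (hl : LinearIndependent ℝ l)
    {ζ : Fin 4 → State} (hζ : LinearIndependent ℝ ζ) (h : ∀ j i, l j (ζ i) = 0) :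
    Function.Bijective ((ContinuousLinearMap.pi l).prod (dotMap ζ)) := by
  have hinj : Function.Injective
      (((ContinuousLinearMap.pi l).prod (dotMap ζ)) :
        State →ₗ[ℝ] (Fin 5 → ℝ) × (Fin 4 → ℝ)) := by
    rw [← LinearMap.ker_eq_bot, LinearMap.ker_eq_bot']
    intro ξ hξ
    have h1 : ∀ j, l j ξ = 0 := fun j => congrFun (congrArg Prod.fst hξ) j
    have h2 : ∀ i, ζ i ⬝ᵥ ξ = 0 := fun i => congrFun (congrArg Prod.snd hξ) i
    have h3 := mem_span_of_forall_eq_zero hl hζ h h1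
    have h4 : ∀ η ∈ Submodule.span ℝ (range ζ), η ⬝ᵥ ξ = 0 := by
      intro η hη
      induction hη using Submodule.span_induction with
      | mem φ hφ => obtain ⟨j, rfl⟩ := hφ; exact h2 j
      | zero => simp
      | add a b _ _ ha hb => simp [ha, hb]
      | smul c a _ ha => simp [ha]
    -- `ξ` lies in the span of the `ζ i` and is orthogonal to all of it, hence to itself.
    exact dotProduct_self_eq_zero.1 (h4 ξ h3)
  exact ⟨hinj, (LinearMap.injective_iff_surjective_of_finrank_eq_finrank (by simp)).1 hinj⟩

/-- Functionally independent invariants of independent fields generate all invariants. -/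
theorem isCompleteInvariantSet_of_linearIndependent {U : Set State} (hU : IsOpen U)
    {Z : Fin 4 → VF} {I : Fin 5 → State → ℝ} (hs : ∀ j, ContDiffOn ℝ ∞ (I j) U)
    (hinv : ∀ j, IsInvariantOn Z (I j) U)
    (hind : ∀ p ∈ U, LinearIndependent ℝ (fun j => fderiv ℝ (I j) p))
    (hZ : ∀ p ∈ U, LinearIndependent ℝ (fun i => Z i p)) :
    IsCompleteInvariantSet U Z I := by
  refine ⟨hs, hinv, hind, ?_⟩
  intro p hp N F hN hpN hF hFinv
  have hsmooth : ∀ p' ∈ U, ∀ j, ContDiffAt ℝ ∞ (I j) p' := fun p' hp' j =>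
    (hs j).contDiffAt (hU.mem_nhds hp')
  -- The four missing coordinates are dot products with the values of the fields frozen at `p`. They
  -- are linear, so the derivative of `Φ` is explicit everywhere; it is invertible at `p` and
  -- therefore near `p`.
  set J := dotMap (fun i => Z i p)
  let Φ : State → (Fin 5 → ℝ) × (Fin 4 → ℝ) := fun p' => (fun j => I j p', J p')
  let Φ' : State → State →L[ℝ] (Fin 5 → ℝ) × (Fin 4 → ℝ) := fun p' =>
    (ContinuousLinearMap.pi fun j => fderiv ℝ (I j) p').prod J
  have hΦs : ∀ p' ∈ U, ContDiffAt ℝ ∞ Φ p' := fun p' hp' =>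
    (contDiffAt_pi.2 fun j => hsmooth p' hp' j).prodMk J.contDiff.contDiffAt
  have hΦd : ∀ p' ∈ U, HasFDerivAt Φ (Φ' p') p' := fun p' hp' =>
    (hasFDerivAt_pi.2 fun j =>
      ((hsmooth p' hp' j).differentiableAt (by simp)).hasFDerivAt).prodMk J.hasFDerivAt
  have hbij : Function.Bijective (Φ' p) :=
    bijective_pi_prod_dotMap (hind p hp) (hZ p hp) fun j i => hinv j i p hp
  let e : State ≃L[ℝ] (Fin 5 → ℝ) × (Fin 4 → ℝ) :=
    (LinearEquiv.ofBijective (Φ' p : State →ₗ[ℝ] _) hbij).toContinuousLinearEquiv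
  have he : (e : State →L[ℝ] _) = Φ' p := by ext1 ξ; rfl
  let R : OpenPartialHomeomorph State ((Fin 5 → ℝ) × (Fin 4 → ℝ)) :=
    (hΦs p hp).toOpenPartialHomeomorph Φ (f' := e) (by rw [he]; exact hΦd p hp) (by simp)
  have hpR : p ∈ R.source := ContDiffAt.mem_toOpenPartialHomeomorph_source _ _ _
  -- the derivative stays invertible near `p`
  have hfd : ContinuousAt (fderiv ℝ Φ) p :=
    ((hΦs p hp).fderiv_right (m := 0) (by simp)).continuousAt
  have hinvertible : ∀ᶠ p' in 𝓝 p, fderiv ℝ Φ p' ∈ range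
      ((↑) : (State ≃L[ℝ] (Fin 5 → ℝ) × (Fin 4 → ℝ)) → State →L[ℝ] _) :=
    hfd.eventually (ContinuousLinearEquiv.isOpen.mem_nhds
      (by rw [(hΦd p hp).fderiv]; exact ⟨e, he⟩))
  have hgood : ∀ᶠ p' in 𝓝 p, p' ∈ R.source ∧ p' ∈ U ∧ p' ∈ N ∧ fderiv ℝ Φ p' ∈ range
      ((↑) : (State ≃L[ℝ] (Fin 5 → ℝ) × (Fin 4 → ℝ)) → State →L[ℝ] _) := by
    filter_upwards [R.open_source.mem_nhds hpR, hU.mem_nhds hp, hN.mem_nhds hpN, hinvertible]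
      with p' h1 h2 h3 h4 using ⟨h1, h2, h3, h4⟩
  have hgood' : ∀ᶠ c in 𝓝 (Φ p), c ∈ R.target ∧ R.symm c ∈ U ∧ R.symm c ∈ N ∧
      fderiv ℝ Φ (R.symm c) ∈ range
      ((↑) : (State ≃L[ℝ] (Fin 5 → ℝ) × (Fin 4 → ℝ)) → State →L[ℝ] _) := by
    have h1 : ContinuousAt R.symm (Φ p) := R.symm.continuousAt (R.map_source hpR)
    have h2 : R.symm (Φ p) = p := R.left_inv hpR
    have h3 := h1.eventually (by rw [h2]; exact hgood)
    filter_upwards [h3, R.open_target.mem_nhds (R.map_source hpR)] with c hc hc'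
      using ⟨hc', hc.2⟩
  -- A ball for the sup metric of a product is a product of balls, so the fibres over the first
  -- factor are convex.
  obtain ⟨δ, hδ, hball⟩ := Metric.eventually_nhds_iff_ball.1 hgood'
  have hmem : ∀ a ∈ Metric.ball (Φ p).1 δ, ∀ b ∈ Metric.ball (Φ p).2 δ,
      (a, b) ∈ Metric.ball (Φ p) δ := by
    intro a ha b hb
    rw [← ball_prod_same]
    exact ⟨ha, hb⟩
  have hFs : ∀ p' ∈ N, ContDiffAt ℝ ∞ F p' := fun p' hp' => hF.contDiffAt (hN.mem_nhds hp')
  have hHs : ∀ c ∈ Metric.ball (Φ p) δ, ContDiffAt ℝ ∞ (F ∘ R.symm) c := by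
    intro c hc
    obtain ⟨h1, h2, h3, e', he'⟩ := hball c hc
    refine (hFs _ h3).comp c (R.contDiffAt_symm h1 (f₀' := e') ?_ (hΦs _ h2))
    rw [he', (hΦd _ h2).fderiv]
    exact hΦd _ h2
  have hHd : ∀ c ∈ Metric.ball (Φ p) δ, ∀ η, fderiv ℝ (F ∘ R.symm) c (0, η) = 0 := by
    intro c hc η
    obtain ⟨h1, h2, h3, e', he'⟩ := hball c hc
    set p' := R.symm c with hp'
    have hΦp' : Φ p' = c := R.right_inv h1
    have hcomp : HasFDerivAt (F ∘ R.symm ∘ Φ)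
        ((fderiv ℝ (F ∘ R.symm) c).comp (Φ' p')) p' := by
      have h5 : HasFDerivAt (F ∘ R.symm) (fderiv ℝ (F ∘ R.symm) c) (Φ p') := by
        rw [hΦp']
        exact ((hHs c hc).differentiableAt (by simp)).hasFDerivAt
      exact h5.comp p' (hΦd p' h2)
    have heq : F ∘ R.symm ∘ Φ =ᶠ[𝓝 p'] F := by
      filter_upwards [R.open_source.mem_nhds (R.map_target h1)] with a ha
      exact congrArg F (R.left_inv ha)
    have hFd := hcomp.congr_of_eventuallyEq heq.symm
    -- This tangent vector at `p'` moves only the four auxiliary coordinates. All `dI j` vanish on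
    -- it, so it lies in the span of the fields at `p'` and `dF` vanishes on it too.
    have hξ : Φ' p' (e'.symm (0, η)) = (0, η) := by
      rw [← (hΦd _ h2).fderiv, ← he']
      exact e'.apply_symm_apply _
    have hspan := mem_span_of_forall_eq_zero (hind p' h2) (hZ p' h2)
      (fun j i => hinv j i p' h2) (ξ := e'.symm (0, η))
      (fun j => congrFun (congrArg Prod.fst hξ) j)
    have hzero : ∀ ζ ∈ Submodule.span ℝ (range fun i => Z i p'), fderiv ℝ F p' ζ = 0 := by
      intro ζ hζ
      induction hζ using Submodule.span_induction with
      | mem φ hφ => obtain ⟨i, rfl⟩ := hφ; exact hFinv i p' h3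
      | zero => simp
      | add a b _ _ ha hb => simp [ha, hb]
      | smul c a _ ha => simp [ha]
    have := hzero _ hspan
    rw [hFd.fderiv, ContinuousLinearMap.comp_apply, hξ] at this
    exact this
  -- `G` is `F` restricted to the slice on which the auxiliary coordinates keep their values at `p`.
  refine ⟨fun a => F (R.symm (a, (Φ p).2)), Metric.ball (Φ p).1 δ, Metric.isOpen_ball,
    Metric.mem_ball_self hδ, ?_, ?_⟩
  · intro a ha
    have h1 := hHs (a, (Φ p).2) (hmem a ha _ (Metric.mem_ball_self hδ))
    have h2 : ContDiffAt ℝ ∞ (fun a : Fin 5 → ℝ => (a, (Φ p).2)) a := by fun_prop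
    exact (h1.comp a h2).contDiffWithinAt
  · have hcont : ContinuousAt Φ p := (hΦs p hp).continuousAt
    filter_upwards [hgood, hcont.eventually (Metric.ball_mem_nhds _ hδ)] with q hq hq'
    have hq2 : (Φ q).1 ∈ Metric.ball (Φ p).1 δ ∧ (Φ q).2 ∈ Metric.ball (Φ p).2 δ := by
      have h := Metric.mem_ball.2 hq'
      rw [← Prod.mk.eta (p := Φ p), ← ball_prod_same] at h
      exact h
    have hconst : ∀ b ∈ Metric.ball (Φ p).2 δ, HasFDerivAt
        (fun b => F (R.symm ((Φ q).1, b))) (0 : (Fin 4 → ℝ) →L[ℝ] ℝ) b := by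
      intro b hb
      have hc := hmem _ hq2.1 b hb
      have h1 := ((hHs _ hc).differentiableAt (by simp)).hasFDerivAt
      have h2 : HasFDerivAt (fun b : Fin 4 → ℝ => ((Φ q).1, b))
        (ContinuousLinearMap.inr ℝ (Fin 5 → ℝ) (Fin 4 → ℝ)) b := hasFDerivAt_prodMk_right _ _
      refine (h1.comp b h2).congr_fderiv ?_
      ext1 η
      exact hHd _ hc η
    have h3 := (Metric.isOpen_ball (x := (Φ p).2) (ε := δ)).is_const_of_fderiv_eq_zero (𝕜 := ℝ)
      (convex_ball _ _).isPreconnected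
      (fun b hb => (hconst b hb).differentiableAt.differentiableWithinAt)
      (fun b hb => (hconst b hb).fderiv) hq2.2 (Metric.mem_ball_self hδ)
    calc F q = F (R.symm (Φ q)) := congrArg F (R.left_inv hq.1).symm
      _ = _ := h3

/-! ### The twelve-dimensional algebra in terms of coefficients. -/

/-- The coefficients of a combination of the twelve generators, in the order
`X1, …, X11, Y`. -/
abbrev Coeffs : Type := Fin 12 → ℝ

/-- The combination of the twelve generators with given coefficients. -/
noncomputable def gen : Coeffs →ₗ[ℝ] VF :=
  Fintype.linearCombination ℝ ![X1, X2, X3, X4, X5, X6, X7, X8, X9, X10, X11, Y]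

/-- `Y` is put first because the fields of the theorem are written as `Y + …`; with this order they
match the expansion after zero terms are dropped. -/
theorem gen_eq (c : Coeffs) : gen c = c 11 • Y + c 0 • X1 + c 1 • X2 + c 2 • X3 + c 3 • X4 + c 4 • X5
    + c 5 • X6 + c 6 • X7 + c 7 • X8 + c 8 • X9 + c 9 • X10 + c 10 • X11 := by
  simp [gen, Fintype.linearCombination_apply, Fin.sum_univ_succ]
  abel

theorem gen_apply (c : Coeffs) (p : State) : gen c p =
    ![c 9 + c 10 * t p,
      c 0 + c 3 * t p + c 7 * z p - c 8 * y p + c 10 * x p,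
      c 1 + c 4 * t p - c 6 * z p + c 8 * x p + c 10 * y p,
      c 2 + c 5 * t p + c 6 * y p - c 7 * x p + c 10 * z p,
      c 3 + c 7 * w p - c 8 * v p,
      c 4 - c 6 * w p + c 8 * u p,
      c 5 + c 6 * v p - c 7 * u p,
      0,
      c 11] := by
  rw [gen_eq]
  ext i
  fin_cases i <;> simp [X1, X2, X3, X4, X5, X6, X7, X8, X9, X10, X11, Y] <;> grind

theorem range_gen : LinearMap.range gen = L12 := by
  rw [gen, Fintype.range_linearCombination, L12]
  congr 1
  ext A
  simp only [mem_range, Fin.exists_fin_succ, mem_insert_iff, mem_singleton_iff]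
  simp [eq_comm]

/-- The value at the origin gives the coefficients of the translations in space, time and pressure
and of the boosts. Unit points on the `t`, `x` and `y` axes then give the dilation and the three
rotations. -/
theorem gen_injective : Function.Injective gen := by
  rw [← LinearMap.ker_eq_bot, LinearMap.ker_eq_bot']
  intro c hc
  have h0 : gen c (fun _ => 0) = 0 := congrFun hc _
  have h1 : gen c ![1, 0, 0, 0, 0, 0, 0, 0, 0] = 0 := congrFun hc _
  have h2 : gen c ![0, 1, 0, 0, 0, 0, 0, 0, 0] = 0 := congrFun hc _
  have h3 : gen c ![0, 0, 1, 0, 0, 0, 0, 0, 0] = 0 := congrFun hc _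
  rw [gen_apply] at h0 h1 h2 h3
  simp [t, x, y, z, u, v, w, funext_iff, Fin.forall_fin_succ] at h0 h1 h2 h3
  ext k
  fin_cases k <;> simp <;> grind

theorem finrank_L12 : Module.finrank ℝ L12 = 12 := by
  rw [← range_gen, LinearMap.finrank_range_of_inj gen_injective]
  simp

/-- The linear part of the affine field `gen c`. -/
noncomputable def genLin (c : Coeffs) : State →L[ℝ] State :=
  LinearMap.toContinuousLinearMap
  { toFun := fun p => gen c p - gen c 0
    map_add' := by
      intro p q
      simp only [gen_apply]
      ext i
      fin_cases i <;> simp [t, x, y, z, u, v, w] <;> ring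
    map_smul' := by
      intro s p
      simp only [gen_apply]
      ext i
      fin_cases i <;> simp [t, x, y, z, u, v, w] <;> ring }

theorem hasFDerivAt_gen (c : Coeffs) (p : State) : HasFDerivAt (gen c) (genLin c) p := by
  have h : gen c = fun p => genLin c p + gen c 0 := by
    ext1 p
    simp [genLin]
  rw [h]
  exact (genLin c).hasFDerivAt.add_const _

/-- The Lie bracket of vector fields in terms of coefficients. -/
def brk (c d : Coeffs) : Coeffs :=
  -- The first three entries collect time translation acting on boosts, and rotations and dilation
  -- acting on space translations; the next six are rotations acting on boosts and on each other.
  -- Then comes time translation against dilation. The bracket never has an `X11` or a `Y`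
  -- component.
  ![(d 3 * c 9 + (d 7 * c 2 - d 8 * c 1) + d 10 * c 0)
      - (c 3 * d 9 + (c 7 * d 2 - c 8 * d 1) + c 10 * d 0),
    (d 4 * c 9 + (d 8 * c 0 - d 6 * c 2) + d 10 * c 1)
      - (c 4 * d 9 + (c 8 * d 0 - c 6 * d 2) + c 10 * d 1),
    (d 5 * c 9 + (d 6 * c 1 - d 7 * c 0) + d 10 * c 2)
      - (c 5 * d 9 + (c 6 * d 1 - c 7 * d 0) + c 10 * d 2),
    (d 7 * c 5 - d 8 * c 4) - (c 7 * d 5 - c 8 * d 4),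
    (d 8 * c 3 - d 6 * c 5) - (c 8 * d 3 - c 6 * d 5),
    (d 6 * c 4 - d 7 * c 3) - (c 6 * d 4 - c 7 * d 3),
    d 7 * c 8 - d 8 * c 7, d 8 * c 6 - d 6 * c 8, d 6 * c 7 - d 7 * c 6,
    d 10 * c 9 - c 10 * d 9, 0, 0]

/-- For affine fields the bracket at `p` is the linear part of the second applied to the first minus
the linear part of the first applied to the second, so it can be compared with `brk` componentwise.
-/
theorem lieBracket_gen (c d : Coeffs) :
    VectorField.lieBracket ℝ (gen c) (gen d) = gen (brk c d) := by
  ext1 p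
  rw [VectorField.lieBracket, (hasFDerivAt_gen c p).fderiv, (hasFDerivAt_gen d p).fderiv]
  have h : ∀ c q, genLin c q = gen c q - gen c 0 := fun _ _ => rfl
  rw [h, h]
  simp only [gen_apply]
  ext i
  fin_cases i <;> simp [t, x, y, z, u, v, w, brk] <;> ring

theorem closedUnderBracket_L12 : ClosedUnderBracket L12 := by
  rw [← range_gen]
  rintro _ ⟨c, rfl⟩ _ ⟨d, rfl⟩
  exact ⟨brk c d, (lieBracket_gen c d).symm⟩

/-- The minors of two coefficient vectors. -/
def wedge (α β : Fin 4 → ℝ) (i j : Fin 4) : ℝ := α i * β j - β i * α j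

/-- Independent coefficient vectors whose span is closed under the bracket give a basis of a
subalgebra; `γ` expresses the bracket in
this basis through the minors of the coefficients of the two factors. -/
theorem isSubalgebraBasis_of_coeffs {Z0 Z1 Z2 Z3 : VF} (c0 c1 c2 c3 : Coeffs)
    (hZ : ![Z0, Z1, Z2, Z3] = ![gen c0, gen c1, gen c2, gen c3])
    (hind : ∀ g0 g1 g2 g3 : ℝ,
      (∀ k, g0 * c0 k + g1 * c1 k + g2 * c2 k + g3 * c3 k = 0) →
        g0 = 0 ∧ g1 = 0 ∧ g2 = 0 ∧ g3 = 0)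
    (γ : (Fin 4 → Fin 4 → ℝ) → Fin 4 → ℝ)
    (hγ : ∀ α β : Fin 4 → ℝ, ∀ k,
      brk (α 0 • c0 + α 1 • c1 + α 2 • c2 + α 3 • c3)
        (β 0 • c0 + β 1 • c1 + β 2 • c2 + β 3 • c3) k =
      γ (wedge α β) 0 * c0 k + γ (wedge α β) 1 * c1 k + γ (wedge α β) 2 * c2 k
        + γ (wedge α β) 3 * c3 k) :
    IsSubalgebraBasis ![Z0, Z1, Z2, Z3] := by
  have hZ' : ![Z0, Z1, Z2, Z3] = fun i => gen (![c0, c1, c2, c3] i) := by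
    rw [hZ]
    ext1 i
    fin_cases i <;> rfl
  have hsum : ∀ α : Fin 4 → ℝ, ∑ i, α i • gen (![c0, c1, c2, c3] i) =
      gen (α 0 • c0 + α 1 • c1 + α 2 • c2 + α 3 • c3) := by
    intro α
    simp [Fin.sum_univ_succ, add_assoc]
  rw [hZ']
  refine ⟨?_, ?_, ?_⟩
  · refine LinearIndependent.map' (v := ![c0, c1, c2, c3]) ?_ gen
      (LinearMap.ker_eq_bot.2 gen_injective)
    rw [Fintype.linearIndependent_iff]
    intro g hg
    have := hind (g 0) (g 1) (g 2) (g 3) fun k => by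
      simpa [Fin.sum_univ_succ, add_assoc] using congrFun hg k
    intro i
    fin_cases i
    exacts [this.1, this.2.1, this.2.2.1, this.2.2.2]
  · rw [Submodule.span_le, ← range_gen]
    rintro _ ⟨i, rfl⟩
    exact ⟨_, rfl⟩
  · intro A hA B hB
    rw [Submodule.mem_span_range_iff_exists_fun] at hA hB ⊢
    obtain ⟨α, rfl⟩ := hA
    obtain ⟨β, rfl⟩ := hB
    refine ⟨γ (wedge α β), ?_⟩
    rw [hsum, hsum, hsum, lieBracket_gen]
    congr 1
    ext k
    rw [hγ]
    simp

/-! ### Local existence of the coordinate functions with prescribed values. -/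

/-- Smoothness in a neighbourhood of a point. -/
def SmoothNear (p : State) (f : State → ℝ) : Prop := ∀ᶠ p' in 𝓝 p, ContDiffAt ℝ ∞ f p'

theorem SmoothNear.continuousAt {p : State} {f : State → ℝ} (h : SmoothNear p f) :
    ContinuousAt f p := (Filter.Eventually.self_of_nhds h).continuousAt

theorem smoothNear_coord (p : State) (i : Fin 9) : SmoothNear p (fun p => p i) :=
  Filter.Eventually.of_forall fun _ => by fun_prop

theorem SmoothNear.add {p : State} {f g : State → ℝ} (hf : SmoothNear p f)
    (hg : SmoothNear p g) : SmoothNear p (fun p => f p + g p) := by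
  filter_upwards [hf, hg] with p' h1 h2 using h1.add h2

theorem SmoothNear.sub {p : State} {f g : State → ℝ} (hf : SmoothNear p f)
    (hg : SmoothNear p g) : SmoothNear p (fun p => f p - g p) := by
  filter_upwards [hf, hg] with p' h1 h2 using h1.sub h2

theorem SmoothNear.mul {p : State} {f g : State → ℝ} (hf : SmoothNear p f)
    (hg : SmoothNear p g) : SmoothNear p (fun p => f p * g p) := by
  filter_upwards [hf, hg] with p' h1 h2 using h1.mul h2

theorem SmoothNear.div {p : State} {f g : State → ℝ} (hf : SmoothNear p f)
    (hg : SmoothNear p g) (h0 : g p ≠ 0) : SmoothNear p (fun p => f p / g p) := by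
  filter_upwards [hf, hg, hg.continuousAt.eventually_ne h0] with p' h1 h2 h3 using h1.div h2 h3

theorem SmoothNear.comp {p : State} {f : State → ℝ} (hf : SmoothNear p f) {φ : ℝ → ℝ}
    (hφ : ContDiff ℝ ∞ φ) : SmoothNear p (fun p => φ (f p)) := by
  filter_upwards [hf] with p' h1 using hφ.contDiffAt.comp p' h1

/-- Two smooth functions that do not vanish simultaneously have smooth polar coordinates with a
prescribed value of the modulus (of either sign) and of the angle. -/
theorem exists_polar {p : State} {A B : State → ℝ} (hA : SmoothNear p A) (hB : SmoothNear p B)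
    {q₀ ϑ₀ : ℝ} (hq : q₀ ≠ 0) (h1 : A p = q₀ * Real.cos ϑ₀) (h2 : B p = q₀ * Real.sin ϑ₀) :
    ∃ q ϑ : State → ℝ, SmoothNear p q ∧ SmoothNear p ϑ ∧ q p = q₀ ∧ ϑ p = ϑ₀ ∧
      ∀ᶠ p' in 𝓝 p, A p' = q p' * Real.cos (ϑ p') ∧ B p' = q p' * Real.sin (ϑ p') := by
  -- Rotating the pair `(A, B)` by `-ϑ₀` gives `(C, D)`, equal to `(q₀, 0)` at `p`. Near `p` the
  -- quotient `D / C` is smooth and small, so `arctan (D / C)` is a smooth correction to the angle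
  -- `ϑ₀`. The modulus is written as `C` times a positive square root to keep the sign of `q₀`.
  let C : State → ℝ := fun p => A p * Real.cos ϑ₀ + B p * Real.sin ϑ₀
  let D : State → ℝ := fun p => B p * Real.cos ϑ₀ - A p * Real.sin ϑ₀
  have hcs := Real.cos_sq_add_sin_sq ϑ₀
  have hconst : ∀ c : ℝ, SmoothNear p (fun _ => c) := fun c =>
    Filter.Eventually.of_forall fun _ => contDiffAt_const
  have hC : SmoothNear p C := (hA.mul (hconst _)).add (hB.mul (hconst _))
  have hD : SmoothNear p D := (hB.mul (hconst _)).sub (hA.mul (hconst _))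
  have hCp : C p = q₀ := by simp only [C, h1, h2]; linear_combination q₀ * hcs
  have hDp : D p = 0 := by simp only [D, h1, h2]; ring
  have hC0 : C p ≠ 0 := by rwa [hCp]
  have hdiv : SmoothNear p fun p => D p / C p := hD.div hC hC0
  have hsqrt : ContDiff ℝ ∞ fun s : ℝ => √(1 + s ^ 2) :=
    ContDiff.sqrt (by fun_prop) fun s => by positivity
  refine ⟨fun p => C p * √(1 + (D p / C p) ^ 2), fun p => ϑ₀ + Real.arctan (D p / C p),
    hC.mul (hdiv.comp hsqrt), (hconst ϑ₀).add (hdiv.comp Real.contDiff_arctan), ?_, ?_, ?_⟩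
  · simp [hCp, hDp]
  · simp [hDp]
  · filter_upwards [hC.continuousAt.eventually_ne hC0] with p' hp'
    have hpos : 0 < √(1 + (D p' / C p') ^ 2) := Real.sqrt_pos.2 (by positivity)
    have e1 : C p' * √(1 + (D p' / C p') ^ 2) * Real.cos (Real.arctan (D p' / C p')) = C p' := by
      rw [Real.cos_arctan]; field_simp
    have e2 : C p' * √(1 + (D p' / C p') ^ 2) * Real.sin (Real.arctan (D p' / C p')) = D p' := by
      rw [Real.sin_arctan]; field_simp
    rw [Real.cos_add, Real.sin_add]
    constructor
    · have : A p' = C p' * Real.cos ϑ₀ - D p' * Real.sin ϑ₀ := by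
        simp only [C, D]; linear_combination (-A p') * hcs
      rw [this]
      linear_combination (-Real.cos ϑ₀) * e1 + Real.sin ϑ₀ * e2
    · have : B p' = C p' * Real.sin ϑ₀ + D p' * Real.cos ϑ₀ := by
        simp only [C, D]; linear_combination (-B p') * hcs
      rw [this]
      linear_combination (-Real.sin ϑ₀) * e1 - Real.cos ϑ₀ * e2

/-- Polar coordinates are taken twice: for `(y, z)`, then for `(v, w)` turned back through the angle
`θ` just found. -/
theorem exists_cylChart (p : State) (r θ q ϑ : ℝ) (h : CylRel p r θ q ϑ) :
    ∃ U : Set State, IsOpen U ∧ p ∈ U ∧ ∃ K : CylChart U,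
      K.r p = r ∧ K.θ p = θ ∧ K.q p = q ∧ K.ϑ p = ϑ := by
  obtain ⟨hr, hq, h1, h2, h3, h4⟩ := h
  have hcs := Real.cos_sq_add_sin_sq θ
  obtain ⟨r', θ', sr, sθ, rfl, rfl, hrel⟩ := exists_polar (smoothNear_coord p 2)
    (smoothNear_coord p 3) hr.ne' h1 h2
  have sc := sθ.comp Real.contDiff_cos
  have ss := sθ.comp Real.contDiff_sin
  obtain ⟨q', ϑ', sq, sϑ, rfl, rfl, hrel'⟩ := exists_polar
    (A := fun p => p 5 * Real.cos (θ' p) + p 6 * Real.sin (θ' p))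
    (B := fun p => p 6 * Real.cos (θ' p) - p 5 * Real.sin (θ' p))
    (q₀ := q) (ϑ₀ := ϑ)
    (((smoothNear_coord p 5).mul sc).add ((smoothNear_coord p 6).mul ss))
    (((smoothNear_coord p 6).mul sc).sub ((smoothNear_coord p 5).mul ss)) hq.ne'
    (by simp only [v, w] at h3 h4; rw [h3, h4]; linear_combination q * Real.cos ϑ * hcs)
    (by simp only [v, w] at h3 h4; rw [h3, h4]; linear_combination q * Real.sin ϑ * hcs)
  have hall : ∀ᶠ p' in 𝓝 p, ContDiffAt ℝ ∞ r' p' ∧ ContDiffAt ℝ ∞ θ' p' ∧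
      ContDiffAt ℝ ∞ q' p' ∧ ContDiffAt ℝ ∞ ϑ' p' ∧
      CylRel p' (r' p') (θ' p') (q' p') (ϑ' p') := by
    filter_upwards [sr, sθ, sq, sϑ, hrel, hrel', sr.continuousAt.eventually (lt_mem_nhds hr),
      sq.continuousAt.eventually (lt_mem_nhds hq)] with p' a1 a2 a3 a4 a5 a6 a7 a8
    have hcs := Real.cos_sq_add_sin_sq (θ' p')
    refine ⟨a1, a2, a3, a4, a7, a8, a5.1, a5.2, ?_, ?_⟩
    · rw [← a6.1, ← a6.2, v]; linear_combination (-p' 5) * hcs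
    · rw [← a6.1, ← a6.2, w]; linear_combination (-p' 6) * hcs
  obtain ⟨U, hU, hUo, hpU⟩ := eventually_nhds_iff.1 hall
  exact ⟨U, hUo, hpU, ⟨r', θ', q', ϑ', fun p' hp' => (hU p' hp').1.contDiffWithinAt,
    fun p' hp' => (hU p' hp').2.1.contDiffWithinAt,
    fun p' hp' => (hU p' hp').2.2.1.contDiffWithinAt,
    fun p' hp' => (hU p' hp').2.2.2.1.contDiffWithinAt,
    fun p' hp' => (hU p' hp').2.2.2.2⟩, rfl, rfl, rfl, rfl⟩

/-- Once the rational terms in `t, y, z` are subtracted from `v` and `w`, the relation is the one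
defining polar coordinates, with a modulus of either sign. -/
theorem exists_velChart (b : ℝ) (p : State) (q ϑ : ℝ) (h : VelRel b p q ϑ) :
    ∃ U : Set State, IsOpen U ∧ p ∈ U ∧ ∃ K : VelChart b U, K.q p = q ∧ K.ϑ p = ϑ := by
  obtain ⟨h0, hq, h1, h2⟩ := h
  have hconst : SmoothNear p (fun _ => b) :=
    Filter.Eventually.of_forall fun _ => contDiffAt_const
  have st : SmoothNear p t := smoothNear_coord p 0
  have sy : SmoothNear p y := smoothNear_coord p 2
  have sz : SmoothNear p z := smoothNear_coord p 3
  have sn : SmoothNear p (fun p => t p ^ 2 + b ^ 2) :=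
    (st.comp (φ := fun s => s ^ 2) (by fun_prop)).add
      (hconst.comp (φ := fun s => s ^ 2) (by fun_prop))
  obtain ⟨q', ϑ', sq, sϑ, rfl, rfl, hrel⟩ := exists_polar
    (A := fun p => v p - (t p * y p + b * z p) / (t p ^ 2 + b ^ 2))
    (B := fun p => w p - (t p * z p - b * y p) / (t p ^ 2 + b ^ 2))
    (q₀ := q) (ϑ₀ := ϑ)
    ((smoothNear_coord p 5).sub (((st.mul sy).add (hconst.mul sz)).div sn h0))
    ((smoothNear_coord p 6).sub (((st.mul sz).sub (hconst.mul sy)).div sn h0)) hq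
    (by rw [h1]; ring) (by rw [h2]; ring)
  have hall : ∀ᶠ p' in 𝓝 p, ContDiffAt ℝ ∞ q' p' ∧ ContDiffAt ℝ ∞ ϑ' p' ∧
      VelRel b p' (q' p') (ϑ' p') := by
    filter_upwards [sq, sϑ, hrel, sn.continuousAt.eventually_ne h0,
      sq.continuousAt.eventually_ne hq] with p' a1 a2 a3 a4 a5
    exact ⟨a1, a2, a4, a5, by linear_combination a3.1, by linear_combination a3.2⟩
  obtain ⟨U, hU, hUo, hpU⟩ := eventually_nhds_iff.1 hall
  exact ⟨U, hUo, hpU, ⟨q', ϑ', fun p' hp' => (hU p' hp').1.contDiffWithinAt,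
    fun p' hp' => (hU p' hp').2.1.contDiffWithinAt,
    fun p' hp' => (hU p' hp').2.2⟩, rfl, rfl⟩

/-- Four successive polar decompositions: `(x, y)` has modulus `r sin θ` and angle `φ`; then `z` and
that modulus give `r` and `θ`. In the spherical frame `(V, W)` has modulus `q sin ϑ` and angle `ψ`;
then `U` and that modulus give `q` and `ϑ`. The ranges of `θ` and `ϑ` make the intermediate moduli
nonzero. -/
theorem exists_sphChart (p : State) (r θ φ q ϑ ψ : ℝ) (h : SphRel p r θ φ q ϑ ψ) :
    ∃ U : Set State, IsOpen U ∧ p ∈ U ∧ ∃ K : SphChart U,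
      K.r p = r ∧ K.θ p = θ ∧ K.φ p = φ ∧ K.q p = q ∧ K.ϑ p = ϑ ∧ K.ψ p = ψ := by
  obtain ⟨hr, hq, hθ, hϑ, h1, h2, h3, h4, h5, h6⟩ := h
  have hsθ : 0 < Real.sin θ := Real.sin_pos_of_mem_Ioo hθ
  have hsϑ : 0 < Real.sin ϑ := Real.sin_pos_of_mem_Ioo hϑ
  have st := Real.cos_sq_add_sin_sq θ
  have sf := Real.cos_sq_add_sin_sq φ
  obtain ⟨R, φ', sR, sφ, hR, rfl, hRel⟩ := exists_polar (smoothNear_coord p 1)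
    (smoothNear_coord p 2) (mul_pos hr hsθ).ne' h1 h2
  obtain ⟨r', θ', sr, sθ, rfl, rfl, hrel⟩ := exists_polar (smoothNear_coord p 3)
    sR hr.ne' h3 hR
  have cθ := sθ.comp Real.contDiff_cos
  have sinθ := sθ.comp Real.contDiff_sin
  have cφ := sφ.comp Real.contDiff_cos
  have sinφ := sφ.comp Real.contDiff_sin
  have su : SmoothNear p u := smoothNear_coord p 4
  have sv : SmoothNear p v := smoothNear_coord p 5
  have sw : SmoothNear p w := smoothNear_coord p 6
  have sH := (su.mul cφ).add (sv.mul sinφ)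
  obtain ⟨S, ψ', sS, sψ, hS, rfl, hSel⟩ := exists_polar
    (A := fun p => (u p * Real.cos (φ' p) + v p * Real.sin (φ' p)) * Real.cos (θ' p)
      - w p * Real.sin (θ' p))
    (B := fun p => v p * Real.cos (φ' p) - u p * Real.sin (φ' p))
    (q₀ := q * Real.sin ϑ) (ϑ₀ := ψ)
    ((sH.mul cθ).sub (sw.mul sinθ)) ((sv.mul cφ).sub (su.mul sinφ)) (mul_pos hq hsϑ).ne'
    (by
      rw [h4, h5, h6]
      linear_combination (((q * Real.cos ϑ) * Real.sin (θ' p)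
        + (q * Real.sin ϑ * Real.cos ψ) * Real.cos (θ' p)) * Real.cos (θ' p)) * sf
        + q * Real.sin ϑ * Real.cos ψ * st)
    (by rw [h4, h5]; linear_combination q * Real.sin ϑ * Real.sin ψ * sf)
  obtain ⟨q', ϑ', sq, sϑ, rfl, rfl, hqel⟩ := exists_polar
    (A := fun p => (u p * Real.cos (φ' p) + v p * Real.sin (φ' p)) * Real.sin (θ' p)
      + w p * Real.cos (θ' p))
    (B := S) (q₀ := q) (ϑ₀ := ϑ)
    ((sH.mul sinθ).add (sw.mul cθ)) sS hq.ne'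
    (by
      rw [h4, h5, h6]
      linear_combination (((q * Real.cos ϑ) * Real.sin (θ' p)
        + (q * Real.sin ϑ * Real.cos (ψ' p)) * Real.cos (θ' p)) * Real.sin (θ' p)) * sf
        + q * Real.cos ϑ * st)
    hS
  have hall : ∀ᶠ p' in 𝓝 p, ContDiffAt ℝ ∞ r' p' ∧ ContDiffAt ℝ ∞ θ' p' ∧
      ContDiffAt ℝ ∞ φ' p' ∧ ContDiffAt ℝ ∞ q' p' ∧ ContDiffAt ℝ ∞ ϑ' p' ∧
      ContDiffAt ℝ ∞ ψ' p' ∧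
      SphRel p' (r' p') (θ' p') (φ' p') (q' p') (ϑ' p') (ψ' p') := by
    filter_upwards [sr, sθ, sφ, sq, sϑ, sψ, hRel, hrel, hSel, hqel,
      sr.continuousAt.eventually (lt_mem_nhds hr),
      sq.continuousAt.eventually (lt_mem_nhds hq),
      sθ.continuousAt.eventually (isOpen_Ioo.mem_nhds hθ),
      sϑ.continuousAt.eventually (isOpen_Ioo.mem_nhds hϑ)]
      with p' a1 a2 a3 a4 a5 a6 b1 b2 b3 b4 c1 c2 c3 c4
    have st := Real.cos_sq_add_sin_sq (θ' p')
    have sf := Real.cos_sq_add_sin_sq (φ' p')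
    obtain ⟨b11, b12⟩ := b1
    obtain ⟨b21, b22⟩ := b2
    obtain ⟨b31, b32⟩ := b3
    obtain ⟨b41, b42⟩ := b4
    rw [b22] at b11 b12
    rw [b42] at b31 b32
    refine ⟨a1, a2, a3, a4, a5, a6, c1, c2, c3, c4, b11, b12, b21, ?_, ?_, ?_⟩
    · rw [← b31, ← b32, ← b41]
      linear_combination (-(u p' * Real.cos (φ' p') + v p' * Real.sin (φ' p'))
        * Real.cos (φ' p')) * st - u p' * sf
    · rw [← b31, ← b32, ← b41]
      linear_combination (-(u p' * Real.cos (φ' p') + v p' * Real.sin (φ' p'))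
        * Real.sin (φ' p')) * st - v p' * sf
    · rw [← b31, ← b41]
      linear_combination (-w p') * st
  obtain ⟨U, hU, hUo, hpU⟩ := eventually_nhds_iff.1 hall
  exact ⟨U, hUo, hpU, ⟨r', θ', φ', q', ϑ', ψ', fun p' hp' => (hU p' hp').1.contDiffWithinAt,
    fun p' hp' => (hU p' hp').2.1.contDiffWithinAt,
    fun p' hp' => (hU p' hp').2.2.1.contDiffWithinAt,
    fun p' hp' => (hU p' hp').2.2.2.1.contDiffWithinAt,
    fun p' hp' => (hU p' hp').2.2.2.2.1.contDiffWithinAt,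
    fun p' hp' => (hU p' hp').2.2.2.2.2.1.contDiffWithinAt,
    fun p' hp' => (hU p' hp').2.2.2.2.2.2⟩, rfl, rfl, rfl, rfl, rfl, rfl⟩

/-! ### Differentials and field components with respect to local coordinates. -/

/-- Nine smooth functions with independent differentials on an open set. -/
structure IsCoordSystem (U : Set State) (κ : Fin 9 → State → ℝ) : Prop where
  isOpen : IsOpen U
  smooth : ∀ k, ContDiffOn ℝ ∞ (κ k) U
  injective : ∀ p ∈ U, ∀ ξ, (∀ k, fderiv ℝ (κ k) p ξ = 0) → ξ = 0

/-- The function `f` is smooth on `U` and its differential has the coefficients `a` with respect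
to the differentials of `κ`. -/
structure HasCoeffs (U : Set State) (κ : Fin 9 → State → ℝ) (f : State → ℝ)
    (a : State → Fin 9 → ℝ) : Prop where
  smooth : ContDiffOn ℝ ∞ f U
  deriv : ∀ p ∈ U, HasFDerivAt f (∑ k, a p k • fderiv ℝ (κ k) p) p

/-- The field `Z` has the components `b` with respect to the functions `κ`. -/
def HasComps (U : Set State) (κ : Fin 9 → State → ℝ) (Z : VF) (b : State → Fin 9 → ℝ) : Prop :=
  ∀ p ∈ U, ∀ k, fderiv ℝ (κ k) p (Z p) = b p k

section Rules

variable {U : Set State} {κ : Fin 9 → State → ℝ} {f g : State → ℝ} {a b : State → Fin 9 → ℝ}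

theorem IsCoordSystem.coord (h : IsCoordSystem U κ) (k : Fin 9) :
    HasCoeffs U κ (κ k) (fun _ => Pi.single k 1) where
  smooth := h.smooth k
  deriv p hp := by
    have h1 := (((h.smooth k).contDiffAt (h.isOpen.mem_nhds hp)).differentiableAt
      (by simp)).hasFDerivAt
    refine h1.congr_fderiv ?_
    simp [Pi.single_apply]

theorem HasCoeffs.congr (h : HasCoeffs U κ f a) (hfg : ∀ p, g p = f p) : HasCoeffs U κ g a := by
  rwa [show g = f from funext hfg]

theorem HasCoeffs.congr_coeffs (h : HasCoeffs U κ f a) (hab : ∀ p ∈ U, b p = a p) :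
    HasCoeffs U κ f b :=
  ⟨h.smooth, fun p hp => by rw [hab p hp]; exact h.deriv p hp⟩

theorem hasCoeffs_const (c : ℝ) : HasCoeffs U κ (fun _ => c) (fun _ => 0) where
  smooth := contDiffOn_const
  deriv p _ := (hasFDerivAt_const c p).congr_fderiv (by simp)

theorem HasCoeffs.add (hf : HasCoeffs U κ f a) (hg : HasCoeffs U κ g b) :
    HasCoeffs U κ (fun p => f p + g p) (fun p => a p + b p) where
  smooth := hf.smooth.add hg.smooth
  deriv p hp := ((hf.deriv p hp).add (hg.deriv p hp)).congr_fderiv (by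
    simp [add_smul, Finset.sum_add_distrib])

theorem HasCoeffs.sub (hf : HasCoeffs U κ f a) (hg : HasCoeffs U κ g b) :
    HasCoeffs U κ (fun p => f p - g p) (fun p => a p - b p) where
  smooth := hf.smooth.sub hg.smooth
  deriv p hp := ((hf.deriv p hp).sub (hg.deriv p hp)).congr_fderiv (by
    ext1 ξ
    simp only [Pi.sub_apply, sub_apply, sum_apply, smul_apply, smul_eq_mul,
      sub_mul, Finset.sum_sub_distrib])

theorem HasCoeffs.mul (hf : HasCoeffs U κ f a) (hg : HasCoeffs U κ g b) :
    HasCoeffs U κ (fun p => f p * g p) (fun p => f p • b p + g p • a p) where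
  smooth := hf.smooth.mul hg.smooth
  deriv p hp := ((hf.deriv p hp).mul (hg.deriv p hp)).congr_fderiv (by
    simp [add_smul, Finset.sum_add_distrib, Finset.smul_sum, smul_smul])

theorem HasCoeffs.sq (hf : HasCoeffs U κ f a) :
    HasCoeffs U κ (fun p => f p ^ 2) (fun p => f p • a p + f p • a p) :=
  (hf.mul hf).congr fun p => pow_two (f p)

theorem HasCoeffs.const_mul (hf : HasCoeffs U κ f a) (c : ℝ) :
    HasCoeffs U κ (fun p => c * f p) (fun p => c • a p) where
  smooth := contDiffOn_const.mul hf.smooth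
  deriv p hp := ((hf.deriv p hp).const_mul c).congr_fderiv (by
    simp [Finset.smul_sum, smul_smul])

theorem HasCoeffs.div_const (hf : HasCoeffs U κ f a) (c : ℝ) :
    HasCoeffs U κ (fun p => f p / c) (fun p => c⁻¹ • a p) :=
  (hf.const_mul c⁻¹).congr fun p => by rw [div_eq_inv_mul]

theorem HasCoeffs.inv (hf : HasCoeffs U κ f a) (h0 : ∀ p ∈ U, f p ≠ 0) :
    HasCoeffs U κ (fun p => (f p)⁻¹) (fun p => -((f p ^ 2)⁻¹ • a p)) where
  smooth := hf.smooth.inv h0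
  deriv p hp := ((hasDerivAt_inv (h0 p hp)).comp_hasFDerivAt p (hf.deriv p hp)).congr_fderiv (by
    ext1 ξ
    simp only [Pi.neg_apply, Pi.smul_apply, sum_apply, smul_apply, smul_eq_mul, neg_mul,
      Finset.sum_neg_distrib, Finset.mul_sum, mul_assoc])

theorem HasCoeffs.div (hf : HasCoeffs U κ f a) (hg : HasCoeffs U κ g b)
    (h0 : ∀ p ∈ U, g p ≠ 0) :
    HasCoeffs U κ (fun p => f p / g p) (fun p => (g p)⁻¹ • a p - (f p / g p ^ 2) • b p) := by
  have h := (hf.mul (hg.inv h0)).congr (g := fun p => f p / g p) fun p => div_eq_mul_inv _ _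
  convert h using 2 with p
  rw [smul_neg, smul_smul, div_eq_mul_inv]
  abel

/-- `Real.log` is even, so the differential is `df / f` for either sign of `f`. -/
theorem HasCoeffs.log_abs (hf : HasCoeffs U κ f a) (h0 : ∀ p ∈ U, f p ≠ 0) :
    HasCoeffs U κ (fun p => Real.log |f p|) (fun p => (f p)⁻¹ • a p) := by
  simp only [Real.log_abs]
  exact ⟨hf.smooth.log h0, fun p hp => ((hf.deriv p hp).log (h0 p hp)).congr_fderiv (by
    simp [Finset.smul_sum, smul_smul])⟩

theorem HasComps.add {A B : VF} (hA : HasComps U κ A a) (hB : HasComps U κ B b) :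
    HasComps U κ (A + B) (fun p => a p + b p) := fun p hp k => by
  simp [hA p hp k, hB p hp k]

theorem HasComps.smul {A : VF} (hA : HasComps U κ A a) (c : ℝ) :
    HasComps U κ (c • A) (fun p => c • a p) := fun p hp k => by
  simp [hA p hp k]

end Rules

/-- The dot product of a row of coefficients and a row of components, written out. -/
def pairing (a b : Fin 9 → ℝ) : ℝ :=
  a 0 * b 0 + a 1 * b 1 + a 2 * b 2 + a 3 * b 3 + a 4 * b 4 + a 5 * b 5 + a 6 * b 6 + a 7 * b 7
    + a 8 * b 8

theorem pairing_eq_dotProduct (a b : Fin 9 → ℝ) : pairing a b = a ⬝ᵥ b := by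
  simp [pairing, dotProduct, Fin.sum_univ_succ, add_assoc]

/-- Five independent rows of coefficients orthogonal to four independent rows of components. -/
structure AreComplementary (a0 a1 a2 a3 a4 b0 b1 b2 b3 : Fin 9 → ℝ) : Prop where
  rows : ∀ g0 g1 g2 g3 g4 : ℝ,
    (∀ k, g0 * a0 k + g1 * a1 k + g2 * a2 k + g3 * a3 k + g4 * a4 k = 0) →
      g0 = 0 ∧ g1 = 0 ∧ g2 = 0 ∧ g3 = 0 ∧ g4 = 0
  cols : ∀ g0 g1 g2 g3 : ℝ, (∀ k, g0 * b0 k + g1 * b1 k + g2 * b2 k + g3 * b3 k = 0) →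
      g0 = 0 ∧ g1 = 0 ∧ g2 = 0 ∧ g3 = 0
  orthogonal : ∀ j i, pairing (![a0, a1, a2, a3, a4] j) (![b0, b1, b2, b3] i) = 0

/-- The criterion for a complete set of invariants in terms of a coordinate system. -/
theorem IsCoordSystem.isCompleteInvariantSet {U : Set State} {κ : Fin 9 → State → ℝ}
    (hκ : IsCoordSystem U κ) {I0 I1 I2 I3 I4 : State → ℝ} {Z0 Z1 Z2 Z3 : VF}
    {a0 a1 a2 a3 a4 b0 b1 b2 b3 : State → Fin 9 → ℝ}
    (h0 : HasCoeffs U κ I0 a0) (h1 : HasCoeffs U κ I1 a1) (h2 : HasCoeffs U κ I2 a2)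
    (h3 : HasCoeffs U κ I3 a3) (h4 : HasCoeffs U κ I4 a4)
    (k0 : HasComps U κ Z0 b0) (k1 : HasComps U κ Z1 b1) (k2 : HasComps U κ Z2 b2)
    (k3 : HasComps U κ Z3 b3)
    (h : ∀ p ∈ U, AreComplementary (a0 p) (a1 p) (a2 p) (a3 p) (a4 p)
      (b0 p) (b1 p) (b2 p) (b3 p)) :
    IsCompleteInvariantSet U ![Z0, Z1, Z2, Z3] ![I0, I1, I2, I3, I4] := by
  have hI : ∀ j, HasCoeffs U κ (![I0, I1, I2, I3, I4] j)
      (fun p => ![a0 p, a1 p, a2 p, a3 p, a4 p] j) := by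
    intro j
    fin_cases j <;> assumption
  have hZ : ∀ i, HasComps U κ (![Z0, Z1, Z2, Z3] i) (fun p => ![b0 p, b1 p, b2 p, b3 p] i) := by
    intro i
    fin_cases i <;> assumption
  refine isCompleteInvariantSet_of_linearIndependent hκ.isOpen (fun j => (hI j).smooth) ?_ ?_ ?_
  · intro j i p hp
    rw [((hI j).deriv p hp).fderiv, ← (h p hp).orthogonal j i, pairing_eq_dotProduct,
      dotProduct]
    simp only [sum_apply, smul_apply, smul_eq_mul,
      hZ i p hp]
  · intro p hp
    -- The nine differentials `dκ k` are injective on a nine-dimensional space, so tangent vectors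
    -- dual to them exist. Evaluating a relation between the `dI j` on the `k`-th dual vector gives
    -- the relation between the `k`-th coefficients.
    let D : State →L[ℝ] (Fin 9 → ℝ) := ContinuousLinearMap.pi fun k => fderiv ℝ (κ k) p
    have hinj : Function.Injective (D : State →ₗ[ℝ] (Fin 9 → ℝ)) := by
      rw [← LinearMap.ker_eq_bot, LinearMap.ker_eq_bot']
      exact fun ξ hξ => hκ.injective p hp ξ fun k => congrFun hξ k
    have hsurj := LinearMap.injective_iff_surjective.1 hinj
    rw [Fintype.linearIndependent_iff]
    intro g hg
    have := (h p hp).rows (g 0) (g 1) (g 2) (g 3) (g 4) fun k => by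
      obtain ⟨ξ, hξ⟩ := hsurj (Pi.single k 1)
      have hξ' : ∀ l, fderiv ℝ (κ l) p ξ = (Pi.single k 1 : Fin 9 → ℝ) l := fun l =>
        congrFun hξ l
      have hval : ∀ j, fderiv ℝ (![I0, I1, I2, I3, I4] j) p ξ =
          ![a0 p, a1 p, a2 p, a3 p, a4 p] j k := by
        intro j
        rw [((hI j).deriv p hp).fderiv]
        simp only [sum_apply, smul_apply, smul_eq_mul,
          hξ']
        simp [Pi.single_apply]
      have h9 := congrArg (fun l => l ξ) hg
      simp only [sum_apply, smul_apply, smul_eq_mul,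
        hval] at h9
      simpa [Fin.sum_univ_succ, add_assoc] using h9
    intro j
    fin_cases j
    exacts [this.1, this.2.1, this.2.2.1, this.2.2.2.1, this.2.2.2.2]
  · intro p hp
    rw [Fintype.linearIndependent_iff]
    intro g hg
    have := (h p hp).cols (g 0) (g 1) (g 2) (g 3) fun k => by
      have h9 := congrArg (fderiv ℝ (κ k) p) hg
      simp only [map_sum, map_smul, smul_eq_mul, hZ _ p hp, map_zero] at h9
      simpa [Fin.sum_univ_succ, add_assoc] using h9
    intro j
    fin_cases j
    exacts [this.1, this.2.1, this.2.2.1, this.2.2.2]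

/-! ### Differentials of Cartesian and polar coordinate functions. -/

theorem hasFDerivAt_coord (p : State) (i : Fin 9) :
    HasFDerivAt (fun p : State => p i)
      (ContinuousLinearMap.proj i : (∀ _ : Fin 9, ℝ) →L[ℝ] ℝ) p :=
  (ContinuousLinearMap.proj i : (∀ _ : Fin 9, ℝ) →L[ℝ] ℝ).hasFDerivAt

theorem fderiv_coord (p : State) (i : Fin 9) (ξ : State) :
    fderiv ℝ (fun p : State => p i) p ξ = ξ i := by
  rw [(hasFDerivAt_coord p i).fderiv]; rfl

theorem contDiffOn_coord (U : Set State) (i : Fin 9) :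
    ContDiffOn ℝ ∞ (fun p : State => p i) U := by fun_prop

/-- The differential of a function given in polar coordinates. -/
theorem fderiv_eq_of_polar {U : Set State} (hU : IsOpen U) {q σ A B : State → ℝ}
    (hq : ContDiffOn ℝ ∞ q U) (hσ : ContDiffOn ℝ ∞ σ U) {p : State} (hp : p ∈ U)
    {A' B' : State →L[ℝ] ℝ} (hA : HasFDerivAt A A' p) (hB : HasFDerivAt B B' p)
    (hAq : ∀ p ∈ U, A p = q p * Real.cos (σ p)) (hBq : ∀ p ∈ U, B p = q p * Real.sin (σ p))
    (ξ : State) :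
    A' ξ = Real.cos (σ p) * fderiv ℝ q p ξ - q p * Real.sin (σ p) * fderiv ℝ σ p ξ ∧
    B' ξ = Real.sin (σ p) * fderiv ℝ q p ξ + q p * Real.cos (σ p) * fderiv ℝ σ p ξ := by
  have hq' := ((hq.contDiffAt (hU.mem_nhds hp)).differentiableAt (by simp)).hasFDerivAt
  have hσ' := ((hσ.contDiffAt (hU.mem_nhds hp)).differentiableAt (by simp)).hasFDerivAt
  have hAe : A =ᶠ[𝓝 p] fun p => q p * Real.cos (σ p) :=
    Filter.eventually_of_mem (hU.mem_nhds hp) hAq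
  have hBe : B =ᶠ[𝓝 p] fun p => q p * Real.sin (σ p) :=
    Filter.eventually_of_mem (hU.mem_nhds hp) hBq
  have e1 := hA.unique ((hq'.mul hσ'.cos).congr_of_eventuallyEq hAe)
  have e2 := hB.unique ((hq'.mul hσ'.sin).congr_of_eventuallyEq hBe)
  constructor
  · rw [e1]; simp; ring
  · rw [e2]; simp; ring

/-- The differentials of the polar coordinates of two functions. -/
theorem fderiv_polar {U : Set State} (hU : IsOpen U) {q σ A B : State → ℝ}
    (hq : ContDiffOn ℝ ∞ q U) (hσ : ContDiffOn ℝ ∞ σ U) {p : State} (hp : p ∈ U)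
    {A' B' : State →L[ℝ] ℝ} (hA : HasFDerivAt A A' p) (hB : HasFDerivAt B B' p)
    (hAq : ∀ p ∈ U, A p = q p * Real.cos (σ p)) (hBq : ∀ p ∈ U, B p = q p * Real.sin (σ p))
    (h0 : q p ≠ 0) (ξ : State) :
    fderiv ℝ q p ξ = (A p * A' ξ + B p * B' ξ) / q p ∧
    fderiv ℝ σ p ξ = (A p * B' ξ - B p * A' ξ) / q p ^ 2 := by
  obtain ⟨e1, e2⟩ := fderiv_eq_of_polar hU hq hσ hp hA hB hAq hBq ξ
  have hcs := Real.cos_sq_add_sin_sq (σ p)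
  rw [hAq p hp, hBq p hp, e1, e2]
  constructor
  · rw [eq_div_iff h0]
    linear_combination (-q p * fderiv ℝ q p ξ) * hcs
  · rw [eq_div_iff (pow_ne_zero 2 h0)]
    linear_combination (-q p ^ 2 * fderiv ℝ σ p ξ) * hcs

/-! ### Cartesian coordinates -/

/-- The Cartesian coordinates. -/
def cart (k : Fin 9) (p : State) : ℝ := p k

theorem isCoordSystem_cart {U : Set State} (hU : IsOpen U) : IsCoordSystem U cart where
  isOpen := hU
  smooth k := contDiffOn_coord U k
  injective p _ ξ hξ := funext fun k => by rw [← fderiv_coord p k ξ]; exact hξ k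

theorem IsCoordSystem.hasCoeffs_cart {U : Set State} (h : IsCoordSystem U cart) :
    HasCoeffs U cart t (fun _ => Pi.single 0 1) ∧
    HasCoeffs U cart x (fun _ => Pi.single 1 1) ∧
    HasCoeffs U cart y (fun _ => Pi.single 2 1) ∧
    HasCoeffs U cart z (fun _ => Pi.single 3 1) ∧
    HasCoeffs U cart u (fun _ => Pi.single 4 1) ∧
    HasCoeffs U cart v (fun _ => Pi.single 5 1) ∧
    HasCoeffs U cart w (fun _ => Pi.single 6 1) ∧
    HasCoeffs U cart P (fun _ => Pi.single 8 1) := by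
  exact ⟨h.coord 0, h.coord 1, h.coord 2, h.coord 3, h.coord 4, h.coord 5, h.coord 6, h.coord 8⟩

theorem hasComps_cart (U : Set State) (Z : VF) : HasComps U cart Z Z := fun p _ k =>
  fderiv_coord p k _

theorem HasCoeffs.sum_cart_apply (a : Fin 9 → ℝ) (p ξ : State) :
    (∑ k, a k • fderiv ℝ (cart k) p) ξ = a ⬝ᵥ ξ := by
  simp only [sum_apply, smul_apply, smul_eq_mul, dotProduct]
  exact Finset.sum_congr rfl fun k _ => congrArg _ (fderiv_coord p k ξ)

/-! ### Polar coordinates for a part of the velocity -/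

/-- The coordinates with `v`, `w` replaced by `q`, `σ`. -/
def velCoords (q σ : State → ℝ) : Fin 9 → State → ℝ := ![t, x, y, z, u, q, σ, ρ, P]

/-- The differentials of `A` and `B` are combinations of `dq` and `dσ`. On a vector killed by all
the new differentials they vanish too; the components other than `v` and `w` being already zero,
they reduce there to `dv` and `dw`. -/
theorem isCoordSystem_velCoords {U : Set State} (hU : IsOpen U) {q σ A B : State → ℝ}
    {a b : State → Fin 9 → ℝ} (hq : ContDiffOn ℝ ∞ q U) (hσ : ContDiffOn ℝ ∞ σ U)
    (hA : HasCoeffs U cart A a) (hB : HasCoeffs U cart B b)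
    (hAq : ∀ p ∈ U, A p = q p * Real.cos (σ p)) (hBq : ∀ p ∈ U, B p = q p * Real.sin (σ p))
    (ha : ∀ p ∈ U, a p 5 = 1 ∧ a p 6 = 0) (hb : ∀ p ∈ U, b p 5 = 0 ∧ b p 6 = 1) :
    IsCoordSystem U (velCoords q σ) where
  isOpen := hU
  smooth k := by
    fin_cases k
    exacts [contDiffOn_coord U 0, contDiffOn_coord U 1, contDiffOn_coord U 2,
      contDiffOn_coord U 3, contDiffOn_coord U 4, hq, hσ, contDiffOn_coord U 7,
      contDiffOn_coord U 8]
  injective p hp ξ hξ := by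
    obtain ⟨e1, e2⟩ := fderiv_eq_of_polar hU hq hσ hp (hA.deriv p hp) (hB.deriv p hp) hAq hBq ξ
    have c0 : ξ 0 = 0 := (fderiv_coord p 0 ξ).symm.trans (hξ 0)
    have c1 : ξ 1 = 0 := (fderiv_coord p 1 ξ).symm.trans (hξ 1)
    have c2 : ξ 2 = 0 := (fderiv_coord p 2 ξ).symm.trans (hξ 2)
    have c3 : ξ 3 = 0 := (fderiv_coord p 3 ξ).symm.trans (hξ 3)
    have c4 : ξ 4 = 0 := (fderiv_coord p 4 ξ).symm.trans (hξ 4)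
    have c7 : ξ 7 = 0 := (fderiv_coord p 7 ξ).symm.trans (hξ 7)
    have c8 : ξ 8 = 0 := (fderiv_coord p 8 ξ).symm.trans (hξ 8)
    have d5 : fderiv ℝ q p ξ = 0 := hξ 5
    have d6 : fderiv ℝ σ p ξ = 0 := hξ 6
    rw [HasCoeffs.sum_cart_apply, d5, d6, dotProduct] at e1 e2
    simp [Fin.sum_univ_succ, c0, c1, c2, c3, c4, c7, c8] at e1 e2
    have c5 : ξ 5 = 0 := by
      have h1 := (ha p hp).1
      have h2 := (ha p hp).2
      simpa [h1, h2] using e1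
    have c6 : ξ 6 = 0 := by
      have h1 := (hb p hp).1
      have h2 := (hb p hp).2
      simpa [h1, h2] using e2
    ext k
    fin_cases k <;> assumption

theorem hasComps_velCoords {U : Set State} {q σ : State → ℝ} {Z : VF} {c d : State → ℝ}
    (hq : ∀ p ∈ U, fderiv ℝ q p (Z p) = c p) (hσ : ∀ p ∈ U, fderiv ℝ σ p (Z p) = d p) :
    HasComps U (velCoords q σ) Z
      (fun p => ![Z p 0, Z p 1, Z p 2, Z p 3, Z p 4, c p, d p, Z p 7, Z p 8]) := by
  intro p hp k
  fin_cases k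
  exacts [fderiv_coord p 0 _, fderiv_coord p 1 _, fderiv_coord p 2 _, fderiv_coord p 3 _,
    fderiv_coord p 4 _, hq p hp, hσ p hp, fderiv_coord p 7 _, fderiv_coord p 8 _]

/-- A field along which the two components of the velocity part are rotated with speed `s`. -/
theorem hasComps_velCoords_of_rotation {U : Set State} (hU : IsOpen U) {q σ A B : State → ℝ}
    {a b : State → Fin 9 → ℝ} (hq : ContDiffOn ℝ ∞ q U) (hσ : ContDiffOn ℝ ∞ σ U)
    (hA : HasCoeffs U cart A a) (hB : HasCoeffs U cart B b)
    (hAq : ∀ p ∈ U, A p = q p * Real.cos (σ p)) (hBq : ∀ p ∈ U, B p = q p * Real.sin (σ p))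
    (h0 : ∀ p ∈ U, q p ≠ 0) {Z : VF} (s : ℝ)
    (hAZ : ∀ p ∈ U, a p ⬝ᵥ Z p = -s * B p) (hBZ : ∀ p ∈ U, b p ⬝ᵥ Z p = s * A p) :
    HasComps U (velCoords q σ) Z
      (fun p => ![Z p 0, Z p 1, Z p 2, Z p 3, Z p 4, 0, s, Z p 7, Z p 8]) := by
  have key : ∀ p ∈ U, fderiv ℝ q p (Z p) = 0 ∧ fderiv ℝ σ p (Z p) = s := by
    intro p hp
    obtain ⟨e1, e2⟩ := fderiv_polar hU hq hσ hp (hA.deriv p hp) (hB.deriv p hp) hAq hBq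
      (h0 p hp) (Z p)
    have h := h0 p hp
    have hcs := Real.cos_sq_add_sin_sq (σ p)
    rw [HasCoeffs.sum_cart_apply, HasCoeffs.sum_cart_apply, hAZ p hp, hBZ p hp] at e1 e2
    rw [e1, e2]
    constructor
    · rw [div_eq_zero_iff]; left; ring
    · rw [div_eq_iff (pow_ne_zero 2 h), hAq p hp, hBq p hp]
      linear_combination s * q p ^ 2 * hcs
  exact hasComps_velCoords (fun p hp => (key p hp).1) fun p hp => (key p hp).2

/-! ### Auxiliary velocity variables -/

section Vel

variable {b : ℝ} {U : Set State} (hU : IsOpen U) (K : VelChart b U)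

theorem VelChart.ne (K : VelChart b U) : ∀ p ∈ U, t p ^ 2 + b ^ 2 ≠ 0 := fun p hp => (K.rel p hp).1

theorem VelChart.q_ne (K : VelChart b U) : ∀ p ∈ U, K.q p ≠ 0 := fun p hp => (K.rel p hp).2.1

theorem VelChart.t_ne (K : VelChart 0 U) : ∀ p ∈ U, t p ≠ 0 := fun p hp h => K.ne p hp (by simp [h])

include hU

/-- The pair is `A = v - (t y + b z) / (t² + b²)`, `B = w - (t z - b y) / (t² + b²)`. Invariance
under `b • X3 + X5` and `b • X2 - X6` imposes on the coefficients of `y` and `z` a linear system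
with determinant `-(t² + b²)`, which forces these fractions. Since `(A, B)` is built equivariantly
from the vectors `(v, w)`, `(y, z)` and `(z, -y)`, `X7` rotates it. -/
theorem VelChart.exists_coeffs : ∃ A B : State → ℝ, ∃ a c : State → Fin 9 → ℝ,
    HasCoeffs U cart A a ∧ HasCoeffs U cart B c ∧
    (∀ p ∈ U, A p = K.q p * Real.cos (K.ϑ p)) ∧ (∀ p ∈ U, B p = K.q p * Real.sin (K.ϑ p)) ∧
    (∀ p ∈ U, a p 5 = 1 ∧ a p 6 = 0) ∧ (∀ p ∈ U, c p 5 = 0 ∧ c p 6 = 1) ∧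
    (∀ p ∈ U, a p ⬝ᵥ X1 p = 0 ∧ c p ⬝ᵥ X1 p = 0) ∧
    (∀ p ∈ U, a p ⬝ᵥ X4 p = 0 ∧ c p ⬝ᵥ X4 p = 0) ∧
    (∀ p ∈ U, a p ⬝ᵥ Y p = 0 ∧ c p ⬝ᵥ Y p = 0) ∧
    (∀ p ∈ U, a p ⬝ᵥ (b • X3 + X5) p = 0 ∧ c p ⬝ᵥ (b • X3 + X5) p = 0) ∧
    (∀ p ∈ U, a p ⬝ᵥ (b • X2 - X6) p = 0 ∧ c p ⬝ᵥ (b • X2 - X6) p = 0) ∧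
    (∀ p ∈ U, a p ⬝ᵥ X7 p = -B p ∧ c p ⬝ᵥ X7 p = A p) ∧
    (b = 0 → ∀ p ∈ U, a p ⬝ᵥ X11 p = 0 ∧ c p ⬝ᵥ X11 p = 0) := by
  have hκ := isCoordSystem_cart hU
  have ht : HasCoeffs U cart t _ := hκ.coord 0
  have hy : HasCoeffs U cart y _ := hκ.coord 2
  have hz : HasCoeffs U cart z _ := hκ.coord 3
  have hM := ht.sq.add
    (hasCoeffs_const (U := U) (κ := cart) (b ^ 2))
  have hM0 := K.ne
  refine ⟨_, _, _, _, (hκ.coord 5).sub (((ht.mul hy).add (hz.const_mul b)).div hM hM0),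
    (hκ.coord 6).sub (((ht.mul hz).sub (hy.const_mul b)).div hM hM0), ?_, ?_, ?_, ?_, ?_, ?_, ?_,
    ?_, ?_, ?_, ?_⟩
  · intro p hp
    have := (K.rel p hp).2.2.1
    simp only [cart, v] at this ⊢
    rw [this]; ring
  · intro p hp
    have := (K.rel p hp).2.2.2
    simp only [cart, w] at this ⊢
    rw [this]; ring
  · intro p hp; simp
  · intro p hp; simp
  · intro p hp
    simp [X1, dotProduct, Fin.sum_univ_succ, Pi.single_apply]
  · intro p hp
    simp [X4, dotProduct, Fin.sum_univ_succ, Pi.single_apply]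
  · intro p hp
    simp [Y, dotProduct, Fin.sum_univ_succ, Pi.single_apply]
  · intro p hp
    have := hM0 p hp
    simp [X3, X5, dotProduct, Fin.sum_univ_succ, Pi.single_apply]
    constructor <;> field_simp <;> ring
  · intro p hp
    have := hM0 p hp
    simp [X2, X6, dotProduct, Fin.sum_univ_succ, Pi.single_apply]
    constructor <;> field_simp <;> ring
  · intro p hp
    have := hM0 p hp
    simp [X7, dotProduct, Fin.sum_univ_succ, Pi.single_apply, cart, v, w]
    constructor <;> field_simp <;> ring
  -- For `b = 0` the subtracted terms are `y / t` and `z / t`, homogeneous of degree zero under the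
  -- dilation.
  · rintro rfl p hp
    have := K.t_ne p hp
    simp [X11, dotProduct, Fin.sum_univ_succ, Pi.single_apply]
    constructor <;> field_simp <;> ring

/-- The coordinates attached to the auxiliary velocity variables. -/
theorem VelChart.isCoordSystem : IsCoordSystem U (velCoords K.q K.ϑ) := by
  obtain ⟨A, B, a, c, hA, hB, hAq, hBq, ha, hc, -⟩ := K.exists_coeffs hU
  exact isCoordSystem_velCoords hU K.smooth_q K.smooth_ϑ hA hB hAq hBq ha hc

theorem VelChart.hasCoeffs :
    HasCoeffs U (velCoords K.q K.ϑ) t (fun _ => Pi.single 0 1) ∧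
    HasCoeffs U (velCoords K.q K.ϑ) x (fun _ => Pi.single 1 1) ∧
    HasCoeffs U (velCoords K.q K.ϑ) y (fun _ => Pi.single 2 1) ∧
    HasCoeffs U (velCoords K.q K.ϑ) z (fun _ => Pi.single 3 1) ∧
    HasCoeffs U (velCoords K.q K.ϑ) u (fun _ => Pi.single 4 1) ∧
    HasCoeffs U (velCoords K.q K.ϑ) K.q (fun _ => Pi.single 5 1) ∧
    HasCoeffs U (velCoords K.q K.ϑ) K.ϑ (fun _ => Pi.single 6 1) ∧
    HasCoeffs U (velCoords K.q K.ϑ) P (fun _ => Pi.single 8 1) := by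
  have h := K.isCoordSystem hU
  exact ⟨h.coord 0, h.coord 1, h.coord 2, h.coord 3, h.coord 4, h.coord 5, h.coord 6, h.coord 8⟩

theorem VelChart.hasComps_X1 :
    HasComps U (velCoords K.q K.ϑ) X1 (fun _ => ![0, 1, 0, 0, 0, 0, 0, 0, 0]) := by
  obtain ⟨A, B, a, c, hA, hB, hAq, hBq, ha, hc, h, -⟩ := K.exists_coeffs hU
  exact hasComps_velCoords_of_rotation hU K.smooth_q K.smooth_ϑ hA hB hAq hBq K.q_ne 0
    (fun p hp => by simpa using (h p hp).1) (fun p hp => by simpa using (h p hp).2)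

theorem VelChart.hasComps_X4 :
    HasComps U (velCoords K.q K.ϑ) X4 (fun p => ![0, t p, 0, 0, 1, 0, 0, 0, 0]) := by
  obtain ⟨A, B, a, c, hA, hB, hAq, hBq, ha, hc, -, h, -⟩ := K.exists_coeffs hU
  exact hasComps_velCoords_of_rotation hU K.smooth_q K.smooth_ϑ hA hB hAq hBq K.q_ne 0
    (fun p hp => by simpa using (h p hp).1) (fun p hp => by simpa using (h p hp).2)

theorem VelChart.hasComps_Y :
    HasComps U (velCoords K.q K.ϑ) Y (fun _ => ![0, 0, 0, 0, 0, 0, 0, 0, 1]) := by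
  obtain ⟨A, B, a, c, hA, hB, hAq, hBq, ha, hc, -, -, h, -⟩ := K.exists_coeffs hU
  exact hasComps_velCoords_of_rotation hU K.smooth_q K.smooth_ϑ hA hB hAq hBq K.q_ne 0
    (fun p hp => by simpa using (h p hp).1) (fun p hp => by simpa using (h p hp).2)

theorem VelChart.hasComps_X3_X5 :
    HasComps U (velCoords K.q K.ϑ) (b • X3 + X5) (fun p => ![0, 0, t p, b, 0, 0, 0, 0, 0]) := by
  obtain ⟨A, B, a, c, hA, hB, hAq, hBq, ha, hc, -, -, -, h, -⟩ := K.exists_coeffs hU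
  convert hasComps_velCoords_of_rotation hU K.smooth_q K.smooth_ϑ hA hB hAq hBq K.q_ne 0
    (fun p hp => by rw [(h p hp).1]; simp) (fun p hp => by rw [(h p hp).2]; simp) using 2
  simp [X3, X5]

theorem VelChart.hasComps_X2_X6 :
    HasComps U (velCoords K.q K.ϑ) (b • X2 - X6) (fun p => ![0, 0, b, -t p, 0, 0, 0, 0, 0]) := by
  obtain ⟨A, B, a, c, hA, hB, hAq, hBq, ha, hc, -, -, -, -, h, -⟩ := K.exists_coeffs hU
  convert hasComps_velCoords_of_rotation hU K.smooth_q K.smooth_ϑ hA hB hAq hBq K.q_ne 0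
    (fun p hp => by rw [(h p hp).1]; simp) (fun p hp => by rw [(h p hp).2]; simp) using 2
  simp [X2, X6]

theorem VelChart.hasComps_X7 :
    HasComps U (velCoords K.q K.ϑ) X7 (fun p => ![0, 0, -z p, y p, 0, 0, 1, 0, 0]) := by
  obtain ⟨A, B, a, c, hA, hB, hAq, hBq, ha, hc, -, -, -, -, -, h, -⟩ := K.exists_coeffs hU
  exact hasComps_velCoords_of_rotation hU K.smooth_q K.smooth_ϑ hA hB hAq hBq K.q_ne 1
    (fun p hp => by simpa using (h p hp).1) (fun p hp => by simpa using (h p hp).2)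

end Vel

section VelZero

variable {U : Set State} (hU : IsOpen U) (K : VelChart 0 U)

include hU

theorem VelChart.hasComps_X11 :
    HasComps U (velCoords K.q K.ϑ) X11 (fun p => ![t p, x p, y p, z p, 0, 0, 0, 0, 0]) := by
  obtain ⟨A, B, a, c, hA, hB, hAq, hBq, ha, hc, -, -, -, -, -, -, h⟩ := K.exists_coeffs hU
  exact hasComps_velCoords_of_rotation hU K.smooth_q K.smooth_ϑ hA hB hAq hBq K.q_ne 0
    (fun p hp => by simpa using (h rfl p hp).1) (fun p hp => by simpa using (h rfl p hp).2)

theorem VelChart.hasComps_X5 :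
    HasComps U (velCoords K.q K.ϑ) X5 (fun p => ![0, 0, t p, 0, 0, 0, 0, 0, 0]) := by
  simpa using K.hasComps_X3_X5 hU

theorem VelChart.hasComps_X6 :
    HasComps U (velCoords K.q K.ϑ) X6 (fun p => ![0, 0, 0, t p, 0, 0, 0, 0, 0]) := by
  convert (K.hasComps_X2_X6 hU).smul (-1) using 2 <;> simp

end VelZero

/-! ### Cylindrical coordinates -/

section Cyl

variable {U : Set State} (hU : IsOpen U) (K : CylChart U)

/-- The cylindrical coordinates. -/
def CylChart.coords (K : CylChart U) : Fin 9 → State → ℝ := ![t, x, K.r, K.θ, u, K.q, K.ϑ, ρ, P]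

/-- The angle of the velocity component orthogonal to the axis. -/
def CylChart.σ (K : CylChart U) (p : State) : ℝ := K.θ p + K.ϑ p

theorem CylChart.r_ne (K : CylChart U) : ∀ p ∈ U, K.r p ≠ 0 := fun p hp => (K.rel p hp).1.ne'

theorem CylChart.q_ne (K : CylChart U) : ∀ p ∈ U, K.q p ≠ 0 := fun p hp => (K.rel p hp).2.1.ne'

theorem CylChart.smooth_σ (K : CylChart U) : ContDiffOn ℝ ∞ K.σ U := K.smooth_θ.add K.smooth_ϑ

theorem CylChart.y_eq (K : CylChart U) : ∀ p ∈ U, y p = K.r p * Real.cos (K.θ p) :=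
  fun p hp => (K.rel p hp).2.2.1

theorem CylChart.z_eq (K : CylChart U) : ∀ p ∈ U, z p = K.r p * Real.sin (K.θ p) :=
  fun p hp => (K.rel p hp).2.2.2.1

theorem CylChart.v_eq (K : CylChart U) : ∀ p ∈ U, v p = K.q p * Real.cos (K.σ p) := fun p hp => by
  rw [(K.rel p hp).2.2.2.2.1, CylChart.σ, Real.cos_add]; ring

theorem CylChart.w_eq (K : CylChart U) : ∀ p ∈ U, w p = K.q p * Real.sin (K.σ p) := fun p hp => by
  rw [(K.rel p hp).2.2.2.2.2, CylChart.σ, Real.sin_add]; ring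

include hU

/-- The pair `(v, w)` has polar coordinates `q` and `θ + ϑ`. Keeping `y` and `z` alongside them is
convenient for algebras containing `X2` and `X3`, which remain constant coordinate fields. -/
theorem CylChart.isCoordSystem_vel : IsCoordSystem U (velCoords K.q K.σ) :=
  isCoordSystem_velCoords hU K.smooth_q K.smooth_σ ((isCoordSystem_cart hU).coord 5)
    ((isCoordSystem_cart hU).coord 6) K.v_eq K.w_eq (by simp) (by simp)

theorem CylChart.hasCoeffs_vel :
    HasCoeffs U (velCoords K.q K.σ) t (fun _ => Pi.single 0 1) ∧
    HasCoeffs U (velCoords K.q K.σ) x (fun _ => Pi.single 1 1) ∧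
    HasCoeffs U (velCoords K.q K.σ) y (fun _ => Pi.single 2 1) ∧
    HasCoeffs U (velCoords K.q K.σ) z (fun _ => Pi.single 3 1) ∧
    HasCoeffs U (velCoords K.q K.σ) u (fun _ => Pi.single 4 1) ∧
    HasCoeffs U (velCoords K.q K.σ) K.q (fun _ => Pi.single 5 1) ∧
    HasCoeffs U (velCoords K.q K.σ) (fun p => K.θ p + K.ϑ p) (fun _ => Pi.single 6 1) ∧
    HasCoeffs U (velCoords K.q K.σ) P (fun _ => Pi.single 8 1) := by
  have h := K.isCoordSystem_vel hU
  exact ⟨h.coord 0, h.coord 1, h.coord 2, h.coord 3, h.coord 4, h.coord 5, h.coord 6, h.coord 8⟩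

theorem CylChart.hasComps_vel {Z : VF} (s : ℝ) (h5 : ∀ p ∈ U, Z p 5 = -s * w p)
    (h6 : ∀ p ∈ U, Z p 6 = s * v p) : HasComps U (velCoords K.q K.σ) Z
      (fun p => ![Z p 0, Z p 1, Z p 2, Z p 3, Z p 4, 0, s, Z p 7, Z p 8]) :=
  hasComps_velCoords_of_rotation hU K.smooth_q K.smooth_σ ((isCoordSystem_cart hU).coord 5)
    ((isCoordSystem_cart hU).coord 6) K.v_eq K.w_eq K.q_ne s
    (fun p hp => by simpa [cart, w] using h5 p hp) (fun p hp => by simpa [cart, v] using h6 p hp)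

theorem CylChart.hasComps_vel_X1 :
    HasComps U (velCoords K.q K.σ) X1 (fun _ => ![0, 1, 0, 0, 0, 0, 0, 0, 0]) :=
  K.hasComps_vel hU 0 (by simp [X1]) (by simp [X1])

theorem CylChart.hasComps_vel_X2 :
    HasComps U (velCoords K.q K.σ) X2 (fun _ => ![0, 0, 1, 0, 0, 0, 0, 0, 0]) :=
  K.hasComps_vel hU 0 (by simp [X2]) (by simp [X2])

theorem CylChart.hasComps_vel_X3 :
    HasComps U (velCoords K.q K.σ) X3 (fun _ => ![0, 0, 0, 1, 0, 0, 0, 0, 0]) :=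
  K.hasComps_vel hU 0 (by simp [X3]) (by simp [X3])

theorem CylChart.hasComps_vel_X4 :
    HasComps U (velCoords K.q K.σ) X4 (fun p => ![0, t p, 0, 0, 1, 0, 0, 0, 0]) :=
  K.hasComps_vel hU 0 (by simp [X4]) (by simp [X4])

theorem CylChart.hasComps_vel_X7 :
    HasComps U (velCoords K.q K.σ) X7 (fun p => ![0, 0, -z p, y p, 0, 0, 1, 0, 0]) :=
  K.hasComps_vel hU 1 (by simp [X7]) (by simp [X7])

theorem CylChart.hasComps_vel_X10 :
    HasComps U (velCoords K.q K.σ) X10 (fun _ => ![1, 0, 0, 0, 0, 0, 0, 0, 0]) :=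
  K.hasComps_vel hU 0 (by simp [X10]) (by simp [X10])

theorem CylChart.hasComps_vel_X11 :
    HasComps U (velCoords K.q K.σ) X11 (fun p => ![t p, x p, y p, z p, 0, 0, 0, 0, 0]) :=
  K.hasComps_vel hU 0 (by simp [X11]) (by simp [X11])

theorem CylChart.hasComps_vel_Y :
    HasComps U (velCoords K.q K.σ) Y (fun _ => ![0, 0, 0, 0, 0, 0, 0, 0, 1]) :=
  K.hasComps_vel hU 0 (by simp [Y]) (by simp [Y])

theorem CylChart.fderiv_σ {p : State} (hp : p ∈ U) (ξ : State) :
    fderiv ℝ K.σ p ξ = fderiv ℝ K.θ p ξ + fderiv ℝ K.ϑ p ξ := by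
  have h1 := (K.smooth_θ.contDiffAt (hU.mem_nhds hp)).differentiableAt (by simp)
  have h2 := (K.smooth_ϑ.contDiffAt (hU.mem_nhds hp)).differentiableAt (by simp)
  have h : K.σ = K.θ + K.ϑ := rfl
  rw [h, fderiv_add h1 h2]
  rfl

/-- If `dr` and `dθ` vanish on a vector then so do `dy` and `dz`; with `dϑ` vanishing too, the
differential of `θ + ϑ` is zero. This reduces the claim to the mixed system `velCoords K.q K.σ`. -/
theorem CylChart.isCoordSystem : IsCoordSystem U K.coords where
  isOpen := hU
  smooth k := by
    fin_cases k
    exacts [contDiffOn_coord U 0, contDiffOn_coord U 1, K.smooth_r, K.smooth_θ,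
      contDiffOn_coord U 4, K.smooth_q, K.smooth_ϑ, contDiffOn_coord U 7, contDiffOn_coord U 8]
  injective p hp ξ hξ := by
    obtain ⟨e1, e2⟩ := fderiv_eq_of_polar hU K.smooth_r K.smooth_θ hp (hasFDerivAt_coord p 2)
      (hasFDerivAt_coord p 3) K.y_eq K.z_eq ξ
    have d2 : fderiv ℝ K.r p ξ = 0 := hξ 2
    have d3 : fderiv ℝ K.θ p ξ = 0 := hξ 3
    have d5 : fderiv ℝ K.q p ξ = 0 := hξ 5
    have d6 : fderiv ℝ K.ϑ p ξ = 0 := hξ 6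
    have c0 : ξ 0 = 0 := (fderiv_coord p 0 ξ).symm.trans (hξ 0)
    have c1 : ξ 1 = 0 := (fderiv_coord p 1 ξ).symm.trans (hξ 1)
    have c4 : ξ 4 = 0 := (fderiv_coord p 4 ξ).symm.trans (hξ 4)
    have c7 : ξ 7 = 0 := (fderiv_coord p 7 ξ).symm.trans (hξ 7)
    have c8 : ξ 8 = 0 := (fderiv_coord p 8 ξ).symm.trans (hξ 8)
    rw [d2, d3] at e1 e2
    refine (K.isCoordSystem_vel hU).injective p hp ξ fun k => ?_
    fin_cases k
    · exact (fderiv_coord p 0 ξ).trans c0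
    · exact (fderiv_coord p 1 ξ).trans c1
    · exact (fderiv_coord p 2 ξ).trans (e1.trans (by ring))
    · exact (fderiv_coord p 3 ξ).trans (e2.trans (by ring))
    · exact (fderiv_coord p 4 ξ).trans c4
    · exact d5
    · exact (K.fderiv_σ hU hp ξ).trans (by rw [d3, d6, add_zero])
    · exact (fderiv_coord p 7 ξ).trans c7
    · exact (fderiv_coord p 8 ξ).trans c8

theorem CylChart.hasCoeffs :
    HasCoeffs U K.coords t (fun _ => Pi.single 0 1) ∧
    HasCoeffs U K.coords x (fun _ => Pi.single 1 1) ∧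
    HasCoeffs U K.coords K.r (fun _ => Pi.single 2 1) ∧
    HasCoeffs U K.coords K.θ (fun _ => Pi.single 3 1) ∧
    HasCoeffs U K.coords u (fun _ => Pi.single 4 1) ∧
    HasCoeffs U K.coords K.q (fun _ => Pi.single 5 1) ∧
    HasCoeffs U K.coords K.ϑ (fun _ => Pi.single 6 1) ∧
    HasCoeffs U K.coords P (fun _ => Pi.single 8 1) := by
  have h := K.isCoordSystem hU
  exact ⟨h.coord 0, h.coord 1, h.coord 2, h.coord 3, h.coord 4, h.coord 5, h.coord 6, h.coord 8⟩

/-- A field that rotates positions and velocities with speed `s` and dilates positions with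
factor `m`. -/
theorem CylChart.hasComps {Z : VF} (s m : ℝ) (h2 : ∀ p ∈ U, Z p 2 = m * y p - s * z p)
    (h3 : ∀ p ∈ U, Z p 3 = m * z p + s * y p) (h5 : ∀ p ∈ U, Z p 5 = -s * w p)
    (h6 : ∀ p ∈ U, Z p 6 = s * v p) : HasComps U K.coords Z
      (fun p => ![Z p 0, Z p 1, m * K.r p, s, Z p 4, 0, 0, Z p 7, Z p 8]) := by
  have key : ∀ p ∈ U, fderiv ℝ K.r p (Z p) = m * K.r p ∧ fderiv ℝ K.θ p (Z p) = s := by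
    intro p hp
    obtain ⟨e1, e2⟩ := fderiv_polar hU K.smooth_r K.smooth_θ hp (hasFDerivAt_coord p 2)
      (hasFDerivAt_coord p 3) K.y_eq K.z_eq (K.r_ne p hp) (Z p)
    have hcs := Real.cos_sq_add_sin_sq (K.θ p)
    have h := K.r_ne p hp
    simp only [ContinuousLinearMap.proj_apply, h2 p hp, h3 p hp] at e1 e2
    have hy : p 2 = _ := K.y_eq p hp
    have hz : p 3 = _ := K.z_eq p hp
    rw [e1, e2, hy, hz, K.y_eq p hp, K.z_eq p hp]
    constructor
    · rw [div_eq_iff h]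
      linear_combination (m * K.r p ^ 2) * hcs
    · rw [div_eq_iff (pow_ne_zero 2 h)]
      linear_combination (s * K.r p ^ 2) * hcs
  have hvel := K.hasComps_vel hU s h5 h6
  intro p hp k
  have hq : fderiv ℝ K.q p (Z p) = 0 := hvel p hp 5
  have hσ : fderiv ℝ K.σ p (Z p) = s := hvel p hp 6
  -- `θ` and `σ = θ + ϑ` both turn with speed `s`, so `ϑ` does not change along `Z`.
  rw [K.fderiv_σ hU hp, (key p hp).2] at hσ
  fin_cases k
  · exact fderiv_coord p 0 _
  · exact fderiv_coord p 1 _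
  · exact (key p hp).1
  · exact (key p hp).2
  · exact fderiv_coord p 4 _
  · exact hq
  · exact add_eq_left.1 hσ
  · exact fderiv_coord p 7 _
  · exact fderiv_coord p 8 _

theorem CylChart.hasComps_X1 :
    HasComps U K.coords X1 (fun _ => ![0, 1, 0, 0, 0, 0, 0, 0, 0]) := by
  simpa [X1] using K.hasComps (Z := X1) hU 0 0 (by simp [X1]) (by simp [X1]) (by simp [X1])
    (by simp [X1])

theorem CylChart.hasComps_X4 :
    HasComps U K.coords X4 (fun p => ![0, t p, 0, 0, 1, 0, 0, 0, 0]) := by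
  simpa [X4] using K.hasComps (Z := X4) hU 0 0 (by simp [X4]) (by simp [X4]) (by simp [X4])
    (by simp [X4])

theorem CylChart.hasComps_X7 :
    HasComps U K.coords X7 (fun _ => ![0, 0, 0, 1, 0, 0, 0, 0, 0]) := by
  simpa [X7] using K.hasComps (Z := X7) hU 1 0 (by simp [X7]) (by simp [X7]) (by simp [X7])
    (by simp [X7])

theorem CylChart.hasComps_X10 :
    HasComps U K.coords X10 (fun _ => ![1, 0, 0, 0, 0, 0, 0, 0, 0]) := by
  simpa [X10] using K.hasComps (Z := X10) hU 0 0 (by simp [X10]) (by simp [X10])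
    (by simp [X10]) (by simp [X10])

theorem CylChart.hasComps_X11 :
    HasComps U K.coords X11 (fun p => ![t p, x p, K.r p, 0, 0, 0, 0, 0, 0]) := by
  simpa [X11] using K.hasComps (Z := X11) hU 0 1 (by simp [X11]) (by simp [X11])
    (by simp [X11]) (by simp [X11])

theorem CylChart.hasComps_Y :
    HasComps U K.coords Y (fun _ => ![0, 0, 0, 0, 0, 0, 0, 0, 1]) := by
  simpa [Y] using K.hasComps (Z := Y) hU 0 0 (by simp [Y]) (by simp [Y]) (by simp [Y])
    (by simp [Y])

end Cyl

/-! ### The four-dimensional subalgebras and their structure constants. -/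

theorem isSubalgebraBasis_X7_X8_X9_YX11 :
    IsSubalgebraBasis ![X7, X8, X9, Y + X11] := by
  refine isSubalgebraBasis_of_coeffs ![0, 0, 0, 0, 0, 0, 1, 0, 0, 0, 0, 0]
    ![0, 0, 0, 0, 0, 0, 0, 1, 0, 0, 0, 0]
    ![0, 0, 0, 0, 0, 0, 0, 0, 1, 0, 0, 0]
    ![0, 0, 0, 0, 0, 0, 0, 0, 0, 0, 1, 1]
    (by simp [gen_eq]) ?_
    -- In each case these entries are the structure constants, `m i j` standing for the bracket of
    -- the `i`-th and `j`-th basis fields. Here `[X8, X9] = -X7`, `[X7, X9] = X8`, `[X7, X8] = -X9`,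
    -- and the fourth field commutes with rotations.
    (fun m => ![-m 1 2, m 0 2, -m 0 1, 0]) ?_
  · intro g0 g1 g2 g3 h
    simp [Fin.forall_fin_succ] at h
    grind
  · intro α β
    simp [Fin.forall_fin_succ, brk, wedge]
    grind

theorem isSubalgebraBasis_X7_X8_X9_YX10 :
    IsSubalgebraBasis ![X7, X8, X9, Y + X10] := by
  refine isSubalgebraBasis_of_coeffs ![0, 0, 0, 0, 0, 0, 1, 0, 0, 0, 0, 0]
    ![0, 0, 0, 0, 0, 0, 0, 1, 0, 0, 0, 0]
    ![0, 0, 0, 0, 0, 0, 0, 0, 1, 0, 0, 0]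
    ![0, 0, 0, 0, 0, 0, 0, 0, 0, 1, 0, 1]
    (by simp [gen_eq]) ?_
    (fun m => ![-m 1 2, m 0 2, -m 0 1, 0]) ?_
  · intro g0 g1 g2 g3 h
    simp [Fin.forall_fin_succ] at h
    grind
  · intro α β
    simp [Fin.forall_fin_succ, brk, wedge]
    grind

/-- `X4` commutes with both `X7` and `X11`, so the only nonzero bracket between basis fields is that
of `X1` with the dilation. -/
theorem isSubalgebraBasis_X1_X4X7_X4X11_YX4 (a b : ℝ) :
    IsSubalgebraBasis ![X1, a • X4 + X7, b • X4 + X11, Y + X4] := by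
  refine isSubalgebraBasis_of_coeffs ![1, 0, 0, 0, 0, 0, 0, 0, 0, 0, 0, 0]
    ![0, 0, 0, a, 0, 0, 1, 0, 0, 0, 0, 0]
    ![0, 0, 0, b, 0, 0, 0, 0, 0, 0, 1, 0]
    ![0, 0, 0, 1, 0, 0, 0, 0, 0, 0, 0, 1]
    (by simp [gen_eq]) ?_
    (fun m => ![m 0 2, 0, 0, 0]) ?_
  · intro g0 g1 g2 g3 h
    simp [Fin.forall_fin_succ] at h
    grind
  · intro α β
    simp [Fin.forall_fin_succ, brk, wedge]
    grind

theorem isSubalgebraBasis_X1_X4_X7X10_YX10 :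
    IsSubalgebraBasis ![X1, X4, X7 + X10, Y + X10] := by
  refine isSubalgebraBasis_of_coeffs ![1, 0, 0, 0, 0, 0, 0, 0, 0, 0, 0, 0]
    ![0, 0, 0, 1, 0, 0, 0, 0, 0, 0, 0, 0]
    ![0, 0, 0, 0, 0, 0, 1, 0, 0, 1, 0, 0]
    ![0, 0, 0, 0, 0, 0, 0, 0, 0, 1, 0, 1]
    (by simp [gen_eq]) ?_
    (fun m => ![-m 1 2 - m 1 3, 0, 0, 0]) ?_
  · intro g0 g1 g2 g3 h
    simp [Fin.forall_fin_succ] at h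
    grind
  · intro α β
    simp [Fin.forall_fin_succ, brk, wedge]
    grind

theorem isSubalgebraBasis_X2_X3_X7X10_YX1X10 (a b : ℝ) :
    IsSubalgebraBasis ![X2, X3, X7 + X10, Y + a • X1 + b • X10] := by
  refine isSubalgebraBasis_of_coeffs ![0, 1, 0, 0, 0, 0, 0, 0, 0, 0, 0, 0]
    ![0, 0, 1, 0, 0, 0, 0, 0, 0, 0, 0, 0]
    ![0, 0, 0, 0, 0, 0, 1, 0, 0, 1, 0, 0]
    ![a, 0, 0, 0, 0, 0, 0, 0, 0, b, 0, 1]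
    (by simp [gen_eq]) ?_
    (fun m => ![-m 1 2, m 0 2, 0, 0]) ?_
  · intro g0 g1 g2 g3 h
    simp [Fin.forall_fin_succ] at h
    grind
  · intro α β
    simp [Fin.forall_fin_succ, brk, wedge]
    grind

theorem isSubalgebraBasis_X2_X3_X7X10_YX10 :
    IsSubalgebraBasis ![X2, X3, X7 + X10, Y + X10] := by
  refine isSubalgebraBasis_of_coeffs ![0, 1, 0, 0, 0, 0, 0, 0, 0, 0, 0, 0]
    ![0, 0, 1, 0, 0, 0, 0, 0, 0, 0, 0, 0]
    ![0, 0, 0, 0, 0, 0, 1, 0, 0, 1, 0, 0]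
    ![0, 0, 0, 0, 0, 0, 0, 0, 0, 1, 0, 1]
    (by simp [gen_eq]) ?_
    (fun m => ![-m 1 2, m 0 2, 0, 0]) ?_
  · intro g0 g1 g2 g3 h
    simp [Fin.forall_fin_succ] at h
    grind
  · intro α β
    simp [Fin.forall_fin_succ, brk, wedge]
    grind

theorem isSubalgebraBasis_X1_X4_X11_YX7 :
    IsSubalgebraBasis ![X1, X4, X11, Y + X7] := by
  refine isSubalgebraBasis_of_coeffs ![1, 0, 0, 0, 0, 0, 0, 0, 0, 0, 0, 0]
    ![0, 0, 0, 1, 0, 0, 0, 0, 0, 0, 0, 0]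
    ![0, 0, 0, 0, 0, 0, 0, 0, 0, 0, 1, 0]
    ![0, 0, 0, 0, 0, 0, 1, 0, 0, 0, 0, 1]
    (by simp [gen_eq]) ?_
    (fun m => ![m 0 2, 0, 0, 0]) ?_
  · intro g0 g1 g2 g3 h
    simp [Fin.forall_fin_succ] at h
    grind
  · intro α β
    simp [Fin.forall_fin_succ, brk, wedge]
    grind

theorem isSubalgebraBasis_X1_X4_X10_YX7X11 (a : ℝ) :
    IsSubalgebraBasis ![X1, X4, X10, Y + a • X7 + X11] := by
  refine isSubalgebraBasis_of_coeffs ![1, 0, 0, 0, 0, 0, 0, 0, 0, 0, 0, 0]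
    ![0, 0, 0, 1, 0, 0, 0, 0, 0, 0, 0, 0]
    ![0, 0, 0, 0, 0, 0, 0, 0, 0, 1, 0, 0]
    ![0, 0, 0, 0, 0, 0, a, 0, 0, 0, 1, 1]
    (by simp [gen_eq]) ?_
    (fun m => ![m 0 3 - m 1 2, 0, m 2 3, 0]) ?_
  · intro g0 g1 g2 g3 h
    simp [Fin.forall_fin_succ] at h
    grind
  · intro α β
    simp [Fin.forall_fin_succ, brk, wedge]
    grind

theorem isSubalgebraBasis_X1_X4_X10_YX11 :
    IsSubalgebraBasis ![X1, X4, X10, Y + X11] := by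
  refine isSubalgebraBasis_of_coeffs ![1, 0, 0, 0, 0, 0, 0, 0, 0, 0, 0, 0]
    ![0, 0, 0, 1, 0, 0, 0, 0, 0, 0, 0, 0]
    ![0, 0, 0, 0, 0, 0, 0, 0, 0, 1, 0, 0]
    ![0, 0, 0, 0, 0, 0, 0, 0, 0, 0, 1, 1]
    (by simp [gen_eq]) ?_
    (fun m => ![m 0 3 - m 1 2, 0, m 2 3, 0]) ?_
  · intro g0 g1 g2 g3 h
    simp [Fin.forall_fin_succ] at h
    grind
  · intro α β
    simp [Fin.forall_fin_succ, brk, wedge]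
    grind

theorem isSubalgebraBasis_X1_X4_X10_YX7 :
    IsSubalgebraBasis ![X1, X4, X10, Y + X7] := by
  refine isSubalgebraBasis_of_coeffs ![1, 0, 0, 0, 0, 0, 0, 0, 0, 0, 0, 0]
    ![0, 0, 0, 1, 0, 0, 0, 0, 0, 0, 0, 0]
    ![0, 0, 0, 0, 0, 0, 0, 0, 0, 1, 0, 0]
    ![0, 0, 0, 0, 0, 0, 1, 0, 0, 0, 0, 1]
    (by simp [gen_eq]) ?_
    (fun m => ![-m 1 2, 0, 0, 0]) ?_
  · intro g0 g1 g2 g3 h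
    simp [Fin.forall_fin_succ] at h
    grind
  · intro α β
    simp [Fin.forall_fin_succ, brk, wedge]

theorem isSubalgebraBasis_X2_X3_X4X10_YX1X7 (ε a : ℝ) :
    IsSubalgebraBasis ![X2, X3, ε • X4 + X10, Y + a • X1 + X7] := by
  refine isSubalgebraBasis_of_coeffs ![0, 1, 0, 0, 0, 0, 0, 0, 0, 0, 0, 0]
    ![0, 0, 1, 0, 0, 0, 0, 0, 0, 0, 0, 0]
    ![0, 0, 0, ε, 0, 0, 0, 0, 0, 1, 0, 0]
    ![a, 0, 0, 0, 0, 0, 1, 0, 0, 0, 0, 1]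
    (by simp [gen_eq]) ?_
    (fun m => ![-m 1 3, m 0 3, 0, 0]) ?_
  · intro g0 g1 g2 g3 h
    simp [Fin.forall_fin_succ] at h
    grind
  · intro α β
    simp [Fin.forall_fin_succ, brk, wedge]
    grind

/-- Translations and boosts commute. `X7` acts on the pairs `X2, X3` and `X5, X6` by the same
quarter turn, and the signs make the plane of `b • X3 + X5` and `b • X2 - X6` stable under it. -/
theorem isSubalgebraBasis_X1X4_X3X5_X2X6_YX1X7 (a b ε : ℝ) :
    IsSubalgebraBasis ![a • X1 + X4, b • X3 + X5, b • X2 - X6, Y + ε • X1 + X7] := by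
  refine isSubalgebraBasis_of_coeffs ![a, 0, 0, 1, 0, 0, 0, 0, 0, 0, 0, 0]
    ![0, 0, b, 0, 1, 0, 0, 0, 0, 0, 0, 0]
    ![0, b, 0, 0, 0, -1, 0, 0, 0, 0, 0, 0]
    ![ε, 0, 0, 0, 0, 0, 1, 0, 0, 0, 0, 1]
    (by simp [gen_eq, sub_eq_add_neg]) ?_
    (fun m => ![0, m 2 3, -m 1 3, 0]) ?_
  · intro g0 g1 g2 g3 h
    simp [Fin.forall_fin_succ] at h
    grind
  · intro α β
    simp [Fin.forall_fin_succ, brk, wedge]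
    grind

theorem isSubalgebraBasis_X4_X5_X6_YX7X11 (a : ℝ) :
    IsSubalgebraBasis ![X4, X5, X6, Y + a • X7 + X11] := by
  refine isSubalgebraBasis_of_coeffs ![0, 0, 0, 1, 0, 0, 0, 0, 0, 0, 0, 0]
    ![0, 0, 0, 0, 1, 0, 0, 0, 0, 0, 0, 0]
    ![0, 0, 0, 0, 0, 1, 0, 0, 0, 0, 0, 0]
    ![0, 0, 0, 0, 0, 0, a, 0, 0, 0, 1, 1]
    (by simp [gen_eq]) ?_
    (fun m => ![0, -a * m 2 3, a * m 1 3, 0]) ?_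
  · intro g0 g1 g2 g3 h
    simp [Fin.forall_fin_succ] at h
    grind
  · intro α β
    simp [Fin.forall_fin_succ, brk, wedge]
    grind

theorem isSubalgebraBasis_X4_X5_X6_YX11 :
    IsSubalgebraBasis ![X4, X5, X6, Y + X11] := by
  refine isSubalgebraBasis_of_coeffs ![0, 0, 0, 1, 0, 0, 0, 0, 0, 0, 0, 0]
    ![0, 0, 0, 0, 1, 0, 0, 0, 0, 0, 0, 0]
    ![0, 0, 0, 0, 0, 1, 0, 0, 0, 0, 0, 0]
    ![0, 0, 0, 0, 0, 0, 0, 0, 0, 0, 1, 1]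
    (by simp [gen_eq]) ?_
    (fun _ => ![0, 0, 0, 0]) ?_
  · intro g0 g1 g2 g3 h
    simp [Fin.forall_fin_succ] at h
    grind
  · intro α β
    simp [Fin.forall_fin_succ, brk]

theorem isSubalgebraBasis_X4_X5_X6_YX1X7 (ε : ℝ) :
    IsSubalgebraBasis ![X4, X5, X6, Y + ε • X1 + X7] := by
  refine isSubalgebraBasis_of_coeffs ![0, 0, 0, 1, 0, 0, 0, 0, 0, 0, 0, 0]
    ![0, 0, 0, 0, 1, 0, 0, 0, 0, 0, 0, 0]
    ![0, 0, 0, 0, 0, 1, 0, 0, 0, 0, 0, 0]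
    ![ε, 0, 0, 0, 0, 0, 1, 0, 0, 0, 0, 1]
    (by simp [gen_eq]) ?_
    (fun m => ![0, -m 2 3, m 1 3, 0]) ?_
  · intro g0 g1 g2 g3 h
    simp [Fin.forall_fin_succ] at h
    grind
  · intro α β
    simp [Fin.forall_fin_succ, brk, wedge]
    grind

theorem isSubalgebraBasis_X1_X3X5_X2X6_YX4X7 (a : ℝ) :
    IsSubalgebraBasis ![X1, X3 + X5, X2 - X6, Y + a • X4 + X7] := by
  refine isSubalgebraBasis_of_coeffs ![1, 0, 0, 0, 0, 0, 0, 0, 0, 0, 0, 0]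
    ![0, 0, 1, 0, 1, 0, 0, 0, 0, 0, 0, 0]
    ![0, 1, 0, 0, 0, -1, 0, 0, 0, 0, 0, 0]
    ![0, 0, 0, a, 0, 0, 1, 0, 0, 0, 0, 1]
    (by simp [gen_eq, sub_eq_add_neg]) ?_
    (fun m => ![0, m 2 3, -m 1 3, 0]) ?_
  · intro g0 g1 g2 g3 h
    simp [Fin.forall_fin_succ] at h
    grind
  · intro α β
    simp [Fin.forall_fin_succ, brk, wedge]
    grind

theorem isSubalgebraBasis_X1_X5_X6_YX4X7X11 (a b : ℝ) :
    IsSubalgebraBasis ![X1, X5, X6, Y + a • X4 + b • X7 + X11] := by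
  refine isSubalgebraBasis_of_coeffs ![1, 0, 0, 0, 0, 0, 0, 0, 0, 0, 0, 0]
    ![0, 0, 0, 0, 1, 0, 0, 0, 0, 0, 0, 0]
    ![0, 0, 0, 0, 0, 1, 0, 0, 0, 0, 0, 0]
    ![0, 0, 0, a, 0, 0, b, 0, 0, 0, 1, 1]
    (by simp [gen_eq]) ?_
    (fun m => ![m 0 3, -b * m 2 3, b * m 1 3, 0]) ?_
  · intro g0 g1 g2 g3 h
    simp [Fin.forall_fin_succ] at h
    grind
  · intro α β
    simp [Fin.forall_fin_succ, brk, wedge]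
    grind

theorem isSubalgebraBasis_X1_X5_X6_YX4X11 (a : ℝ) :
    IsSubalgebraBasis ![X1, X5, X6, Y + a • X4 + X11] := by
  refine isSubalgebraBasis_of_coeffs ![1, 0, 0, 0, 0, 0, 0, 0, 0, 0, 0, 0]
    ![0, 0, 0, 0, 1, 0, 0, 0, 0, 0, 0, 0]
    ![0, 0, 0, 0, 0, 1, 0, 0, 0, 0, 0, 0]
    ![0, 0, 0, a, 0, 0, 0, 0, 0, 0, 1, 1]
    (by simp [gen_eq]) ?_
    (fun m => ![m 0 3, 0, 0, 0]) ?_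
  · intro g0 g1 g2 g3 h
    simp [Fin.forall_fin_succ] at h
    grind
  · intro α β
    simp [Fin.forall_fin_succ, brk, wedge]
    grind

theorem isSubalgebraBasis_X1_X5_X6_YX4X7 (b : ℝ) :
    IsSubalgebraBasis ![X1, X5, X6, Y + b • X4 + X7] := by
  refine isSubalgebraBasis_of_coeffs ![1, 0, 0, 0, 0, 0, 0, 0, 0, 0, 0, 0]
    ![0, 0, 0, 0, 1, 0, 0, 0, 0, 0, 0, 0]
    ![0, 0, 0, 0, 0, 1, 0, 0, 0, 0, 0, 0]
    ![0, 0, 0, b, 0, 0, 1, 0, 0, 0, 0, 1]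
    (by simp [gen_eq]) ?_
    (fun m => ![0, -m 2 3, m 1 3, 0]) ?_
  · intro g0 g1 g2 g3 h
    simp [Fin.forall_fin_succ] at h
    grind
  · intro α β
    simp [Fin.forall_fin_succ, brk, wedge]
    grind

theorem isSubalgebraBasis_X2_X3_X4_YX7X11 (a : ℝ) :
    IsSubalgebraBasis ![X2, X3, X4, Y + a • X7 + X11] := by
  refine isSubalgebraBasis_of_coeffs ![0, 1, 0, 0, 0, 0, 0, 0, 0, 0, 0, 0]
    ![0, 0, 1, 0, 0, 0, 0, 0, 0, 0, 0, 0]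
    ![0, 0, 0, 1, 0, 0, 0, 0, 0, 0, 0, 0]
    ![0, 0, 0, 0, 0, 0, a, 0, 0, 0, 1, 1]
    (by simp [gen_eq]) ?_
    (fun m => ![m 0 3 - a * m 1 3, m 1 3 + a * m 0 3, 0, 0]) ?_
  · intro g0 g1 g2 g3 h
    simp [Fin.forall_fin_succ] at h
    grind
  · intro α β
    simp [Fin.forall_fin_succ, brk, wedge]
    grind

theorem isSubalgebraBasis_X2_X3_X4_YX11 :
    IsSubalgebraBasis ![X2, X3, X4, Y + X11] := by
  refine isSubalgebraBasis_of_coeffs ![0, 1, 0, 0, 0, 0, 0, 0, 0, 0, 0, 0]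
    ![0, 0, 1, 0, 0, 0, 0, 0, 0, 0, 0, 0]
    ![0, 0, 0, 1, 0, 0, 0, 0, 0, 0, 0, 0]
    ![0, 0, 0, 0, 0, 0, 0, 0, 0, 0, 1, 1]
    (by simp [gen_eq]) ?_
    (fun m => ![m 0 3, m 1 3, 0, 0]) ?_
  · intro g0 g1 g2 g3 h
    simp [Fin.forall_fin_succ] at h
    grind
  · intro α β
    simp [Fin.forall_fin_succ, brk, wedge]
    grind

theorem isSubalgebraBasis_X2_X3_X4_YX1X7 (ε : ℝ) :
    IsSubalgebraBasis ![X2, X3, X4, Y + ε • X1 + X7] := by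
  refine isSubalgebraBasis_of_coeffs ![0, 1, 0, 0, 0, 0, 0, 0, 0, 0, 0, 0]
    ![0, 0, 1, 0, 0, 0, 0, 0, 0, 0, 0, 0]
    ![0, 0, 0, 1, 0, 0, 0, 0, 0, 0, 0, 0]
    ![ε, 0, 0, 0, 0, 0, 1, 0, 0, 0, 0, 1]
    (by simp [gen_eq]) ?_
    (fun m => ![-m 1 3, m 0 3, 0, 0]) ?_
  · intro g0 g1 g2 g3 h
    simp [Fin.forall_fin_succ] at h
    grind
  · intro α β
    simp [Fin.forall_fin_succ, brk, wedge]
    grind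

theorem isSubalgebraBasis_X1_X2_X4_YX5X6X10X11 (a b c d : ℝ) :
    IsSubalgebraBasis ![X1, X2, X4, Y + a • X5 + b • X6 + c • X10 + d • X11] := by
  refine isSubalgebraBasis_of_coeffs ![1, 0, 0, 0, 0, 0, 0, 0, 0, 0, 0, 0]
    ![0, 1, 0, 0, 0, 0, 0, 0, 0, 0, 0, 0]
    ![0, 0, 0, 1, 0, 0, 0, 0, 0, 0, 0, 0]
    ![0, 0, 0, 0, a, b, 0, 0, 0, c, d, 1]
    (by simp [gen_eq]) ?_
    (fun m => ![d * m 0 3 - c * m 2 3, d * m 1 3, 0, 0]) ?_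
  · intro g0 g1 g2 g3 h
    simp [Fin.forall_fin_succ] at h
    grind
  · intro α β
    simp [Fin.forall_fin_succ, brk, wedge]
    grind

theorem isSubalgebraBasis_X1_X2_X4_YX5X6X10 (a b : ℝ) :
    IsSubalgebraBasis ![X1, X2, X4, Y + a • X5 + b • X6 + X10] := by
  refine isSubalgebraBasis_of_coeffs ![1, 0, 0, 0, 0, 0, 0, 0, 0, 0, 0, 0]
    ![0, 1, 0, 0, 0, 0, 0, 0, 0, 0, 0, 0]
    ![0, 0, 0, 1, 0, 0, 0, 0, 0, 0, 0, 0]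
    ![0, 0, 0, 0, a, b, 0, 0, 0, 1, 0, 1]
    (by simp [gen_eq]) ?_
    (fun m => ![-m 2 3, 0, 0, 0]) ?_
  · intro g0 g1 g2 g3 h
    simp [Fin.forall_fin_succ] at h
    grind
  · intro α β
    simp [Fin.forall_fin_succ, brk, wedge]
    grind

/-- On the plane of `X2` and `X3` the fourth field acts as multiplication by the complex number `c +
i`: `X7` turns and `c • X11` scales. -/
theorem isSubalgebraBasis_X1_X2_X3_YX4X7X11 (a c : ℝ) :
    IsSubalgebraBasis ![X1, X2, X3, Y + a • X4 + X7 + c • X11] := by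
  refine isSubalgebraBasis_of_coeffs ![1, 0, 0, 0, 0, 0, 0, 0, 0, 0, 0, 0]
    ![0, 1, 0, 0, 0, 0, 0, 0, 0, 0, 0, 0]
    ![0, 0, 1, 0, 0, 0, 0, 0, 0, 0, 0, 0]
    ![0, 0, 0, a, 0, 0, 1, 0, 0, 0, c, 1]
    (by simp [gen_eq]) ?_
    (fun m => ![c * m 0 3, c * m 1 3 - m 2 3, m 1 3 + c * m 2 3, 0]) ?_
  · intro g0 g1 g2 g3 h
    simp [Fin.forall_fin_succ] at h
    grind
  · intro α β
    simp [Fin.forall_fin_succ, brk, wedge]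
    grind

theorem isSubalgebraBasis_X1_X2_X3_YX4X7 (a : ℝ) :
    IsSubalgebraBasis ![X1, X2, X3, Y + a • X4 + X7] := by
  refine isSubalgebraBasis_of_coeffs ![1, 0, 0, 0, 0, 0, 0, 0, 0, 0, 0, 0]
    ![0, 1, 0, 0, 0, 0, 0, 0, 0, 0, 0, 0]
    ![0, 0, 1, 0, 0, 0, 0, 0, 0, 0, 0, 0]
    ![0, 0, 0, a, 0, 0, 1, 0, 0, 0, 0, 1]
    (by simp [gen_eq]) ?_
    (fun m => ![0, -m 2 3, m 1 3, 0]) ?_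
  · intro g0 g1 g2 g3 h
    simp [Fin.forall_fin_succ] at h
    grind
  · intro α β
    simp [Fin.forall_fin_succ, brk, wedge]
    grind

theorem isSubalgebraBasis_X1_X2_X3_YX4X7X10 (a : ℝ) :
    IsSubalgebraBasis ![X1, X2, X3, Y + a • X4 + X7 + X10] := by
  refine isSubalgebraBasis_of_coeffs ![1, 0, 0, 0, 0, 0, 0, 0, 0, 0, 0, 0]
    ![0, 1, 0, 0, 0, 0, 0, 0, 0, 0, 0, 0]
    ![0, 0, 1, 0, 0, 0, 0, 0, 0, 0, 0, 0]
    ![0, 0, 0, a, 0, 0, 1, 0, 0, 1, 0, 1]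
    (by simp [gen_eq]) ?_
    (fun m => ![0, -m 2 3, m 1 3, 0]) ?_
  · intro g0 g1 g2 g3 h
    simp [Fin.forall_fin_succ] at h
    grind
  · intro α β
    simp [Fin.forall_fin_succ, brk, wedge]
    grind

theorem isSubalgebraBasis_X1_X2_X3_YX4 :
    IsSubalgebraBasis ![X1, X2, X3, Y + X4] := by
  refine isSubalgebraBasis_of_coeffs ![1, 0, 0, 0, 0, 0, 0, 0, 0, 0, 0, 0]
    ![0, 1, 0, 0, 0, 0, 0, 0, 0, 0, 0, 0]
    ![0, 0, 1, 0, 0, 0, 0, 0, 0, 0, 0, 0]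
    ![0, 0, 0, 1, 0, 0, 0, 0, 0, 0, 0, 1]
    (by simp [gen_eq]) ?_
    (fun _ => ![0, 0, 0, 0]) ?_
  · intro g0 g1 g2 g3 h
    simp [Fin.forall_fin_succ] at h
    grind
  · intro α β
    simp [Fin.forall_fin_succ, brk]

/-! ### Complete sets of invariants in cylindrical, auxiliary and Cartesian variables. -/

theorem isCompleteInvariantSet_X1_X4X7_X4X11_YX4 (a b : ℝ) {U : Set State}
    (hU : IsOpen U) (K : CylChart U) (h0 : ∀ p ∈ U, t p ≠ 0) :
    IsCompleteInvariantSet U ![X1, a • X4 + X7, b • X4 + X11, Y + X4]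
      ![ρ, fun p => K.r p / t p,
        K.q,
        K.ϑ,
        fun p => u p - P p - a * K.θ p - b * Real.log |t p|] := by
  have h := K.isCoordSystem hU
  obtain ⟨ht, -, hr, hθ, hu, hq, hϑ, hP⟩ := K.hasCoeffs hU
  refine h.isCompleteInvariantSet (h.coord 7) (hr.div ht h0)
    hq
    hϑ
    -- `X4` raises `u` at unit rate. The terms `P`, `a θ` and `b ln |t|` compensate for this along
    -- `Y + X4`, `a • X4 + X7` and `b • X4 + X11` respectively.
    (((hu.sub hP).sub (hθ.const_mul a)).sub ((ht.log_abs h0).const_mul b))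
    (K.hasComps_X1 hU)
    (((K.hasComps_X4 hU).smul a).add (K.hasComps_X7 hU))
    (((K.hasComps_X4 hU).smul b).add (K.hasComps_X11 hU))
    ((K.hasComps_Y hU).add (K.hasComps_X4 hU))
    fun p hp => ?_
  have h1 := h0 p hp
  refine ⟨?_, ?_, ?_⟩
  · intro g0 g1 g2 g3 g4 h
    simp [Fin.forall_fin_succ, Pi.single_apply] at h
    grind
  · intro g0 g1 g2 g3 h
    simp [Fin.forall_fin_succ] at h
    grind
  · simp [Fin.forall_fin_succ, pairing]
    grind

theorem isCompleteInvariantSet_X1_X4_X7X10_YX10 {U : Set State}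
    (hU : IsOpen U) (K : CylChart U) :
    IsCompleteInvariantSet U ![X1, X4, X7 + X10, Y + X10]
      ![ρ, K.r,
        K.q,
        K.ϑ,
        fun p => P p - t p + K.θ p] := by
  have h := K.isCoordSystem hU
  obtain ⟨ht, -, hr, hθ, -, hq, hϑ, hP⟩ := K.hasCoeffs hU
  refine h.isCompleteInvariantSet (h.coord 7) hr
    hq
    hϑ
    ((hP.sub ht).add hθ)
    (K.hasComps_X1 hU)
    (K.hasComps_X4 hU)
    ((K.hasComps_X7 hU).add (K.hasComps_X10 hU))
    ((K.hasComps_Y hU).add (K.hasComps_X10 hU))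
    fun p hp => ⟨?_, ?_, ?_⟩
  · intro g0 g1 g2 g3 g4 h
    simp [Fin.forall_fin_succ, Pi.single_apply] at h
    grind
  · intro g0 g1 g2 g3 h
    simp [Fin.forall_fin_succ] at h
    grind
  · simp [Fin.forall_fin_succ, pairing]

theorem isCompleteInvariantSet_X2_X3_X7X10_YX1X10 (a b : ℝ) (ha : a ≠ 0) {U : Set State}
    (hU : IsOpen U) (K : CylChart U) :
    IsCompleteInvariantSet U ![X2, X3, X7 + X10, Y + a • X1 + b • X10]
      ![ρ, fun p => b / a * x p - t p + K.θ p + K.ϑ p,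
        u,
        K.q,
        fun p => P p - x p / a] := by
  have h := K.isCoordSystem_vel hU
  obtain ⟨ht, hx, -, -, hu, hq, hσ, hP⟩ := K.hasCoeffs_vel hU
  -- The sum is regrouped because `θ + ϑ` is a single coordinate of the mixed system. Along the last
  -- field `x` moves with speed `a ≠ 0` and serves as the parameter.
  refine h.isCompleteInvariantSet (h.coord 7) ((((hx.const_mul (b / a)).sub ht).add hσ).congr fun p => add_assoc _ _ _)
    hu
    hq
    (hP.sub (hx.div_const a))
    (K.hasComps_vel_X2 hU)
    (K.hasComps_vel_X3 hU)
    ((K.hasComps_vel_X7 hU).add (K.hasComps_vel_X10 hU))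
    (((K.hasComps_vel_Y hU).add ((K.hasComps_vel_X1 hU).smul a)).add ((K.hasComps_vel_X10 hU).smul b))
    fun p hp => ⟨?_, ?_, ?_⟩
  · intro g0 g1 g2 g3 g4 h
    simp [Fin.forall_fin_succ, Pi.single_apply] at h
    grind
  · intro g0 g1 g2 g3 h
    simp [Fin.forall_fin_succ] at h
    grind
  · simp [Fin.forall_fin_succ, pairing]
    grind

theorem isCompleteInvariantSet_X2_X3_X7X10_YX10 {U : Set State}
    (hU : IsOpen U) (K : CylChart U) :
    IsCompleteInvariantSet U ![X2, X3, X7 + X10, Y + X10]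
      ![ρ, x,
        u,
        K.q,
        fun p => P p - t p + K.θ p + K.ϑ p] := by
  have h := K.isCoordSystem_vel hU
  obtain ⟨ht, hx, -, -, hu, hq, hσ, hP⟩ := K.hasCoeffs_vel hU
  refine h.isCompleteInvariantSet (h.coord 7) hx
    hu
    hq
    (((hP.sub ht).add hσ).congr fun p => add_assoc _ _ _)
    (K.hasComps_vel_X2 hU)
    (K.hasComps_vel_X3 hU)
    ((K.hasComps_vel_X7 hU).add (K.hasComps_vel_X10 hU))
    ((K.hasComps_vel_Y hU).add (K.hasComps_vel_X10 hU))
    fun p hp => ⟨?_, ?_, ?_⟩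
  · intro g0 g1 g2 g3 g4 h
    simp [Fin.forall_fin_succ, Pi.single_apply] at h
    grind
  · intro g0 g1 g2 g3 h
    simp [Fin.forall_fin_succ] at h
    grind
  · simp [Fin.forall_fin_succ, pairing]

theorem isCompleteInvariantSet_X1_X4_X11_YX7 {U : Set State}
    (hU : IsOpen U) (K : CylChart U) (h0 : ∀ p ∈ U, t p ≠ 0) :
    IsCompleteInvariantSet U ![X1, X4, X11, Y + X7]
      ![ρ, fun p => K.r p / t p,
        K.q,
        K.ϑ,
        fun p => P p - K.θ p] := by
  have h := K.isCoordSystem hU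
  obtain ⟨ht, -, hr, hθ, -, hq, hϑ, hP⟩ := K.hasCoeffs hU
  refine h.isCompleteInvariantSet (h.coord 7) (hr.div ht h0)
    hq
    hϑ
    (hP.sub hθ)
    (K.hasComps_X1 hU)
    (K.hasComps_X4 hU)
    (K.hasComps_X11 hU)
    ((K.hasComps_Y hU).add (K.hasComps_X7 hU))
    fun p hp => ?_
  have h1 := h0 p hp
  refine ⟨?_, ?_, ?_⟩
  · intro g0 g1 g2 g3 g4 h
    simp [Fin.forall_fin_succ, Pi.single_apply] at h
    grind
  · intro g0 g1 g2 g3 h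
    simp [Fin.forall_fin_succ] at h
    grind
  · simp [Fin.forall_fin_succ, pairing]
    grind

theorem isCompleteInvariantSet_X1_X4_X10_YX7X11 (a : ℝ) {U : Set State}
    (hU : IsOpen U) (K : CylChart U) :
    IsCompleteInvariantSet U ![X1, X4, X10, Y + a • X7 + X11]
      ![ρ, fun p => K.θ p - a * Real.log |K.r p|,
        K.q,
        K.ϑ,
        fun p => P p - Real.log |K.r p|] := by
  have h := K.isCoordSystem hU
  obtain ⟨-, -, hr, hθ, -, hq, hϑ, hP⟩ := K.hasCoeffs hU
  refine h.isCompleteInvariantSet (h.coord 7) (hθ.sub ((hr.log_abs K.r_ne).const_mul a))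
    hq
    hϑ
    (hP.sub (hr.log_abs K.r_ne))
    (K.hasComps_X1 hU)
    (K.hasComps_X4 hU)
    (K.hasComps_X10 hU)
    (((K.hasComps_Y hU).add ((K.hasComps_X7 hU).smul a)).add (K.hasComps_X11 hU))
    fun p hp => ?_
  have h1 := K.r_ne p hp
  refine ⟨?_, ?_, ?_⟩
  · intro g0 g1 g2 g3 g4 h
    simp [Fin.forall_fin_succ, Pi.single_apply] at h
    grind
  · intro g0 g1 g2 g3 h
    simp [Fin.forall_fin_succ] at h
    grind
  · simp [Fin.forall_fin_succ, pairing]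
    grind

/-- In the Cartesian cases the largest admissible domain suffices, because every condition in
`IsCompleteInvariantSet` restricts to open subsets. -/
theorem isCompleteInvariantSet_X1_X4_X10_YX11 :
    IsCompleteInvariantSet {p | y p ≠ 0 ∧ z p ≠ 0} ![X1, X4, X10, Y + X11]
      ![ρ, fun p => y p / z p,
        v,
        w,
        fun p => P p - Real.log |y p|] := by
  have h : IsCoordSystem {p | y p ≠ 0 ∧ z p ≠ 0} cart := isCoordSystem_cart <|
    (isOpen_ne_fun (continuous_apply 2) continuous_const).inter
    (isOpen_ne_fun (continuous_apply 3) continuous_const)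
  obtain ⟨-, -, hy, hz, -, hv, hw, hP⟩ := h.hasCoeffs_cart
  refine h.isCompleteInvariantSet (h.coord 7) (hy.div hz fun p hp => hp.2)
    hv
    hw
    (hP.sub (hy.log_abs fun p hp => hp.1))
    (hasComps_cart _ _)
    (hasComps_cart _ _)
    (hasComps_cart _ _)
    (hasComps_cart _ _)
    fun p hp => ?_
  obtain ⟨h1, h2⟩ := hp
  refine ⟨?_, ?_, ?_⟩
  · intro g0 g1 g2 g3 g4 h
    simp [Fin.forall_fin_succ, Pi.single_apply] at h
    grind
  · intro g0 g1 g2 g3 h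
    simp [Fin.forall_fin_succ, X1, X4, X10, X11, Y] at h
    grind
  · simp [Fin.forall_fin_succ, pairing, X1, X4, X10, X11, Y]
    grind

theorem isCompleteInvariantSet_X1_X4_X10_YX7 {U : Set State}
    (hU : IsOpen U) (K : CylChart U) :
    IsCompleteInvariantSet U ![X1, X4, X10, Y + X7]
      ![ρ, K.r,
        K.ϑ,
        K.q,
        fun p => P p - K.θ p] := by
  have h := K.isCoordSystem hU
  obtain ⟨-, -, hr, hθ, -, hq, hϑ, hP⟩ := K.hasCoeffs hU
  refine h.isCompleteInvariantSet (h.coord 7) hr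
    hϑ
    hq
    (hP.sub hθ)
    (K.hasComps_X1 hU)
    (K.hasComps_X4 hU)
    (K.hasComps_X10 hU)
    ((K.hasComps_Y hU).add (K.hasComps_X7 hU))
    fun p hp => ⟨?_, ?_, ?_⟩
  · intro g0 g1 g2 g3 g4 h
    simp [Fin.forall_fin_succ, Pi.single_apply] at h
    grind
  · intro g0 g1 g2 g3 h
    simp [Fin.forall_fin_succ] at h
    grind
  · simp [Fin.forall_fin_succ, pairing]

/-- The flow of `ε • X4 + X10` is uniformly accelerated motion, which preserves `u - ε t` and `x - ε
t² / 2`. Along the last field `θ + ϑ` is the parameter. -/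
theorem isCompleteInvariantSet_X2_X3_X4X10_YX1X7 (ε a : ℝ) {U : Set State}
    (hU : IsOpen U) (K : CylChart U) :
    IsCompleteInvariantSet U ![X2, X3, ε • X4 + X10, Y + a • X1 + X7]
      ![ρ, fun p => x p - ε * (t p ^ 2 / 2) - a * (K.θ p + K.ϑ p),
        fun p => u p - ε * t p,
        K.q,
        fun p => P p - (K.θ p + K.ϑ p)] := by
  have h := K.isCoordSystem_vel hU
  obtain ⟨ht, hx, -, -, hu, hq, hσ, hP⟩ := K.hasCoeffs_vel hU
  refine h.isCompleteInvariantSet (h.coord 7) ((hx.sub ((ht.sq.div_const 2).const_mul ε)).sub (hσ.const_mul a))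
    (hu.sub (ht.const_mul ε))
    hq
    (hP.sub hσ)
    (K.hasComps_vel_X2 hU)
    (K.hasComps_vel_X3 hU)
    (((K.hasComps_vel_X4 hU).smul ε).add (K.hasComps_vel_X10 hU))
    (((K.hasComps_vel_Y hU).add ((K.hasComps_vel_X1 hU).smul a)).add (K.hasComps_vel_X7 hU))
    fun p hp => ⟨?_, ?_, ?_⟩
  · intro g0 g1 g2 g3 g4 h
    simp [Fin.forall_fin_succ, Pi.single_apply] at h
    grind
  · intro g0 g1 g2 g3 h
    simp [Fin.forall_fin_succ] at h
    grind
  · simp [Fin.forall_fin_succ, pairing]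
    grind

theorem isCompleteInvariantSet_X1X4_X3X5_X2X6_YX1X7 (a b ε : ℝ) {U : Set State}
    (hU : IsOpen U) (K : VelChart b U) (h0 : ∀ p ∈ U, t p + a ≠ 0) :
    IsCompleteInvariantSet U ![a • X1 + X4, b • X3 + X5, b • X2 - X6, Y + ε • X1 + X7]
      ![ρ, t,
        fun p => u p - x p / (t p + a) + ε / (t p + a) * K.ϑ p,
        K.q,
        fun p => P p - K.ϑ p] := by
  have h := K.isCoordSystem hU
  obtain ⟨ht, hx, -, -, hu, hq, hϑ, hP⟩ := K.hasCoeffs hU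
  have hT := ht.add (hasCoeffs_const (U := U) (κ := velCoords K.q K.ϑ) a)
  refine h.isCompleteInvariantSet (h.coord 7) ht
    ((hu.sub (hx.div hT h0)).add (((hasCoeffs_const ε).div hT h0).mul hϑ))
    hq
    (hP.sub hϑ)
    (((K.hasComps_X1 hU).smul a).add (K.hasComps_X4 hU))
    (K.hasComps_X3_X5 hU)
    (K.hasComps_X2_X6 hU)
    (((K.hasComps_Y hU).add ((K.hasComps_X1 hU).smul ε)).add (K.hasComps_X7 hU))
    fun p hp => ?_
  have h1 := h0 p hp
  refine ⟨?_, ?_, ?_⟩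
  · intro g0 g1 g2 g3 g4 h
    simp [Fin.forall_fin_succ, Pi.single_apply] at h
    grind
  · have h1 := K.ne p hp
    intro g0 g1 g2 g3 h
    simp [Fin.forall_fin_succ] at h
    -- The `y` and `z` components give a linear system for `g1` and `g2`, with determinant `-(t² +
    -- b²)`; elimination leaves each unknown multiplied by `t² + b²`.
    have e1 : g1 * (t p ^ 2 + b ^ 2) = 0 := by grind
    have e2 : g2 * (t p ^ 2 + b ^ 2) = 0 := by grind
    have e3 := (mul_eq_zero_iff_right h1).1 e1
    have e4 := (mul_eq_zero_iff_right h1).1 e2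
    grind
  · simp [Fin.forall_fin_succ, pairing]
    grind

theorem isCompleteInvariantSet_X4_X5_X6_YX7X11 (a : ℝ) (ha : a ≠ 0) {U : Set State}
    (hU : IsOpen U) (K : VelChart 0 U) :
    IsCompleteInvariantSet U ![X4, X5, X6, Y + a • X7 + X11]
      ![ρ, fun p => u p - x p / t p,
        fun p => Real.log |t p| - K.ϑ p / a,
        K.q,
        fun p => P p - Real.log |t p|] := by
  -- With `b = 0` the chart condition `t² + b² ≠ 0` already excludes `t = 0`.
  have h0 := K.t_ne
  have h := K.isCoordSystem hU
  obtain ⟨ht, hx, -, -, hu, hq, hϑ, hP⟩ := K.hasCoeffs hU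
  refine h.isCompleteInvariantSet (h.coord 7) (hu.sub (hx.div ht h0))
    ((ht.log_abs h0).sub (hϑ.div_const a))
    hq
    (hP.sub (ht.log_abs h0))
    (K.hasComps_X4 hU)
    (K.hasComps_X5 hU)
    (K.hasComps_X6 hU)
    (((K.hasComps_Y hU).add ((K.hasComps_X7 hU).smul a)).add (K.hasComps_X11 hU))
    fun p hp => ?_
  have h1 := h0 p hp
  refine ⟨?_, ?_, ?_⟩
  · intro g0 g1 g2 g3 g4 h
    simp [Fin.forall_fin_succ, Pi.single_apply] at h
    grind
  · intro g0 g1 g2 g3 h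
    simp [Fin.forall_fin_succ] at h
    grind
  · simp [Fin.forall_fin_succ, pairing]
    grind

theorem isCompleteInvariantSet_X4_X5_X6_YX11 :
    IsCompleteInvariantSet {p | t p ≠ 0} ![X4, X5, X6, Y + X11]
      ![ρ, fun p => u p - x p / t p,
        fun p => v p - y p / t p,
        fun p => w p - z p / t p,
        fun p => P p - Real.log |t p|] := by
  have h : IsCoordSystem {p | t p ≠ 0} cart := isCoordSystem_cart <|
    isOpen_ne_fun (continuous_apply 0) continuous_const
  have h0 : ∀ p ∈ {p | t p ≠ 0}, t p ≠ 0 := fun p hp => hp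
  obtain ⟨ht, hx, hy, hz, hu, hv, hw, hP⟩ := h.hasCoeffs_cart
  refine h.isCompleteInvariantSet (h.coord 7) (hu.sub (hx.div ht h0))
    (hv.sub (hy.div ht h0))
    (hw.sub (hz.div ht h0))
    (hP.sub (ht.log_abs h0))
    (hasComps_cart _ _)
    (hasComps_cart _ _)
    (hasComps_cart _ _)
    (hasComps_cart _ _)
    fun p hp => ?_
  have h1 := h0 p hp
  refine ⟨?_, ?_, ?_⟩
  · intro g0 g1 g2 g3 g4 h
    simp [Fin.forall_fin_succ, Pi.single_apply] at h
    grind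
  · intro g0 g1 g2 g3 h
    simp [Fin.forall_fin_succ, X4, X5, X6, X11, Y] at h
    grind
  · simp [Fin.forall_fin_succ, pairing, X4, X5, X6, X11, Y]
    grind

theorem isCompleteInvariantSet_X4_X5_X6_YX1X7 (ε : ℝ) {U : Set State}
    (hU : IsOpen U) (K : VelChart 0 U) :
    IsCompleteInvariantSet U ![X4, X5, X6, Y + ε • X1 + X7]
      ![ρ, t,
        fun p => u p - x p / t p + ε / t p * K.ϑ p,
        K.q,
        fun p => P p - K.ϑ p] := by
  have h0 := K.t_ne
  have h := K.isCoordSystem hU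
  obtain ⟨ht, hx, -, -, hu, hq, hϑ, hP⟩ := K.hasCoeffs hU
  refine h.isCompleteInvariantSet (h.coord 7) ht
    ((hu.sub (hx.div ht h0)).add (((hasCoeffs_const ε).div ht h0).mul hϑ))
    hq
    (hP.sub hϑ)
    (K.hasComps_X4 hU)
    (K.hasComps_X5 hU)
    (K.hasComps_X6 hU)
    (((K.hasComps_Y hU).add ((K.hasComps_X1 hU).smul ε)).add (K.hasComps_X7 hU))
    fun p hp => ?_
  have h1 := h0 p hp
  refine ⟨?_, ?_, ?_⟩
  · intro g0 g1 g2 g3 g4 h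
    simp [Fin.forall_fin_succ, Pi.single_apply] at h
    grind
  · intro g0 g1 g2 g3 h
    simp [Fin.forall_fin_succ] at h
    grind
  · simp [Fin.forall_fin_succ, pairing]
    grind

theorem isCompleteInvariantSet_X1_X3X5_X2X6_YX4X7 (a : ℝ) {U : Set State}
    (hU : IsOpen U) (K : VelChart 1 U) :
    IsCompleteInvariantSet U ![X1, X3 + X5, X2 - X6, Y + a • X4 + X7]
      ![ρ, t,
        fun p => u p - a * K.ϑ p,
        K.q,
        fun p => P p - K.ϑ p] := by
  have h := K.isCoordSystem hU
  obtain ⟨ht, -, -, -, hu, hq, hϑ, hP⟩ := K.hasCoeffs hU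
  refine h.isCompleteInvariantSet (h.coord 7) ht
    (hu.sub (hϑ.const_mul a))
    hq
    (hP.sub hϑ)
    (K.hasComps_X1 hU)
    (by simpa using K.hasComps_X3_X5 hU)
    (by simpa using K.hasComps_X2_X6 hU)
    (((K.hasComps_Y hU).add ((K.hasComps_X4 hU).smul a)).add (K.hasComps_X7 hU))
    fun p hp => ⟨?_, ?_, ?_⟩
  · intro g0 g1 g2 g3 g4 h
    simp [Fin.forall_fin_succ, Pi.single_apply] at h
    grind
  · have h1 := K.ne p hp
    intro g0 g1 g2 g3 h
    simp [Fin.forall_fin_succ] at h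
    have e1 : g1 * (t p ^ 2 + 1 ^ 2) = 0 := by grind
    have e2 : g2 * (t p ^ 2 + 1 ^ 2) = 0 := by grind
    have e3 := (mul_eq_zero_iff_right h1).1 e1
    have e4 := (mul_eq_zero_iff_right h1).1 e2
    grind
  · simp [Fin.forall_fin_succ, pairing]

theorem isCompleteInvariantSet_X1_X5_X6_YX4X7X11 (a b : ℝ) {U : Set State}
    (hU : IsOpen U) (K : VelChart 0 U) :
    IsCompleteInvariantSet U ![X1, X5, X6, Y + a • X4 + b • X7 + X11]
      ![ρ, fun p => u p - a * Real.log |t p|,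
        fun p => K.ϑ p - b * Real.log |t p|,
        K.q,
        fun p => P p - Real.log |t p|] := by
  have h0 := K.t_ne
  have h := K.isCoordSystem hU
  obtain ⟨ht, -, -, -, hu, hq, hϑ, hP⟩ := K.hasCoeffs hU
  refine h.isCompleteInvariantSet (h.coord 7) (hu.sub ((ht.log_abs h0).const_mul a))
    (hϑ.sub ((ht.log_abs h0).const_mul b))
    hq
    (hP.sub (ht.log_abs h0))
    (K.hasComps_X1 hU)
    (K.hasComps_X5 hU)
    (K.hasComps_X6 hU)
    ((((K.hasComps_Y hU).add ((K.hasComps_X4 hU).smul a)).add ((K.hasComps_X7 hU).smul b)).add (K.hasComps_X11 hU))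
    fun p hp => ?_
  have h1 := h0 p hp
  refine ⟨?_, ?_, ?_⟩
  · intro g0 g1 g2 g3 g4 h
    simp [Fin.forall_fin_succ, Pi.single_apply] at h
    grind
  · intro g0 g1 g2 g3 h
    simp [Fin.forall_fin_succ] at h
    grind
  · simp [Fin.forall_fin_succ, pairing]
    grind

theorem isCompleteInvariantSet_X1_X5_X6_YX4X11 (a : ℝ) :
    IsCompleteInvariantSet {p | t p ≠ 0} ![X1, X5, X6, Y + a • X4 + X11]
      ![ρ, fun p => u p - a * Real.log |t p|,
        fun p => v p - y p / t p,
        fun p => w p - z p / t p,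
        fun p => P p - Real.log |t p|] := by
  have h : IsCoordSystem {p | t p ≠ 0} cart := isCoordSystem_cart <|
    isOpen_ne_fun (continuous_apply 0) continuous_const
  have h0 : ∀ p ∈ {p | t p ≠ 0}, t p ≠ 0 := fun p hp => hp
  obtain ⟨ht, -, hy, hz, hu, hv, hw, hP⟩ := h.hasCoeffs_cart
  refine h.isCompleteInvariantSet (h.coord 7) (hu.sub ((ht.log_abs h0).const_mul a))
    (hv.sub (hy.div ht h0))
    (hw.sub (hz.div ht h0))
    (hP.sub (ht.log_abs h0))
    (hasComps_cart _ _)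
    (hasComps_cart _ _)
    (hasComps_cart _ _)
    (hasComps_cart _ _)
    fun p hp => ?_
  have h1 := h0 p hp
  refine ⟨?_, ?_, ?_⟩
  · intro g0 g1 g2 g3 g4 h
    simp [Fin.forall_fin_succ, Pi.single_apply] at h
    grind
  · intro g0 g1 g2 g3 h
    simp [Fin.forall_fin_succ, X1, X4, X5, X6, X11, Y] at h
    grind
  · simp [Fin.forall_fin_succ, pairing, X1, X4, X5, X6, X11, Y]
    grind

theorem isCompleteInvariantSet_X1_X5_X6_YX4X7 (b : ℝ) {U : Set State}
    (hU : IsOpen U) (K : VelChart 0 U) :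
    IsCompleteInvariantSet U ![X1, X5, X6, Y + b • X4 + X7]
      ![ρ, t,
        fun p => u p - b * K.ϑ p,
        K.q,
        fun p => P p - K.ϑ p] := by
  have h0 := K.t_ne
  have h := K.isCoordSystem hU
  obtain ⟨ht, -, -, -, hu, hq, hϑ, hP⟩ := K.hasCoeffs hU
  refine h.isCompleteInvariantSet (h.coord 7) ht
    (hu.sub (hϑ.const_mul b))
    hq
    (hP.sub hϑ)
    (K.hasComps_X1 hU)
    (K.hasComps_X5 hU)
    (K.hasComps_X6 hU)
    (((K.hasComps_Y hU).add ((K.hasComps_X4 hU).smul b)).add (K.hasComps_X7 hU))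
    fun p hp => ?_
  have h1 := h0 p hp
  refine ⟨?_, ?_, ?_⟩
  · intro g0 g1 g2 g3 g4 h
    simp [Fin.forall_fin_succ, Pi.single_apply] at h
    grind
  · intro g0 g1 g2 g3 h
    simp [Fin.forall_fin_succ] at h
    grind
  · simp [Fin.forall_fin_succ, pairing]

theorem isCompleteInvariantSet_X2_X3_X4_YX7X11 (a : ℝ) {U : Set State}
    (hU : IsOpen U) (K : CylChart U) (h0 : ∀ p ∈ U, t p ≠ 0) :
    IsCompleteInvariantSet U ![X2, X3, X4, Y + a • X7 + X11]
      ![ρ, fun p => u p - x p / t p,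
        fun p => K.θ p + K.ϑ p - a * Real.log |t p|,
        K.q,
        fun p => P p - Real.log |t p|] := by
  have h := K.isCoordSystem_vel hU
  obtain ⟨ht, hx, -, -, hu, hq, hσ, hP⟩ := K.hasCoeffs_vel hU
  refine h.isCompleteInvariantSet (h.coord 7) (hu.sub (hx.div ht h0))
    (hσ.sub ((ht.log_abs h0).const_mul a))
    hq
    (hP.sub (ht.log_abs h0))
    (K.hasComps_vel_X2 hU)
    (K.hasComps_vel_X3 hU)
    (K.hasComps_vel_X4 hU)
    (((K.hasComps_vel_Y hU).add ((K.hasComps_vel_X7 hU).smul a)).add (K.hasComps_vel_X11 hU))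
    fun p hp => ?_
  have h1 := h0 p hp
  refine ⟨?_, ?_, ?_⟩
  · intro g0 g1 g2 g3 g4 h
    simp [Fin.forall_fin_succ, Pi.single_apply] at h
    grind
  · intro g0 g1 g2 g3 h
    simp [Fin.forall_fin_succ] at h
    grind
  · simp [Fin.forall_fin_succ, pairing]
    grind

theorem isCompleteInvariantSet_X2_X3_X4_YX11 :
    IsCompleteInvariantSet {p | t p ≠ 0} ![X2, X3, X4, Y + X11]
      ![ρ, fun p => u p - x p / t p,
        v,
        w,
        fun p => P p - Real.log |t p|] := by
  have h : IsCoordSystem {p | t p ≠ 0} cart := isCoordSystem_cart <|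
    isOpen_ne_fun (continuous_apply 0) continuous_const
  have h0 : ∀ p ∈ {p | t p ≠ 0}, t p ≠ 0 := fun p hp => hp
  obtain ⟨ht, hx, -, -, hu, hv, hw, hP⟩ := h.hasCoeffs_cart
  refine h.isCompleteInvariantSet (h.coord 7) (hu.sub (hx.div ht h0))
    hv
    hw
    (hP.sub (ht.log_abs h0))
    (hasComps_cart _ _)
    (hasComps_cart _ _)
    (hasComps_cart _ _)
    (hasComps_cart _ _)
    fun p hp => ?_
  have h1 := h0 p hp
  refine ⟨?_, ?_, ?_⟩
  · intro g0 g1 g2 g3 g4 h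
    simp [Fin.forall_fin_succ, Pi.single_apply] at h
    grind
  · intro g0 g1 g2 g3 h
    simp [Fin.forall_fin_succ, X2, X3, X4, X11, Y] at h
    grind
  · simp [Fin.forall_fin_succ, pairing, X2, X3, X4, X11, Y]
    grind

theorem isCompleteInvariantSet_X2_X3_X4_YX1X7 (ε : ℝ) {U : Set State}
    (hU : IsOpen U) (K : CylChart U) (h0 : ∀ p ∈ U, t p ≠ 0) :
    IsCompleteInvariantSet U ![X2, X3, X4, Y + ε • X1 + X7]
      ![ρ, t,
        K.q,
        fun p => u p - x p / t p + ε / t p * (K.θ p + K.ϑ p),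
        fun p => P p - (K.θ p + K.ϑ p)] := by
  have h := K.isCoordSystem_vel hU
  obtain ⟨ht, hx, -, -, hu, hq, hσ, hP⟩ := K.hasCoeffs_vel hU
  refine h.isCompleteInvariantSet (h.coord 7) ht
    hq
    ((hu.sub (hx.div ht h0)).add (((hasCoeffs_const ε).div ht h0).mul hσ))
    (hP.sub hσ)
    (K.hasComps_vel_X2 hU)
    (K.hasComps_vel_X3 hU)
    (K.hasComps_vel_X4 hU)
    (((K.hasComps_vel_Y hU).add ((K.hasComps_vel_X1 hU).smul ε)).add (K.hasComps_vel_X7 hU))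
    fun p hp => ?_
  have h1 := h0 p hp
  refine ⟨?_, ?_, ?_⟩
  · intro g0 g1 g2 g3 g4 h
    simp [Fin.forall_fin_succ, Pi.single_apply] at h
    grind
  · intro g0 g1 g2 g3 h
    simp [Fin.forall_fin_succ] at h
    grind
  · simp [Fin.forall_fin_succ, pairing]
    grind

/-- Put `T = d t + c`. Along the last field `ln |T|` grows with speed `d`, and `z / T` with speed `b
t / T = b / d - b c / (d T)`. The logarithmic term cancels the first summand and the term in `1 / T`
the second. -/
theorem isCompleteInvariantSet_X1_X2_X4_YX5X6X10X11 (a b c d : ℝ) (hd : d ≠ 0) :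
    IsCompleteInvariantSet {p | d * t p + c ≠ 0} ![X1, X2, X4, Y + a • X5 + b • X6 + c • X10 + d • X11]
      ![ρ, fun p => z p / (d * t p + c) - b * c / (d ^ 2 * (d * t p + c))
            - b * Real.log |d * t p + c| / d ^ 2,
        fun p => v p - a / d * Real.log |d * t p + c|,
        fun p => w p - b / d * Real.log |d * t p + c|,
        fun p => P p - Real.log |d * t p + c| / d] := by
  have h : IsCoordSystem {p | d * t p + c ≠ 0} cart := isCoordSystem_cart <|
    isOpen_ne_fun ((continuous_const.mul (continuous_apply 0)).add
    continuous_const) continuous_const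
  have h0 : ∀ p ∈ {p | d * t p + c ≠ 0}, d * t p + c ≠ 0 := fun p hp => hp
  obtain ⟨ht, -, -, hz, -, hv, hw, hP⟩ := h.hasCoeffs_cart
  have hT := (ht.const_mul d).add (hasCoeffs_const (U := {p | d * t p + c ≠ 0}) (κ := cart) c)
  refine h.isCompleteInvariantSet (h.coord 7) (((hz.div hT h0).sub ((hasCoeffs_const (b * c)).div (hT.const_mul (d ^ 2))
      fun p hp => mul_ne_zero (pow_ne_zero 2 hd) (h0 p hp))).sub
      (((hT.log_abs h0).const_mul b).div_const (d ^ 2)))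
    (hv.sub ((hT.log_abs h0).const_mul (a / d)))
    (hw.sub ((hT.log_abs h0).const_mul (b / d)))
    (hP.sub ((hT.log_abs h0).div_const d))
    (hasComps_cart _ _)
    (hasComps_cart _ _)
    (hasComps_cart _ _)
    (hasComps_cart _ _)
    fun p hp => ?_
  have h1 := h0 p hp
  refine ⟨?_, ?_, ?_⟩
  · intro g0 g1 g2 g3 g4 h
    simp [Fin.forall_fin_succ, Pi.single_apply] at h
    grind
  · intro g0 g1 g2 g3 h
    simp [Fin.forall_fin_succ, X1, X2, X4, X5, X6, X10, X11, Y] at h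
    grind
  · simp [Fin.forall_fin_succ, pairing, X1, X2, X4, X5, X6, X10, X11, Y]
    refine ⟨?_, ?_, ?_, ?_⟩ <;> field_simp <;> ring

theorem isCompleteInvariantSet_X1_X2_X4_YX5X6X10 (a b : ℝ) :
    IsCompleteInvariantSet univ ![X1, X2, X4, Y + a • X5 + b • X6 + X10]
      ![ρ, fun p => z p - b * (t p ^ 2 / 2),
        fun p => v p - a * t p,
        fun p => w p - b * t p,
        fun p => P p - t p] := by
  have h : IsCoordSystem univ cart := isCoordSystem_cart <|
    isOpen_univ
  obtain ⟨ht, -, -, hz, -, hv, hw, hP⟩ := h.hasCoeffs_cart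
  refine h.isCompleteInvariantSet (h.coord 7) (hz.sub ((ht.sq.div_const 2).const_mul b))
    (hv.sub (ht.const_mul a))
    (hw.sub (ht.const_mul b))
    (hP.sub ht)
    (hasComps_cart _ _)
    (hasComps_cart _ _)
    (hasComps_cart _ _)
    (hasComps_cart _ _)
    fun p hp => ⟨?_, ?_, ?_⟩
  · intro g0 g1 g2 g3 g4 h
    simp [Fin.forall_fin_succ, Pi.single_apply] at h
    grind
  · intro g0 g1 g2 g3 h
    simp [Fin.forall_fin_succ, X1, X2, X4, X5, X6, X10, Y] at h
    grind
  · simp [Fin.forall_fin_succ, pairing, X1, X2, X4, X5, X6, X10, Y]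
    grind

theorem isCompleteInvariantSet_X1_X2_X3_YX4X7X11 (a c : ℝ) (hc : c ≠ 0) {U : Set State}
    (hU : IsOpen U) (K : CylChart U) (h0 : ∀ p ∈ U, t p ≠ 0) :
    IsCompleteInvariantSet U ![X1, X2, X3, Y + a • X4 + X7 + c • X11]
      ![ρ, fun p => K.θ p + K.ϑ p - Real.log |t p| / c,
        fun p => u p - a / c * Real.log |t p|,
        K.q,
        fun p => P p - Real.log |t p| / c] := by
  have h := K.isCoordSystem_vel hU
  obtain ⟨ht, -, -, -, hu, hq, hσ, hP⟩ := K.hasCoeffs_vel hU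
  refine h.isCompleteInvariantSet (h.coord 7) (hσ.sub ((ht.log_abs h0).div_const c))
    (hu.sub ((ht.log_abs h0).const_mul (a / c)))
    hq
    (hP.sub ((ht.log_abs h0).div_const c))
    (K.hasComps_vel_X1 hU)
    (K.hasComps_vel_X2 hU)
    (K.hasComps_vel_X3 hU)
    ((((K.hasComps_vel_Y hU).add ((K.hasComps_vel_X4 hU).smul a)).add (K.hasComps_vel_X7 hU)).add ((K.hasComps_vel_X11 hU).smul c))
    fun p hp => ?_
  have h1 := h0 p hp
  refine ⟨?_, ?_, ?_⟩
  · intro g0 g1 g2 g3 g4 h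
    simp [Fin.forall_fin_succ, Pi.single_apply] at h
    grind
  · intro g0 g1 g2 g3 h
    simp [Fin.forall_fin_succ] at h
    grind
  · simp [Fin.forall_fin_succ, pairing]
    grind

theorem isCompleteInvariantSet_X1_X2_X3_YX4X7 (a : ℝ) {U : Set State}
    (hU : IsOpen U) (K : CylChart U) :
    IsCompleteInvariantSet U ![X1, X2, X3, Y + a • X4 + X7]
      ![ρ, t,
        fun p => u p - a * (K.ϑ p + K.θ p),
        K.q,
        fun p => P p - (K.θ p + K.ϑ p)] := by
  have h := K.isCoordSystem_vel hU
  obtain ⟨ht, -, -, -, hu, hq, hσ, hP⟩ := K.hasCoeffs_vel hU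
  refine h.isCompleteInvariantSet (h.coord 7) ht
    -- The coordinate of the mixed system is `θ + ϑ`; the listed function has the summands in the
    -- other order.
    (hu.sub ((hσ.congr fun p => add_comm _ _).const_mul a))
    hq
    (hP.sub hσ)
    (K.hasComps_vel_X1 hU)
    (K.hasComps_vel_X2 hU)
    (K.hasComps_vel_X3 hU)
    (((K.hasComps_vel_Y hU).add ((K.hasComps_vel_X4 hU).smul a)).add (K.hasComps_vel_X7 hU))
    fun p hp => ⟨?_, ?_, ?_⟩
  · intro g0 g1 g2 g3 g4 h
    simp [Fin.forall_fin_succ, Pi.single_apply] at h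
    grind
  · intro g0 g1 g2 g3 h
    simp [Fin.forall_fin_succ] at h
    grind
  · simp [Fin.forall_fin_succ, pairing]

theorem isCompleteInvariantSet_X1_X2_X3_YX4X7X10 (a : ℝ) {U : Set State}
    (hU : IsOpen U) (K : CylChart U) :
    IsCompleteInvariantSet U ![X1, X2, X3, Y + a • X4 + X7 + X10]
      ![ρ, fun p => K.θ p + K.ϑ p - t p,
        fun p => u p - a * t p,
        K.q,
        fun p => P p - t p] := by
  have h := K.isCoordSystem_vel hU
  obtain ⟨ht, -, -, -, hu, hq, hσ, hP⟩ := K.hasCoeffs_vel hU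
  refine h.isCompleteInvariantSet (h.coord 7) (hσ.sub ht)
    (hu.sub (ht.const_mul a))
    hq
    (hP.sub ht)
    (K.hasComps_vel_X1 hU)
    (K.hasComps_vel_X2 hU)
    (K.hasComps_vel_X3 hU)
    ((((K.hasComps_vel_Y hU).add ((K.hasComps_vel_X4 hU).smul a)).add (K.hasComps_vel_X7 hU)).add (K.hasComps_vel_X10 hU))
    fun p hp => ⟨?_, ?_, ?_⟩
  · intro g0 g1 g2 g3 g4 h
    simp [Fin.forall_fin_succ, Pi.single_apply] at h
    grind
  · intro g0 g1 g2 g3 h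
    simp [Fin.forall_fin_succ] at h
    grind
  · simp [Fin.forall_fin_succ, pairing]

theorem isCompleteInvariantSet_X1_X2_X3_YX4 :
    IsCompleteInvariantSet univ ![X1, X2, X3, Y + X4]
      ![ρ, t,
        v,
        w,
        fun p => P p - u p] := by
  have h : IsCoordSystem univ cart := isCoordSystem_cart <|
    isOpen_univ
  obtain ⟨ht, -, -, -, hu, hv, hw, hP⟩ := h.hasCoeffs_cart
  refine h.isCompleteInvariantSet (h.coord 7) ht
    hv
    hw
    (hP.sub hu)
    (hasComps_cart _ _)
    (hasComps_cart _ _)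
    (hasComps_cart _ _)
    (hasComps_cart _ _)
    fun p hp => ⟨?_, ?_, ?_⟩
  · intro g0 g1 g2 g3 g4 h
    simp [Fin.forall_fin_succ, Pi.single_apply] at h
    grind
  · intro g0 g1 g2 g3 h
    simp [Fin.forall_fin_succ, X1, X2, X3, X4, Y] at h
    grind
  · simp [Fin.forall_fin_succ, pairing, X1, X2, X3, X4, Y]

/-! ### Spherical coordinates -/

section Sph

variable {U : Set State} (hU : IsOpen U) (K : SphChart U)

theorem SphChart.r_ne (K : SphChart U) : ∀ p ∈ U, K.r p ≠ 0 := fun p hp => (K.rel p hp).1.ne'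

theorem SphChart.q_ne (K : SphChart U) : ∀ p ∈ U, K.q p ≠ 0 := fun p hp => (K.rel p hp).2.1.ne'

theorem SphChart.sin_ne (K : SphChart U) : ∀ p ∈ U, Real.sin (K.ϑ p) ≠ 0 := fun p hp =>
  (Real.sin_pos_of_mem_Ioo (K.rel p hp).2.2.2.1).ne'

theorem SphChart.sq_r (K : SphChart U) : ∀ p ∈ U, K.r p ^ 2 = x p ^ 2 + y p ^ 2 + z p ^ 2 := by
  intro p hp
  obtain ⟨-, -, -, -, h1, h2, h3, -⟩ := K.rel p hp
  rw [h1, h2, h3]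
  linear_combination (-K.r p ^ 2 * Real.sin (K.θ p) ^ 2) * Real.sin_sq_add_cos_sq (K.φ p)
    - K.r p ^ 2 * Real.sin_sq_add_cos_sq (K.θ p)

theorem SphChart.sq_q (K : SphChart U) : ∀ p ∈ U, K.q p ^ 2 = u p ^ 2 + v p ^ 2 + w p ^ 2 := by
  intro p hp
  obtain ⟨-, -, -, -, -, -, -, h1, h2, h3⟩ := K.rel p hp
  rw [h1, h2, h3]
  have e1 := Real.sin_sq_add_cos_sq (K.φ p)
  have e2 := Real.sin_sq_add_cos_sq (K.θ p)
  have e3 := Real.sin_sq_add_cos_sq (K.ϑ p)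
  have e4 := Real.sin_sq_add_cos_sq (K.ψ p)
  generalize Real.sin (K.φ p) = sf, Real.cos (K.φ p) = cf, Real.sin (K.θ p) = st,
    Real.cos (K.θ p) = ct, Real.sin (K.ϑ p) = sv, Real.cos (K.ϑ p) = cv,
    Real.sin (K.ψ p) = sp, Real.cos (K.ψ p) = cp, K.q p = q at *
  linear_combination (-((q * cv * st + q * sv * cp * ct) ^ 2 + (q * sv * sp) ^ 2)) * e1
    - ((q * cv) ^ 2 + (q * sv * cp) ^ 2) * e2 - q ^ 2 * sv ^ 2 * e4 - q ^ 2 * e3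

/-- The spherical frame is orthonormal with the position along its first vector, so the scalar
product is `r` times the radial velocity `U = q cos ϑ`. -/
theorem SphChart.inner_eq (K : SphChart U) : ∀ p ∈ U,
    x p * u p + y p * v p + z p * w p = K.r p * K.q p * Real.cos (K.ϑ p) := by
  intro p hp
  obtain ⟨-, -, -, -, h1, h2, h3, h4, h5, h6⟩ := K.rel p hp
  rw [h1, h2, h3, h4, h5, h6]
  have e1 := Real.sin_sq_add_cos_sq (K.φ p)
  have e2 := Real.sin_sq_add_cos_sq (K.θ p)
  generalize Real.sin (K.φ p) = sf, Real.cos (K.φ p) = cf, Real.sin (K.θ p) = st,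
    Real.cos (K.θ p) = ct, Real.sin (K.ϑ p) = sv, Real.cos (K.ϑ p) = cv,
    Real.sin (K.ψ p) = sp, Real.cos (K.ψ p) = cp, K.q p = q, K.r p = r at *
  linear_combination (r * st * (q * cv * st + q * sv * cp * ct)) * e1 + r * q * cv * e2

/-- Position and velocity are not parallel where spherical coordinates are defined. -/
theorem SphChart.cross_ne (K : SphChart U) : ∀ p ∈ U,
    (y p * w p - z p * v p) ^ 2 + (z p * u p - x p * w p) ^ 2 + (x p * v p - y p * u p) ^ 2
      ≠ 0 := by
  intro p hp
  have h : (y p * w p - z p * v p) ^ 2 + (z p * u p - x p * w p) ^ 2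
      + (x p * v p - y p * u p) ^ 2 = (K.r p * K.q p * Real.sin (K.ϑ p)) ^ 2 := by
    have e := Real.sin_sq_add_cos_sq (K.ϑ p)
    have h1 := K.sq_r p hp
    have h2 := K.sq_q p hp
    have h3 := K.inner_eq p hp
    -- Lagrange's identity for the cross product of position and velocity.
    calc _ = (x p ^ 2 + y p ^ 2 + z p ^ 2) * (u p ^ 2 + v p ^ 2 + w p ^ 2)
          - (x p * u p + y p * v p + z p * w p) ^ 2 := by ring
      _ = _ := by
        rw [← h1, ← h2, h3]
        linear_combination (-K.r p ^ 2 * K.q p ^ 2) * e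
  rw [h]
  exact pow_ne_zero 2 (mul_ne_zero (mul_ne_zero (K.r_ne p hp) (K.q_ne p hp)) (K.sin_ne p hp))

include hU

theorem SphChart.hasCoeffs_r : HasCoeffs U cart K.r
    (fun p => (K.r p)⁻¹ • ![0, x p, y p, z p, 0, 0, 0, 0, 0]) where
  smooth := K.smooth_r
  deriv p hp := by
    have hr := ((K.smooth_r.contDiffAt (hU.mem_nhds hp)).differentiableAt (by simp)).hasFDerivAt
    have heq : (fun p => K.r p ^ 2) =ᶠ[𝓝 p] fun p => p 1 ^ 2 + p 2 ^ 2 + p 3 ^ 2 :=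
      Filter.eventually_of_mem (hU.mem_nhds hp) K.sq_r
    have h := (hr.pow 2).unique (((((hasFDerivAt_coord p 1).pow 2).add
      ((hasFDerivAt_coord p 2).pow 2)).add
      ((hasFDerivAt_coord p 3).pow 2)).congr_of_eventuallyEq heq)
    refine hr.congr_fderiv ?_
    ext1 ξ
    have h1 := congrArg (fun l => l ξ) h
    have h0 := K.r_ne p hp
    rw [HasCoeffs.sum_cart_apply]
    simp at h1
    simp [dotProduct, Fin.sum_univ_succ, x, y, z]
    field_simp
    linear_combination h1 / 2

theorem SphChart.hasCoeffs_q : HasCoeffs U cart K.q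
    (fun p => (K.q p)⁻¹ • ![0, 0, 0, 0, u p, v p, w p, 0, 0]) where
  smooth := K.smooth_q
  deriv p hp := by
    have hr := ((K.smooth_q.contDiffAt (hU.mem_nhds hp)).differentiableAt (by simp)).hasFDerivAt
    have heq : (fun p => K.q p ^ 2) =ᶠ[𝓝 p] fun p => p 4 ^ 2 + p 5 ^ 2 + p 6 ^ 2 :=
      Filter.eventually_of_mem (hU.mem_nhds hp) K.sq_q
    have h := (hr.pow 2).unique (((((hasFDerivAt_coord p 4).pow 2).add
      ((hasFDerivAt_coord p 5).pow 2)).add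
      ((hasFDerivAt_coord p 6).pow 2)).congr_of_eventuallyEq heq)
    refine hr.congr_fderiv ?_
    ext1 ξ
    have h1 := congrArg (fun l => l ξ) h
    have h0 := K.q_ne p hp
    rw [HasCoeffs.sum_cart_apply]
    simp at h1
    simp [dotProduct, Fin.sum_univ_succ, u, v, w]
    field_simp
    linear_combination h1 / 2

/-- Differentiate the scalar product `r q cos ϑ` of position and velocity and solve for `dϑ`,
dividing by `r q sin ϑ ≠ 0`. -/
theorem SphChart.hasCoeffs_ϑ : HasCoeffs U cart K.ϑ
    (fun p => (K.r p * K.q p * Real.sin (K.ϑ p))⁻¹ •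
      ((K.q p * Real.cos (K.ϑ p)) • (K.r p)⁻¹ • ![0, x p, y p, z p, 0, 0, 0, 0, 0]
        + (K.r p * Real.cos (K.ϑ p)) • (K.q p)⁻¹ • ![0, 0, 0, 0, u p, v p, w p, 0, 0]
        - ![0, u p, v p, w p, x p, y p, z p, 0, 0])) where
  smooth := K.smooth_ϑ
  deriv p hp := by
    have hϑ := ((K.smooth_ϑ.contDiffAt (hU.mem_nhds hp)).differentiableAt (by simp)).hasFDerivAt
    have hr := (K.hasCoeffs_r hU).deriv p hp
    have hq := (K.hasCoeffs_q hU).deriv p hp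
    have heq : (fun p => K.r p * K.q p * Real.cos (K.ϑ p)) =ᶠ[𝓝 p]
        fun p => p 1 * p 4 + p 2 * p 5 + p 3 * p 6 :=
      Filter.eventually_of_mem (hU.mem_nhds hp) fun p hp => (K.inner_eq p hp).symm
    have h := ((hr.mul hq).mul hϑ.cos).unique
      (((((hasFDerivAt_coord p 1).mul (hasFDerivAt_coord p 4)).add
      ((hasFDerivAt_coord p 2).mul (hasFDerivAt_coord p 5))).add
      ((hasFDerivAt_coord p 3).mul (hasFDerivAt_coord p 6))).congr_of_eventuallyEq heq)
    refine hϑ.congr_fderiv ?_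
    ext1 ξ
    have h1 := congrArg (fun l => l ξ) h
    have h0 := K.r_ne p hp
    have h2 := K.q_ne p hp
    have h3 := K.sin_ne p hp
    rw [HasCoeffs.sum_cart_apply]
    simp only [add_apply, smul_apply, HasCoeffs.sum_cart_apply, smul_dotProduct, smul_eq_mul,
      Pi.mul_apply,
      ContinuousLinearMap.proj_apply] at h1
    simp only [smul_dotProduct, sub_dotProduct, add_dotProduct, smul_eq_mul]
    have h4 : ![0, u p, v p, w p, x p, y p, z p, 0, 0] ⬝ᵥ ξ =
        p 1 * ξ 4 + p 4 * ξ 1 + (p 2 * ξ 5 + p 5 * ξ 2) + (p 3 * ξ 6 + p 6 * ξ 3) := by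
      simp [dotProduct, Fin.sum_univ_succ, x, y, z, u, v, w]; ring
    rw [h4, ← h1]
    field_simp
    ring

/-- Invariants of the rotations and one more field that dilates the positions. -/
theorem SphChart.isCompleteInvariantSet {I1 I4 : State → ℝ} {Z : VF} (s c d τ m : State → ℝ)
    (h1 : HasCoeffs U cart I1 fun p => ![s p, c p * x p, c p * y p, c p * z p, 0, 0, 0, 0, 0])
    (h4 : HasCoeffs U cart I4 fun p => ![d p, 0, 0, 0, 0, 0, 0, 0, 1])
    (hc : ∀ p ∈ U, c p ≠ 0)
    (hZ : Z = fun p => ![τ p, m p * x p, m p * y p, m p * z p, 0, 0, 0, 0, 1])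
    (hinv1 : ∀ p ∈ U, s p * τ p + c p * m p * K.r p ^ 2 = 0)
    (hinv4 : ∀ p ∈ U, d p * τ p + 1 = 0) :
    IsCompleteInvariantSet U ![X7, X8, X9, Z] ![ρ, I1, K.q, K.ϑ, I4] := by
  subst hZ
  refine (isCoordSystem_cart hU).isCompleteInvariantSet ((isCoordSystem_cart hU).coord 7) h1
    (K.hasCoeffs_q hU) (K.hasCoeffs_ϑ hU) h4 (hasComps_cart _ _) (hasComps_cart _ _)
    (hasComps_cart _ _) (hasComps_cart _ _) fun p hp => ?_
  have hr := K.r_ne p hp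
  have hq := K.q_ne p hp
  have hs := K.sin_ne p hp
  have hn := K.cross_ne p hp
  have hr2 := K.sq_r p hp
  have hq2 := K.sq_q p hp
  have hxu := K.inner_eq p hp
  have hcp := hc p hp
  have hi1 := hinv1 p hp
  have hi4 := hinv4 p hp
  clear hinv1 hinv4 hc h1 h4
  generalize Real.sin (K.ϑ p) = sϑ, Real.cos (K.ϑ p) = cϑ, K.r p = r, K.q p = q, c p = c,
    s p = s, d p = d, τ p = τ, m p = m at *
  refine ⟨?_, ?_, ?_⟩
  · intro g0 g1 g2 g3 g4 h
    simp [Fin.forall_fin_succ, Pi.single_apply] at h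
    obtain ⟨e0, e1, e2, e3, e4, e5, e6, e7, e8⟩ := h
    subst e7 e8
    have k1 : (g1 * c + g3 * ((r * q * sϑ)⁻¹ * (q * cϑ * r⁻¹))) * x p
        - g3 * (r * q * sϑ)⁻¹ * u p = 0 := by rw [← e1]; field_simp; ring
    have k2 : (g1 * c + g3 * ((r * q * sϑ)⁻¹ * (q * cϑ * r⁻¹))) * y p
        - g3 * (r * q * sϑ)⁻¹ * v p = 0 := by rw [← e2]; field_simp; ring
    have k3 : (g1 * c + g3 * ((r * q * sϑ)⁻¹ * (q * cϑ * r⁻¹))) * z p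
        - g3 * (r * q * sϑ)⁻¹ * w p = 0 := by rw [← e3]; field_simp; ring
    have k4 : (g2 * q⁻¹ + g3 * ((r * q * sϑ)⁻¹ * (r * cϑ * q⁻¹))) * u p
        - g3 * (r * q * sϑ)⁻¹ * x p = 0 := by rw [← e4]; field_simp; ring
    have k5 : (g2 * q⁻¹ + g3 * ((r * q * sϑ)⁻¹ * (r * cϑ * q⁻¹))) * v p
        - g3 * (r * q * sϑ)⁻¹ * y p = 0 := by rw [← e5]; field_simp; ring
    have k6 : (g2 * q⁻¹ + g3 * ((r * q * sϑ)⁻¹ * (r * cϑ * q⁻¹))) * w p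
        - g3 * (r * q * sϑ)⁻¹ * z p = 0 := by rw [← e6]; field_simp; ring
    -- `k1`–`k3` say that a multiple of the position minus `β = g3 / (r q sin ϑ)` times the velocity
    -- is zero. With `n` the cross product of position and velocity, pairing with the cross product
    -- of position and `n` removes the position and leaves `β |n|² = 0`.
    have hg3 : g3 = 0 := by
      have : g3 * (r * q * sϑ)⁻¹ * ((y p * w p - z p * v p) ^ 2 + (z p * u p - x p * w p) ^ 2
          + (x p * v p - y p * u p) ^ 2) = 0 := by
        linear_combination
          (z p * (y p * w p - z p * v p) - x p * (x p * v p - y p * u p)) * k2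
          + (x p * (z p * u p - x p * w p) - y p * (y p * w p - z p * v p)) * k3
          + (y p * (x p * v p - y p * u p) - z p * (z p * u p - x p * w p)) * k1
      simpa [hn, hr, hq, hs] using this
    subst hg3
    simp only [zero_mul, add_zero, sub_zero] at k1 k2 k3 k4 k5 k6
    have hg1 : g1 = 0 := by
      have : g1 * c * r ^ 2 = 0 := by
        rw [hr2]; linear_combination x p * k1 + y p * k2 + z p * k3
      simpa [hcp, hr] using this
    have hg2 : g2 = 0 := by
      have : g2 * q⁻¹ * q ^ 2 = 0 := by
        rw [hq2]; linear_combination u p * k4 + v p * k5 + w p * k6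
      simpa [hq] using this
    simp [hg1, hg2]
  · intro g0 g1 g2 g3 h
    simp [Fin.forall_fin_succ, X7, X8, X9] at h
    obtain ⟨-, e1, e2, e3, e4, e5, e6, e7⟩ := h
    subst e7
    -- The remaining equations say that `(g0, g1, g2)` has zero cross product with both position and
    -- velocity. These are not parallel, so the vector is zero.
    have k0 : g0 * ((y p * w p - z p * v p) ^ 2 + (z p * u p - x p * w p) ^ 2
      + (x p * v p - y p * u p) ^ 2) = 0 := by grind
    have k1 : g1 * ((y p * w p - z p * v p) ^ 2 + (z p * u p - x p * w p) ^ 2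
      + (x p * v p - y p * u p) ^ 2) = 0 := by grind
    have k2 : g2 * ((y p * w p - z p * v p) ^ 2 + (z p * u p - x p * w p) ^ 2
      + (x p * v p - y p * u p) ^ 2) = 0 := by grind
    simpa [hn] using And.intro k0 (And.intro k1 k2)
  · simp [Fin.forall_fin_succ, pairing, X7, X8, X9]
    have hrr : r⁻¹ * r ^ 2 = r := by field_simp
    refine ⟨⟨by ring, by ring, by ring, ?_⟩, ⟨by ring, by ring, by ring⟩,
      ⟨by ring, by ring, by ring, ?_⟩, hi4⟩
    · linear_combination hi1 - c * m * hr2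
    · linear_combination (-(sϑ⁻¹ * (q⁻¹ * r⁻¹) * m * q * cϑ * r⁻¹)) * hr2
        - sϑ⁻¹ * (q⁻¹ * r⁻¹) * m * hxu + sϑ⁻¹ * (q⁻¹ * r⁻¹) * m * q * cϑ * hrr

end Sph

/-! ### The two algebras containing all rotations. -/

theorem isCompleteInvariantSet_X7_X8_X9_YX11 {U : Set State} (hU : IsOpen U) (K : SphChart U)
    (h0 : ∀ p ∈ U, t p ≠ 0) :
    IsCompleteInvariantSet U ![X7, X8, X9, Y + X11]
      ![ρ, fun p => K.r p / t p, K.q, K.ϑ, fun p => P p - Real.log |t p|] := by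
  have h := isCoordSystem_cart hU
  have ht : HasCoeffs U cart t _ := h.coord 0
  have hP : HasCoeffs U cart P _ := h.coord 8
  refine K.isCompleteInvariantSet hU (fun p => -(K.r p / t p ^ 2))
    (fun p => (t p)⁻¹ * (K.r p)⁻¹) (fun p => -(t p)⁻¹) t 1
    (((K.hasCoeffs_r hU).div ht h0).congr_coeffs fun p _ => ?_)
    ((hP.sub (ht.log_abs h0)).congr_coeffs fun p _ => ?_)
    (fun p hp => mul_ne_zero (inv_ne_zero (h0 p hp)) (inv_ne_zero (K.r_ne p hp))) ?_ ?_ ?_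
  · ext k
    fin_cases k <;> simp [mul_assoc]
  · ext k
    fin_cases k <;> simp
  · ext p k
    fin_cases k <;> simp [Y, X11]
  · intro p hp
    have h1 := h0 p hp
    have h2 := K.r_ne p hp
    simp
    field_simp
    ring
  · intro p hp
    simp [h0 p hp]

theorem isCompleteInvariantSet_X7_X8_X9_YX10 {U : Set State} (hU : IsOpen U) (K : SphChart U) :
    IsCompleteInvariantSet U ![X7, X8, X9, Y + X10]
      ![ρ, K.r, K.q, K.ϑ, fun p => P p - t p] := by
  have h := isCoordSystem_cart hU
  have ht : HasCoeffs U cart t _ := h.coord 0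
  have hP : HasCoeffs U cart P _ := h.coord 8
  refine K.isCompleteInvariantSet hU 0 (fun p => (K.r p)⁻¹) (fun _ => -1) 1 0
    ((K.hasCoeffs_r hU).congr_coeffs fun p _ => ?_)
    ((hP.sub ht).congr_coeffs fun p _ => ?_)
    (fun p hp => inv_ne_zero (K.r_ne p hp)) ?_ ?_ ?_
  · ext k
    fin_cases k <;> simp
  · ext k
    fin_cases k <;> simp
  · ext p k
    fin_cases k <;> simp [Y, X10]
  · intro p hp
    simp
  · intro p hp
    simp

end GasDyn

/-! ### All cases together. -/

theorem mainTheorem1 :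
    -- The twelve generators span a twelve-dimensional Lie algebra.
    (Module.finrank ℝ L12 = 12 ∧ ClosedUnderBracket L12) ∧
    -- Smooth coordinate functions exist locally, with any prescribed values of the angles.
    (∀ (p : State) (r θ q ϑ : ℝ), CylRel p r θ q ϑ →
      ∃ U : Set State, IsOpen U ∧ p ∈ U ∧ ∃ K : CylChart U,
        K.r p = r ∧ K.θ p = θ ∧ K.q p = q ∧ K.ϑ p = ϑ) ∧
    (∀ (p : State) (r θ φ q ϑ ψ : ℝ), SphRel p r θ φ q ϑ ψ →
      ∃ U : Set State, IsOpen U ∧ p ∈ U ∧ ∃ K : SphChart U,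
        K.r p = r ∧ K.θ p = θ ∧ K.φ p = φ ∧ K.q p = q ∧ K.ϑ p = ϑ ∧ K.ψ p = ψ) ∧
    (∀ (b : ℝ) (p : State) (q ϑ : ℝ), VelRel b p q ϑ →
      ∃ U : Set State, IsOpen U ∧ p ∈ U ∧ ∃ K : VelChart b U, K.q p = q ∧ K.ϑ p = ϑ) ∧
    -- Item 1.
    (IsSubalgebraBasis ![X7, X8, X9, Y + X11] ∧
      ∀ U : Set State, IsOpen U → ∀ K : SphChart U, (∀ p ∈ U, t p ≠ 0) →
        IsCompleteInvariantSet U ![X7, X8, X9, Y + X11]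
          ![ρ, fun p => K.r p / t p, K.q, K.ϑ, fun p => P p - Real.log |t p|]) ∧
    -- Item 2.
    (IsSubalgebraBasis ![X7, X8, X9, Y + X10] ∧
      ∀ U : Set State, IsOpen U → ∀ K : SphChart U,
        IsCompleteInvariantSet U ![X7, X8, X9, Y + X10]
          ![ρ, K.r, K.q, K.ϑ, fun p => P p - t p]) ∧
    -- Item 3.
    (∀ a b : ℝ, IsSubalgebraBasis ![X1, a • X4 + X7, b • X4 + X11, Y + X4] ∧
      ∀ U : Set State, IsOpen U → ∀ K : CylChart U, (∀ p ∈ U, t p ≠ 0) →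
        IsCompleteInvariantSet U ![X1, a • X4 + X7, b • X4 + X11, Y + X4]
          ![ρ, fun p => K.r p / t p, K.q, K.ϑ, fun p => u p - P p - a * K.θ p - b * Real.log |t p|]) ∧
    -- Item 4.
    (IsSubalgebraBasis ![X1, X4, X7 + X10, Y + X10] ∧
      ∀ U : Set State, IsOpen U → ∀ K : CylChart U,
        IsCompleteInvariantSet U ![X1, X4, X7 + X10, Y + X10]
          ![ρ, K.r, K.q, K.ϑ, fun p => P p - t p + K.θ p]) ∧
    -- Item 5.
    (∀ a b : ℝ, a ≠ 0 → a ^ 2 + b ^ 2 = 1 → IsSubalgebraBasis ![X2, X3, X7 + X10, Y + a • X1 + b • X10] ∧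
      ∀ U : Set State, IsOpen U → ∀ K : CylChart U,
        IsCompleteInvariantSet U ![X2, X3, X7 + X10, Y + a • X1 + b • X10]
          ![ρ, fun p => b / a * x p - t p + K.θ p + K.ϑ p, u, K.q, fun p => P p - x p / a]) ∧
    (IsSubalgebraBasis ![X2, X3, X7 + X10, Y + X10] ∧
      ∀ U : Set State, IsOpen U → ∀ K : CylChart U,
        IsCompleteInvariantSet U ![X2, X3, X7 + X10, Y + X10]
          ![ρ, x, u, K.q, fun p => P p - t p + K.θ p + K.ϑ p]) ∧
    -- Item 6.
    (IsSubalgebraBasis ![X1, X4, X11, Y + X7] ∧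
      ∀ U : Set State, IsOpen U → ∀ K : CylChart U, (∀ p ∈ U, t p ≠ 0) →
        IsCompleteInvariantSet U ![X1, X4, X11, Y + X7]
          ![ρ, fun p => K.r p / t p, K.q, K.ϑ, fun p => P p - K.θ p]) ∧
    -- Item 7.
    (∀ a : ℝ, a ≠ 0 → IsSubalgebraBasis ![X1, X4, X10, Y + a • X7 + X11] ∧
      ∀ U : Set State, IsOpen U → ∀ K : CylChart U,
        IsCompleteInvariantSet U ![X1, X4, X10, Y + a • X7 + X11]
          ![ρ, fun p => K.θ p - a * Real.log |K.r p|, K.q, K.ϑ, fun p => P p - Real.log |K.r p|]) ∧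
    (IsSubalgebraBasis ![X1, X4, X10, Y + X11] ∧
      IsCompleteInvariantSet {p | y p ≠ 0 ∧ z p ≠ 0} ![X1, X4, X10, Y + X11]
        ![ρ, fun p => y p / z p, v, w, fun p => P p - Real.log |y p|]) ∧
    -- Item 8.
    (IsSubalgebraBasis ![X1, X4, X10, Y + X7] ∧
      ∀ U : Set State, IsOpen U → ∀ K : CylChart U,
        IsCompleteInvariantSet U ![X1, X4, X10, Y + X7]
          ![ρ, K.r, K.ϑ, K.q, fun p => P p - K.θ p]) ∧
    -- Item 9.
    (∀ ε a : ℝ, (ε = 0 ∨ ε = 1) → IsSubalgebraBasis ![X2, X3, ε • X4 + X10, Y + a • X1 + X7] ∧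
      ∀ U : Set State, IsOpen U → ∀ K : CylChart U,
        IsCompleteInvariantSet U ![X2, X3, ε • X4 + X10, Y + a • X1 + X7]
          ![ρ, fun p => x p - ε * (t p ^ 2 / 2) - a * (K.θ p + K.ϑ p), fun p => u p - ε * t p, K.q, fun p => P p - (K.θ p + K.ϑ p)]) ∧
    -- Item 10.
    (∀ a b ε : ℝ, a ^ 2 + b ^ 2 = 1 → (ε = 0 ∨ ε = 1) → IsSubalgebraBasis ![a • X1 + X4, b • X3 + X5, b • X2 - X6, Y + ε • X1 + X7] ∧
      ∀ U : Set State, IsOpen U → ∀ K : VelChart b U, (∀ p ∈ U, t p + a ≠ 0) →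
        IsCompleteInvariantSet U ![a • X1 + X4, b • X3 + X5, b • X2 - X6, Y + ε • X1 + X7]
          ![ρ, t, fun p => u p - x p / (t p + a) + ε / (t p + a) * K.ϑ p, K.q, fun p => P p - K.ϑ p]) ∧
    -- Item 11.
    (∀ a : ℝ, a ≠ 0 → IsSubalgebraBasis ![X4, X5, X6, Y + a • X7 + X11] ∧
      ∀ U : Set State, IsOpen U → ∀ K : VelChart 0 U,
        IsCompleteInvariantSet U ![X4, X5, X6, Y + a • X7 + X11]
          ![ρ, fun p => u p - x p / t p, fun p => Real.log |t p| - K.ϑ p / a, K.q, fun p => P p - Real.log |t p|]) ∧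
    (IsSubalgebraBasis ![X4, X5, X6, Y + X11] ∧
      IsCompleteInvariantSet {p | t p ≠ 0} ![X4, X5, X6, Y + X11]
        ![ρ, fun p => u p - x p / t p, fun p => v p - y p / t p, fun p => w p - z p / t p, fun p => P p - Real.log |t p|]) ∧
    -- Item 12.
    (∀ ε : ℝ, (ε = 0 ∨ ε = 1) → IsSubalgebraBasis ![X4, X5, X6, Y + ε • X1 + X7] ∧
      ∀ U : Set State, IsOpen U → ∀ K : VelChart 0 U,
        IsCompleteInvariantSet U ![X4, X5, X6, Y + ε • X1 + X7]
          ![ρ, t, fun p => u p - x p / t p + ε / t p * K.ϑ p, K.q, fun p => P p - K.ϑ p]) ∧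
    -- Item 13.
    (∀ a : ℝ, IsSubalgebraBasis ![X1, X3 + X5, X2 - X6, Y + a • X4 + X7] ∧
      ∀ U : Set State, IsOpen U → ∀ K : VelChart 1 U,
        IsCompleteInvariantSet U ![X1, X3 + X5, X2 - X6, Y + a • X4 + X7]
          ![ρ, t, fun p => u p - a * K.ϑ p, K.q, fun p => P p - K.ϑ p]) ∧
    -- Item 14.
    (∀ a b : ℝ, b ≠ 0 → IsSubalgebraBasis ![X1, X5, X6, Y + a • X4 + b • X7 + X11] ∧
      ∀ U : Set State, IsOpen U → ∀ K : VelChart 0 U,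
        IsCompleteInvariantSet U ![X1, X5, X6, Y + a • X4 + b • X7 + X11]
          ![ρ, fun p => u p - a * Real.log |t p|, fun p => K.ϑ p - b * Real.log |t p|, K.q, fun p => P p - Real.log |t p|]) ∧
    (∀ a : ℝ, IsSubalgebraBasis ![X1, X5, X6, Y + a • X4 + X11] ∧
      IsCompleteInvariantSet {p | t p ≠ 0} ![X1, X5, X6, Y + a • X4 + X11]
        ![ρ, fun p => u p - a * Real.log |t p|, fun p => v p - y p / t p, fun p => w p - z p / t p, fun p => P p - Real.log |t p|]) ∧
    -- Item 15.
    (∀ b : ℝ, IsSubalgebraBasis ![X1, X5, X6, Y + b • X4 + X7] ∧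
      ∀ U : Set State, IsOpen U → ∀ K : VelChart 0 U,
        IsCompleteInvariantSet U ![X1, X5, X6, Y + b • X4 + X7]
          ![ρ, t, fun p => u p - b * K.ϑ p, K.q, fun p => P p - K.ϑ p]) ∧
    -- Item 16.
    (∀ a : ℝ, a ≠ 0 → IsSubalgebraBasis ![X2, X3, X4, Y + a • X7 + X11] ∧
      ∀ U : Set State, IsOpen U → ∀ K : CylChart U, (∀ p ∈ U, t p ≠ 0) →
        IsCompleteInvariantSet U ![X2, X3, X4, Y + a • X7 + X11]
          ![ρ, fun p => u p - x p / t p, fun p => K.θ p + K.ϑ p - a * Real.log |t p|, K.q, fun p => P p - Real.log |t p|]) ∧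
    (IsSubalgebraBasis ![X2, X3, X4, Y + X11] ∧
      IsCompleteInvariantSet {p | t p ≠ 0} ![X2, X3, X4, Y + X11]
        ![ρ, fun p => u p - x p / t p, v, w, fun p => P p - Real.log |t p|]) ∧
    -- Item 17.
    (∀ ε : ℝ, (ε = 0 ∨ ε = 1) → IsSubalgebraBasis ![X2, X3, X4, Y + ε • X1 + X7] ∧
      ∀ U : Set State, IsOpen U → ∀ K : CylChart U, (∀ p ∈ U, t p ≠ 0) →
        IsCompleteInvariantSet U ![X2, X3, X4, Y + ε • X1 + X7]
          ![ρ, t, K.q, fun p => u p - x p / t p + ε / t p * (K.θ p + K.ϑ p), fun p => P p - (K.θ p + K.ϑ p)]) ∧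
    -- Item 18.
    (∀ a b c d : ℝ, d ≠ 0 → c ^ 2 + d ^ 2 = 1 → IsSubalgebraBasis ![X1, X2, X4, Y + a • X5 + b • X6 + c • X10 + d • X11] ∧
      IsCompleteInvariantSet {p | d * t p + c ≠ 0} ![X1, X2, X4, Y + a • X5 + b • X6 + c • X10 + d • X11]
        ![ρ, fun p => z p / (d * t p + c) - b * c / (d ^ 2 * (d * t p + c))
            - b * Real.log |d * t p + c| / d ^ 2, fun p => v p - a / d * Real.log |d * t p + c|,
          fun p => w p - b / d * Real.log |d * t p + c|, fun p => P p - Real.log |d * t p + c| / d]) ∧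
    (∀ a b : ℝ, IsSubalgebraBasis ![X1, X2, X4, Y + a • X5 + b • X6 + X10] ∧
      IsCompleteInvariantSet univ ![X1, X2, X4, Y + a • X5 + b • X6 + X10]
        ![ρ, fun p => z p - b * (t p ^ 2 / 2), fun p => v p - a * t p, fun p => w p - b * t p, fun p => P p - t p]) ∧
    -- Item 19.
    (∀ a c : ℝ, c ≠ 0 → IsSubalgebraBasis ![X1, X2, X3, Y + a • X4 + X7 + c • X11] ∧
      ∀ U : Set State, IsOpen U → ∀ K : CylChart U, (∀ p ∈ U, t p ≠ 0) →
        IsCompleteInvariantSet U ![X1, X2, X3, Y + a • X4 + X7 + c • X11]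
          ![ρ, fun p => K.θ p + K.ϑ p - Real.log |t p| / c, fun p => u p - a / c * Real.log |t p|, K.q, fun p => P p - Real.log |t p| / c]) ∧
    (∀ a : ℝ, IsSubalgebraBasis ![X1, X2, X3, Y + a • X4 + X7] ∧
      ∀ U : Set State, IsOpen U → ∀ K : CylChart U,
        IsCompleteInvariantSet U ![X1, X2, X3, Y + a • X4 + X7]
          ![ρ, t, fun p => u p - a * (K.ϑ p + K.θ p), K.q, fun p => P p - (K.θ p + K.ϑ p)]) ∧
    (∀ a : ℝ, IsSubalgebraBasis ![X1, X2, X3, Y + a • X4 + X7 + X10] ∧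
      ∀ U : Set State, IsOpen U → ∀ K : CylChart U,
        IsCompleteInvariantSet U ![X1, X2, X3, Y + a • X4 + X7 + X10]
          ![ρ, fun p => K.θ p + K.ϑ p - t p, fun p => u p - a * t p, K.q, fun p => P p - t p]) ∧
    -- Item 20.
    (IsSubalgebraBasis ![X1, X2, X3, Y + X4] ∧
      IsCompleteInvariantSet univ ![X1, X2, X3, Y + X4]
        ![ρ, t, v, w, fun p => P p - u p]) := by
  exact ⟨⟨finrank_L12, closedUnderBracket_L12⟩, exists_cylChart, exists_sphChart, exists_velChart,
    ⟨isSubalgebraBasis_X7_X8_X9_YX11, fun _ hU K h0 =>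
      isCompleteInvariantSet_X7_X8_X9_YX11 hU K h0⟩,
    ⟨isSubalgebraBasis_X7_X8_X9_YX10, fun _ hU K =>
      isCompleteInvariantSet_X7_X8_X9_YX10 hU K⟩,
    fun a b => ⟨isSubalgebraBasis_X1_X4X7_X4X11_YX4 a b, fun _ hU K h0 =>
      isCompleteInvariantSet_X1_X4X7_X4X11_YX4 a b hU K h0⟩,
    ⟨isSubalgebraBasis_X1_X4_X7X10_YX10, fun _ hU K =>
      isCompleteInvariantSet_X1_X4_X7X10_YX10 hU K⟩,
    fun a b ha _ => ⟨isSubalgebraBasis_X2_X3_X7X10_YX1X10 a b, fun _ hU K =>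
      isCompleteInvariantSet_X2_X3_X7X10_YX1X10 a b ha hU K⟩,
    ⟨isSubalgebraBasis_X2_X3_X7X10_YX10, fun _ hU K =>
      isCompleteInvariantSet_X2_X3_X7X10_YX10 hU K⟩,
    ⟨isSubalgebraBasis_X1_X4_X11_YX7, fun _ hU K h0 =>
      isCompleteInvariantSet_X1_X4_X11_YX7 hU K h0⟩,
    fun a _ => ⟨isSubalgebraBasis_X1_X4_X10_YX7X11 a, fun _ hU K =>
      isCompleteInvariantSet_X1_X4_X10_YX7X11 a hU K⟩,
    ⟨isSubalgebraBasis_X1_X4_X10_YX11,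
      isCompleteInvariantSet_X1_X4_X10_YX11⟩,
    ⟨isSubalgebraBasis_X1_X4_X10_YX7, fun _ hU K =>
      isCompleteInvariantSet_X1_X4_X10_YX7 hU K⟩,
    fun ε a _ => ⟨isSubalgebraBasis_X2_X3_X4X10_YX1X7 ε a, fun _ hU K =>
      isCompleteInvariantSet_X2_X3_X4X10_YX1X7 ε a hU K⟩,
    fun a b ε _ _ => ⟨isSubalgebraBasis_X1X4_X3X5_X2X6_YX1X7 a b ε, fun _ hU K h0 =>
      isCompleteInvariantSet_X1X4_X3X5_X2X6_YX1X7 a b ε hU K h0⟩,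
    fun a ha => ⟨isSubalgebraBasis_X4_X5_X6_YX7X11 a, fun _ hU K =>
      isCompleteInvariantSet_X4_X5_X6_YX7X11 a ha hU K⟩,
    ⟨isSubalgebraBasis_X4_X5_X6_YX11,
      isCompleteInvariantSet_X4_X5_X6_YX11⟩,
    fun ε _ => ⟨isSubalgebraBasis_X4_X5_X6_YX1X7 ε, fun _ hU K =>
      isCompleteInvariantSet_X4_X5_X6_YX1X7 ε hU K⟩,
    fun a => ⟨isSubalgebraBasis_X1_X3X5_X2X6_YX4X7 a, fun _ hU K =>
      isCompleteInvariantSet_X1_X3X5_X2X6_YX4X7 a hU K⟩,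
    fun a b _ => ⟨isSubalgebraBasis_X1_X5_X6_YX4X7X11 a b, fun _ hU K =>
      isCompleteInvariantSet_X1_X5_X6_YX4X7X11 a b hU K⟩,
    fun a => ⟨isSubalgebraBasis_X1_X5_X6_YX4X11 a,
      isCompleteInvariantSet_X1_X5_X6_YX4X11 a⟩,
    fun b => ⟨isSubalgebraBasis_X1_X5_X6_YX4X7 b, fun _ hU K =>
      isCompleteInvariantSet_X1_X5_X6_YX4X7 b hU K⟩,
    fun a _ => ⟨isSubalgebraBasis_X2_X3_X4_YX7X11 a, fun _ hU K h0 =>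
      isCompleteInvariantSet_X2_X3_X4_YX7X11 a hU K h0⟩,
    ⟨isSubalgebraBasis_X2_X3_X4_YX11,
      isCompleteInvariantSet_X2_X3_X4_YX11⟩,
    fun ε _ => ⟨isSubalgebraBasis_X2_X3_X4_YX1X7 ε, fun _ hU K h0 =>
      isCompleteInvariantSet_X2_X3_X4_YX1X7 ε hU K h0⟩,
    fun a b c d hd _ => ⟨isSubalgebraBasis_X1_X2_X4_YX5X6X10X11 a b c d,
      isCompleteInvariantSet_X1_X2_X4_YX5X6X10X11 a b c d hd⟩,
    fun a b => ⟨isSubalgebraBasis_X1_X2_X4_YX5X6X10 a b,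
      isCompleteInvariantSet_X1_X2_X4_YX5X6X10 a b⟩,
    fun a c hc => ⟨isSubalgebraBasis_X1_X2_X3_YX4X7X11 a c, fun _ hU K h0 =>
      isCompleteInvariantSet_X1_X2_X3_YX4X7X11 a c hc hU K h0⟩,
    fun a => ⟨isSubalgebraBasis_X1_X2_X3_YX4X7 a, fun _ hU K =>
      isCompleteInvariantSet_X1_X2_X3_YX4X7 a hU K⟩,
    fun a => ⟨isSubalgebraBasis_X1_X2_X3_YX4X7X10 a, fun _ hU K =>
      isCompleteInvariantSet_X1_X2_X3_YX4X7X10 a hU K⟩,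
    ⟨isSubalgebraBasis_X1_X2_X3_YX4,
      isCompleteInvariantSet_X1_X2_X3_YX4⟩⟩
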